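/- **Conventions.** $R$ is a principal ideal domain, $P(R)$ is its set of primes up to units, and all sheaves are sheaves of $R$-modules. For an open cone write $cL=L\times[0,1)/L\times\{0\}$, with $c\emptyset$ a point. An *$n$-dimensional CS set* is a paracompact Hausdorff space $|X|$ with a filtration by closed subsets $X=X^n\supset X^{n-1}\supset\cdots\supset X^0\supset X^{-1}=\emptyset$ such that: $X_k:=X^k-X^{k-1}$ is a (possibly empty) topological $k$-manifold; each $x\in X_k$ has an open neighborhood $B$ in $X_k$, an open neighborhood $N$ in $X$, a compact filtered space $L$ (possibly empty, of formal dimension $n-k-1$) and a homeomorphism $h:B\times cL\to N$ with $h(B\times c(L^j))=X^{k+j+1}\cap N$ for all $j$ (here $c(L^{-1})$ is the cone vertex, and $c(L^j)=\emptyset$ for $j<-1$); and $X-X^{n-1}$ is dense. The *strata* of dimension $k$ are the connected components of $X_k$. A stratification *refines* another one of the same space if each stratum of the latter is a union of strata of the former. A *ts-coefficient system* on a space $M$ is a complex $\mathcal E$ of sheaves on $M$ such that for each connected component of $M$ there is a set $\wp\subset P(R)$ for which, on that component, $\mathcal H^1(\mathcal E)$ is locally constant with finitely generated $\wp$-torsion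 stalks and $\mathcal H^0(\mathcal E)$ is locally constant with finitely generated $\wp$-torsion free stalks, and $\mathcal H^i(\mathcal E)=0$ for $i\ne 0,1$. (An element is $\wp$-torsion if it is killed by a finite product of primes in $\wp$.) A *maximal ts-coefficient system* on $|X|$ is a ts-coefficient system $\mathcal E$ on an open $n$-manifold $U_{\mathcal E}\subset |X|$ whose complement has codimension $\ge 2$, such that $\mathcal E$ does not extend, up to isomorphism in the derived category, to a ts-coefficient system on a larger open $n$-manifold in $|X|$. A stratification $X$ is *fully adapted* to $\mathcal E$ if $X-X^{n-1}\subset U_{\mathcal E}$ and $U_{\mathcal E}$ is a union of strata of $X$. For a subset $C\subset|X|$, write $x\sim y$ if there is a homeomorphism $h:(U_x,x)\to(U_y,y)$ between open neighborhoods of $x$ and $y$ such that $h(U_x\cap C)=U_y\cap C$, $h(U_x\cap U_{\mathcal E})=U_y\cap U_{\mathcal E}$, and $h^*(\mathcal E|_{U_y\cap U_{\mathcal E}})\cong\mathcal E|_{U_x\cap U_{\mathcal E}}$ in the derived category. Let $\mathfrak X^i_{\mathcal E,C}$ be the union of the $\sim$-equivalence classes made up only of strata of $X$ of dimension $\le i$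 (that is, the classes contained in $X^i$), and let $\mathfrak X=\mathfrak X_{\mathcal E,C}$ be $|X|$ with these skeleta, the *intrinsic stratification of $X$ rel $(\mathcal E,C)$*. **Proposition.** Let $X$ be an $n$-dimensional CS set fully adapted to the maximal ts-coefficient system $\mathcal E$ with domain the open $n$-manifold $U_{\mathcal E}$, and let $C$ be a closed union of strata of $X$ of codimension $\ge 1$. Then: 1. The sets $\mathfrak X^i_{\mathcal E,C}$ filter $|X|$ as an $n$-dimensional CS set. 2. If $x$ and $y$ are in the same stratum of $\mathfrak X_{\mathcal E,C}$, then $x\sim y$. 3. $C$ is a union of strata of $\mathfrak X_{\mathcal E,C}$. 4. $\mathfrak X-\mathfrak X^{n-1}=U_{\mathcal E}-C$. 5. $\mathfrak X_{\mathcal E,C}$ is fully adapted to $\mathcal E$. 6. If $\mathcal X$ is another $n$-dimensional CS set stratification of $|X|$ that is fully adapted to $\mathcal E$ and such that $C$ is also a union of strata of $\mathcal X$, then the intrinsic stratification of $\mathcal X$ rel $(\mathcal E,C)$ is the same $\mathfrak X_{\mathcal E,C}$. 7. Every such $\mathcal X$ refines $\mathfrak X_{\mathcal E,C}$: each stratum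 of $\mathfrak X_{\mathcal E,C}$ is a union of strata of $\mathcal X$. Moreover, for each $k\ge 1$ let $C_k$ be the closure of the union of the strata of $X$ of codimension $k$. Then: 8. $C_k$ is a (closed) union of strata of $X$ of codimension $\ge 1$, and $C_k$ is also the closure of the union of the strata of $\mathfrak X_{\mathcal E,C_k}$ of codimension $k$. -/

import Mathlib

open CategoryTheory TopologicalSpace Topology

universe u

noncomputable section

namespace IntrinsicStrat

/-! ### Open cones -/

/-- The points of `pt ⊔ (L × [0,1))` that are collapsed to the cone vertex. -/
def coneApex (L : Type u) : Unit ⊕ (L × Set.Ico (0 : ℝ) 1) → Prop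
  | Sum.inl _ => True
  | Sum.inr p => (p.2 : ℝ) = 0

/-- The relation on `pt ⊔ (L × [0,1))` that collapses `pt ⊔ (L × {0})` to one point. -/
def coneSetoid (L : Type u) : Setoid (Unit ⊕ (L × Set.Ico (0 : ℝ) 1)) where
  r a b := a = b ∨ (coneApex L a ∧ coneApex L b)
  iseqv :=
    { refl := fun _ => Or.inl rfl
      symm := by
        rintro a b (h | h)
        · exact Or.inl h.symm
        · exact Or.inr h.symm
      trans := by
        rintro a b c (rfl | h) (rfl | h')
        · exact Or.inl rfl
        · exact Or.inr h'
        · exact Or.inr h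
        · exact Or.inr ⟨h.1, h'.2⟩ }

/-- The open cone `cL = L × [0,1) / L × {0}`, with the convention that `c∅` is a point
(the extra point `pt` is there only for the sake of this convention). -/
def OpenCone (L : Type u) : Type u := Quotient (coneSetoid L)

instance (L : Type u) [TopologicalSpace L] : TopologicalSpace (OpenCone L) :=
  inferInstanceAs (TopologicalSpace (Quotient (coneSetoid L)))

/-- The vertex of the open cone. -/
def OpenCone.vertex (L : Type u) : OpenCone L := Quotient.mk (coneSetoid L) (Sum.inl ())

/-- The point `[l, t]` of the open cone. -/
def OpenCone.point {L : Type u} (l : L) (t : Set.Ico (0 : ℝ) 1) : OpenCone L :=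
  Quotient.mk (coneSetoid L) (Sum.inr (l, t))

/-- The subset `c(L^j)` of `cL` for a filtration `G` of `L`. It contains the vertex for every
`j ≥ -1` (for instance `c(L^{-1}) = c∅` is the vertex) and is empty for `j < -1`. -/
def coneSkel {L : Type u} (G : ℤ → Set L) (j : ℤ) : Set (OpenCone L) :=
  {c | -1 ≤ j ∧ (c = OpenCone.vertex L ∨ ∃ l ∈ G j, ∃ t, c = OpenCone.point l t)}

/-! ### CS sets -/

section CSSets

variable {X : Type u} [TopologicalSpace X]

/-- A filtration `F` by closed subsets `F i = X^i`, indexed by all integers, of formal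
dimension `d`: `X^i = ∅` for `i < 0` and `X^d = X`. -/
structure IsFiltration (d : ℤ) (F : ℤ → Set X) : Prop where
  closed : ∀ i, IsClosed (F i)
  mono : Monotone F
  neg : ∀ i, i < 0 → F i = ∅
  top : F d = Set.univ

/-- `X_k = X^k - X^{k-1}`. -/
def layer (F : ℤ → Set X) (k : ℤ) : Set X := F k \ F (k - 1)

/-- The subspace `A` is a topological `k`-manifold: it is locally Euclidean of dimension `k`. (It is
only used for subspaces of paracompact CS sets; these are metrizable, so that subspaces are
automatically Hausdorff and paracompact.) -/
def IsManifoldSet (k : ℕ) (A : Set X) : Prop :=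
  Nonempty (ChartedSpace (EuclideanSpace ℝ (Fin k)) A)

/-- `x ∈ X_k` has a distinguished neighborhood in the `n`-dimensional filtered space `(X, F)`:
there are an open neighborhood `B` of `x` in `X_k`, an open neighborhood `N` of `x` in `X`, a
compact filtered space `L` (possibly empty) of formal dimension `n - k - 1`, and a homeomorphism
`h : B × cL → N` with `h(B × c(L^j)) = X^{k+j+1} ∩ N` for all `j`. -/
def HasDistinguishedNhd (n : ℕ) (F : ℤ → Set X) (k : ℕ) (x : X) : Prop :=
  ∃ (B : Set X) (N : Opens X) (L : Type u) (_ : TopologicalSpace L) (_ : CompactSpace L)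
    (G : ℤ → Set L) (h : (B × OpenCone L) ≃ₜ N),
    x ∈ B ∧ (∃ O : Set X, IsOpen O ∧ B = O ∩ layer F k) ∧ x ∈ N ∧
    IsFiltration ((n : ℤ) - k - 1) G ∧
    ∀ j : ℤ, (fun p => (h p : X)) '' {p | p.2 ∈ coneSkel G j} = F (k + j + 1) ∩ N

/-- `F` makes the (paracompact Hausdorff) space `X` into a dimensionally homogeneous
`n`-dimensional CS set. -/
structure IsCSSet (n : ℕ) (F : ℤ → Set X) : Prop where
  filtration : IsFiltration n F
  manifold : ∀ k : ℕ, IsManifoldSet k (layer F k)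
  local_cone : ∀ (k : ℕ), ∀ x ∈ layer F k, HasDistinguishedNhd n F k x
  dense : Dense (F ((n : ℤ) - 1))ᶜ

/-- `S` is a stratum of dimension `k`: a connected component of `X_k`. -/
def IsStratumOfDim (F : ℤ → Set X) (k : ℤ) (S : Set X) : Prop :=
  ∃ x ∈ layer F k, S = connectedComponentIn (layer F k) x

/-- `S` is a stratum. -/
def IsStratum (F : ℤ → Set X) (S : Set X) : Prop := ∃ k, IsStratumOfDim F k S

/-- `A` is a union of strata. -/
def IsUnionOfStrata (F : ℤ → Set X) (A : Set X) : Prop :=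
  ∃ 𝒮 : Set (Set X), (∀ S ∈ 𝒮, IsStratum F S) ∧ A = ⋃₀ 𝒮

/-- `A` is a union of strata of codimension at least one (in dimension `n`). -/
def IsUnionOfSingularStrata (n : ℕ) (F : ℤ → Set X) (A : Set X) : Prop :=
  ∃ 𝒮 : Set (Set X), (∀ S ∈ 𝒮, ∃ k : ℤ, k ≤ (n : ℤ) - 1 ∧ IsStratumOfDim F k S) ∧ A = ⋃₀ 𝒮

/-- The stratification `F` refines `F'` (equivalently, `F'` coarsens `F`): each stratum of `F'` is
a union of strata of `F`. -/
def Refines (F F' : ℤ → Set X) : Prop := ∀ S, IsStratum F' S → IsUnionOfStrata F S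

/-- The closure `C_k` of the union of the strata of codimension `k`. -/
def closureCodim (n : ℕ) (F : ℤ → Set X) (k : ℕ) : Set X :=
  closure (⋃₀ {S | IsStratumOfDim F ((n : ℤ) - k) S})

end CSSets

/-- The (Čech–Lebesgue) covering dimension of `Y` is less than `m`: every finite open cover has an
open refinement, still a cover, such that each point lies in at most `m` of its members. For
`m = 0` this says that `Y` is empty. -/
def CoveringDimLT (Y : Type u) [TopologicalSpace Y] (m : ℕ) : Prop :=
  ∀ 𝒰 : Set (Opens Y), 𝒰.Finite → (∀ y, ∃ V ∈ 𝒰, y ∈ V) →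
    ∃ 𝒱 : Set (Opens Y), (∀ y, ∃ V ∈ 𝒱, y ∈ V) ∧ (∀ V ∈ 𝒱, ∃ V' ∈ 𝒰, V ≤ V') ∧
      ∀ y, {V ∈ 𝒱 | y ∈ V}.encard ≤ m

/-! ### Sheaf complexes -/

section Sheaves

variable (R : Type u) [CommRing R]

/-- Complexes of sheaves of `R`-modules on the space `Y`. -/
abbrev SheafComplex (Y : Type u) [TopologicalSpace Y] :=
  CochainComplex (TopCat.Sheaf (ModuleCat.{u} R) (TopCat.of Y)) ℤ

variable {R}

section

variable {Y Z : Type u} [TopologicalSpace Y] [TopologicalSpace Z]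

/-- The inverse image of sheaves along an open embedding. -/
def sheafPull {f : Y → Z} (hf : IsOpenEmbedding f) :
    TopCat.Sheaf (ModuleCat.{u} R) (TopCat.of Z) ⥤ TopCat.Sheaf (ModuleCat.{u} R) (TopCat.of Y) :=
  IsOpenEmbedding.sheafPullback (X := TopCat.of Y) (Y := TopCat.of Z)
    (f := TopCat.ofHom ⟨f, hf.continuous⟩) (ModuleCat.{u} R) hf

instance {f : Y → Z} (hf : IsOpenEmbedding f) : (sheafPull (R := R) hf).Additive where
  map_add := rfl

/-- The inverse image `f^* E` of a sheaf complex along an open embedding `f`. -/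
def complexPull {f : Y → Z} (hf : IsOpenEmbedding f) (E : SheafComplex R Z) : SheafComplex R Y :=
  ((sheafPull (R := R) hf).mapHomologicalComplex (ComplexShape.up ℤ)).obj E

/-- `E` and `E'` are isomorphic in the derived category of sheaves of `R`-modules on `Y`. -/
def DerivedIso (E E' : SheafComplex R Y) : Prop :=
  letI := HasDerivedCategory.standard (TopCat.Sheaf (ModuleCat.{u} R) (TopCat.of Y))
  Nonempty (DerivedCategory.Q.obj E ≅ DerivedCategory.Q.obj E')

/-- Near `y` the sheaf `A` is (isomorphic to) the constant sheaf with some stalk `M` that has the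
property `P`. -/
def IsConstantNear (P : ModuleCat.{u} R → Prop)
    (A : TopCat.Sheaf (ModuleCat.{u} R) (TopCat.of Y)) (y : Y) : Prop :=
  ∃ V : Opens Y, y ∈ V ∧ ∃ M : ModuleCat.{u} R, P M ∧
    Nonempty ((sheafPull V.isOpenEmbedding').obj A ≅
      (constantSheaf (Opens.grothendieckTopology (TopCat.of V)) (ModuleCat.{u} R)).obj M)

end

variable (R) in
/-- The set `P(R)` of primes of `R` up to units. -/
abbrev PrimeClass : Type u := {p : Associates R // Prime p}

/-- The finite products of powers of primes whose class lies in `℘`. -/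
def primeProducts (℘ : Set (PrimeClass R)) : Submonoid R :=
  Submonoid.closure {p | ∃ c ∈ ℘, (c : Associates R) = Associates.mk p}

/-- The `℘`-torsion submodule `T^℘ M`. -/
def torsionPart (℘ : Set (PrimeClass R)) (M : ModuleCat.{u} R) : Submodule R M :=
  Submodule.torsion' R M (primeProducts ℘)

/-- The complex `E` on `Y` is a ts-coefficient system: on each connected component there is a set
`℘` of primes (which may vary with the component) such that `H^1(E)` is locally constant with
finitely generated `℘`-torsion stalks, `H^0(E)` is locally constant with finitely generated
`℘`-torsion free stalks, and the other cohomology sheaves vanish. -/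
def IsTSCoefficientSystem {Y : Type u} [TopologicalSpace Y] (E : SheafComplex R Y) : Prop :=
  (∃ ℘ : ConnectedComponents Y → Set (PrimeClass R), ∀ y : Y,
    IsConstantNear (fun M => Module.Finite R M ∧ torsionPart (℘ (y : ConnectedComponents Y)) M = ⊤)
      (E.homology 1) y ∧
    IsConstantNear (fun M => Module.Finite R M ∧ torsionPart (℘ (y : ConnectedComponents Y)) M = ⊥)
      (E.homology 0) y) ∧
  ∀ i : ℤ, i ≠ 0 → i ≠ 1 → Limits.IsZero (E.homology i)

variable {X : Type u} [TopologicalSpace X]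

/-- `E`, defined on the open set `U ⊆ X`, is a maximal ts-coefficient system on the `n`-dimensional
space `X` with `U_E = U`: `U` is an `n`-manifold whose complement has codimension at least two
(that is, dimension at most `n - 2`; the complement is empty if `n ≤ 1`), `E` is a ts-coefficient
system on `U`, and `E` does not extend, up to isomorphism in the derived category, to a
ts-coefficient system on a larger open `n`-manifold in `X`. -/
structure IsMaximalTSCoefficientSystem (n : ℕ) (U : Opens X) (E : SheafComplex R U) : Prop where
  manifold : IsManifoldSet n (U : Set X)
  codim : CoveringDimLT ((U : Set X)ᶜ : Set X) (n - 1)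
  coeff : IsTSCoefficientSystem E
  maximal : ∀ (V : Opens X) (hUV : U ≤ V), IsManifoldSet n (V : Set X) →
    ∀ E' : SheafComplex R V, IsTSCoefficientSystem E' →
      DerivedIso (complexPull (Opens.isOpenEmbedding_of_le hUV) E') E → V = U

/-- The stratification `F` is fully adapted to a (maximal) ts-coefficient system with domain `U`:
`X - X^{n-1} ⊆ U`, and `U` is a union of strata. -/
def FullyAdapted (n : ℕ) (F : ℤ → Set X) (U : Opens X) : Prop :=
  (F ((n : ℤ) - 1))ᶜ ⊆ (U : Set X) ∧ IsUnionOfStrata F (U : Set X)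

/-! ### The intrinsic stratification -/

/-- The homeomorphism `A ∩ U → B ∩ U` induced by a homeomorphism `h : A → B` that preserves `U`. -/
def restrictHomeo {A B U : Opens X} (h : A ≃ₜ B) (hU : ∀ z : A, (z : X) ∈ U ↔ (h z : X) ∈ U) :
    (A ⊓ U : Opens X) ≃ₜ (B ⊓ U : Opens X) where
  toFun z := ⟨h ⟨z, z.2.1⟩, (h ⟨z, z.2.1⟩).2, (hU ⟨z, z.2.1⟩).1 z.2.2⟩
  invFun w := ⟨h.symm ⟨w, w.2.1⟩, (h.symm ⟨w, w.2.1⟩).2,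
    (hU (h.symm ⟨w, w.2.1⟩)).2 (by rw [h.apply_symm_apply]; exact w.2.2)⟩
  left_inv z := by simp
  right_inv w := by simp
  continuous_toFun := by fun_prop
  continuous_invFun := by fun_prop

/-- The restriction of the sheaf complex `E` on `U` to `A ∩ U`. -/
def restrictTo {U : Opens X} (E : SheafComplex R U) (A : Opens X) :
    SheafComplex R (A ⊓ U : Opens X) :=
  complexPull (Opens.isOpenEmbedding_of_le (inf_le_right : A ⊓ U ≤ U)) E

/-- The relation `x ∼ y` rel `(E, C)`: there is a homeomorphism of pairs `h : (A, x) → (B, y)`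
between open neighborhoods with `h(A ∩ C) = B ∩ C`, `h(A ∩ U) = B ∩ U` and
`h^*(E|_{B ∩ U}) ≅ E|_{A ∩ U}` in the derived category. -/
def LocEquiv (U : Opens X) (E : SheafComplex R U) (C : Set X) (x y : X) : Prop :=
  ∃ (A B : Opens X) (hx : x ∈ A) (hy : y ∈ B) (h : A ≃ₜ B),
    h ⟨x, hx⟩ = ⟨y, hy⟩ ∧ (∀ z : A, (z : X) ∈ C ↔ (h z : X) ∈ C) ∧
    ∃ hU : ∀ z : A, (z : X) ∈ U ↔ (h z : X) ∈ U,
      DerivedIso (complexPull (restrictHomeo h hU).isOpenEmbedding (restrictTo E B))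
        (restrictTo E A)

/-- The skeleta of the intrinsic stratification of `(X, F)` rel `(E, C)`: the `i`-th one is the
union of the equivalence classes made up only of strata of dimension at most `i`, that is, of the
equivalence classes contained in `X^i`. -/
def intrinsic (U : Opens X) (E : SheafComplex R U) (C : Set X) (F : ℤ → Set X) : ℤ → Set X :=
  fun i => {x | {y | LocEquiv U E C x y} ⊆ F i}

end Sheaves

end IntrinsicStrat

end

/-! Everything rests on one fact: two points of the same stratum of a CS set are equivalent. Near a
point of a `k`-stratum the space is `ℝ^k × cL`. Each slice `ℝ^k × {q}` is connected and lies in one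
layer, so translations of `ℝ^k` preserve every union of strata, in particular `U` and `C`. What
remains is that `E` is isomorphic in the derived category to its translate.

`UnitFlow.derivedIso_pull` provides this for any complex with bounded below, locally constant
cohomology and any flow that moves a real coordinate at unit speed. Replace the complex by a bounded
below complex `I` of injective, hence flasque, sheaves. Consider germs of global sections of `I`
along the sets `{T s w | w ∈ W, 0 ≤ s ≤ 1}`. Such germs restrict to `T 0 '' W` and to `T 1 '' W`.
Cohomology classes continue uniquely along a flow segment, so both restrictions are
quasi-isomorphisms on stalks. Hence `I` and its translate by time one are both isomorphic to the
sheafified complex of germs. `LocEquiv.translate` and `IsCSSet.locEquiv` carry this over to strata.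

The rest is formal, except for one use of invariance of dimension. The intrinsic skeleta are closed
since an equivalence moves whole neighborhoods. In a class whose maximal stratum dimension is `k`, a
point on a `k`-stratum keeps its chart `ℝ^k × cL`, with a coarser filtration of `L`
(`IsCSSet.coneChart_intrinsic_of_mem`); equivalence transports the chart to the rest of the class.
The classes are open in the intrinsic layers, so they are constant on intrinsic strata. Invariance
of `C` and `U` makes them unions of strata, and density of the top stratum of `X` identifies the new
top stratum.

For two stratifications, the intrinsic dimension at `x` is in both cases the dimension of the
manifold formed by the points near `x` equivalent to `x`. So `intrinsic_eq` reduces to the fact that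
an injective continuous map `ℝ^m → ℝ^n` forces `m ≤ n` (`le_of_continuous_injective`), proved from
the no-retraction theorem. Refinement holds because each stratum of the finer structure is connected
and lies in one class. For `C_k`, the closure of a layer is locally a product with `ℝ^k`, hence a
union of strata, and the relation rel `C_k` cannot leave `C_k` (`closure_layer_intrinsic`). -/

noncomputable section

namespace IntrinsicStrat

/-! ### Exactness and functoriality of inverse images along open embeddings. -/

section Derived

variable {R : Type u} [CommRing R]

/-- Precomposition with the image functor on open sets has a left adjoint; being isomorphic to the
usual inverse image, it also has a right adjoint. So it is exact, acts on derived categories and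
commutes with homology sheaves. -/
instance sheafPull_preservesFiniteLimits {Y Z : Type u} [TopologicalSpace Y] [TopologicalSpace Z]
    {f : Y → Z} (hf : IsOpenEmbedding f) :
    Limits.PreservesFiniteLimits (sheafPull (R := R) hf) := by
  have h := IsOpenEmbedding.functor_isContinuous (X := TopCat.of Y) (Y := TopCat.of Z)
    (f := TopCat.ofHom ⟨f, hf.continuous⟩) hf
  have : (sheafPull (R := R) hf).IsRightAdjoint :=
    (Functor.sheafAdjunctionContinuous
      (IsOpenEmbedding.isOpenMap (f := TopCat.ofHom ⟨f, hf.continuous⟩) hf).functor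
      (ModuleCat.{u} R) (Opens.grothendieckTopology (TopCat.of Y))
      (Opens.grothendieckTopology (TopCat.of Z))).isRightAdjoint
  infer_instance

instance sheafPull_preservesFiniteColimits {Y Z : Type u} [TopologicalSpace Y] [TopologicalSpace Z]
    {f : Y → Z} (hf : IsOpenEmbedding f) :
    Limits.PreservesFiniteColimits (sheafPull (R := R) hf) := by
  have : (sheafPull (R := R) hf).IsLeftAdjoint :=
    Functor.isLeftAdjoint_of_iso (IsOpenEmbedding.sheafPullbackIso (X := TopCat.of Y)
      (Y := TopCat.of Z) (f := TopCat.ofHom ⟨f, hf.continuous⟩) (ModuleCat.{u} R) hf)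
  infer_instance

variable {Y Z W : Type u} [TopologicalSpace Y] [TopologicalSpace Z] [TopologicalSpace W]

lemma DerivedIso.refl (E : SheafComplex R Y) : DerivedIso E E :=
  letI := HasDerivedCategory.standard (TopCat.Sheaf (ModuleCat.{u} R) (TopCat.of Y))
  ⟨Iso.refl _⟩

lemma DerivedIso.symm {E E' : SheafComplex R Y} (h : DerivedIso E E') : DerivedIso E' E :=
  letI := HasDerivedCategory.standard (TopCat.Sheaf (ModuleCat.{u} R) (TopCat.of Y))
  ⟨h.some.symm⟩

lemma DerivedIso.trans {E E' E'' : SheafComplex R Y} (h : DerivedIso E E')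
    (h' : DerivedIso E' E'') : DerivedIso E E'' :=
  letI := HasDerivedCategory.standard (TopCat.Sheaf (ModuleCat.{u} R) (TopCat.of Y))
  ⟨h.some ≪≫ h'.some⟩

lemma DerivedIso.of_quasiIso {E E' : SheafComplex R Y} (f : E ⟶ E') [QuasiIso f] :
    DerivedIso E E' :=
  letI := HasDerivedCategory.standard (TopCat.Sheaf (ModuleCat.{u} R) (TopCat.of Y))
  ⟨asIso (DerivedCategory.Q.map f)⟩

lemma DerivedIso.of_iso {E E' : SheafComplex R Y} (e : E ≅ E') : DerivedIso E E' :=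
  .of_quasiIso e.hom

lemma DerivedIso.pull {f : Y → Z} (hf : IsOpenEmbedding f) {E E' : SheafComplex R Z}
    (h : DerivedIso E E') : DerivedIso (complexPull hf E) (complexPull hf E') := by
  let := HasDerivedCategory.standard (TopCat.Sheaf (ModuleCat.{u} R) (TopCat.of Y))
  let := HasDerivedCategory.standard (TopCat.Sheaf (ModuleCat.{u} R) (TopCat.of Z))
  obtain ⟨e⟩ := h
  let F := sheafPull (R := R) hf
  exact ⟨(F.mapDerivedCategoryFactors.symm.app E ≪≫ F.mapDerivedCategory.mapIso e ≪≫
    F.mapDerivedCategoryFactors.app E' :)⟩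

/-- The image of an open set under an open embedding. -/
def openImage {f : Y → Z} (hf : IsOpenEmbedding f) (V : Opens Y) : Opens Z :=
  ⟨f '' V, hf.isOpenMap _ V.2⟩

@[simp] lemma mem_openImage {f : Y → Z} (hf : IsOpenEmbedding f) (V : Opens Y) (z : Z) :
    z ∈ openImage hf V ↔ ∃ y ∈ V, f y = z := Iff.rfl

/-- Inverse image along a composition of open embeddings. -/
def sheafPullComp {f : Y → Z} {g : Z → W} {k : Y → W} (hf : IsOpenEmbedding f)
    (hg : IsOpenEmbedding g) (hk : IsOpenEmbedding k) (h : ∀ y, g (f y) = k y) :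
    sheafPull (R := R) hg ⋙ sheafPull hf ≅ sheafPull hk :=
  NatIso.ofComponents (fun F => (fullyFaithfulSheafToPresheaf _ _).preimageIso
    (NatIso.ofComponents (fun V => F.obj.mapIso (eqToIso (congrArg Opposite.op
      (show openImage hg (openImage hf V.unop) = openImage hk V.unop by
        ext w
        simp [← h]))))
      (fun {V V'} i => by
        refine (F.obj.map_comp _ _).symm.trans (Eq.trans ?_ (F.obj.map_comp _ _))
        congr 1)))
    (fun {F G} φ => by
      refine ObjectProperty.hom_ext _ (NatTrans.ext (funext fun V => ?_))
      have := φ.hom.naturality (eqToHom (congrArg Opposite.op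
        (show openImage hg (openImage hf V.unop) = openImage hk V.unop by
          ext w
          simp [← h])))
      exact this.symm)

/-- Inverse image of sheaf complexes along a composition of open embeddings. -/
def complexPullComp {f : Y → Z} {g : Z → W} {k : Y → W} (hf : IsOpenEmbedding f)
    (hg : IsOpenEmbedding g) (hk : IsOpenEmbedding k) (h : ∀ y, g (f y) = k y)
    (E : SheafComplex R W) : complexPull hf (complexPull hg E) ≅ complexPull hk E :=
  (NatIso.mapHomologicalComplex (sheafPullComp (R := R) hf hg hk h) (ComplexShape.up ℤ)).app E

/-- Inverse image along the identity. -/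
def sheafPullId : sheafPull (R := R) (IsOpenEmbedding.id (X := Y)) ≅ 𝟭 _ :=
  NatIso.ofComponents (fun F => (fullyFaithfulSheafToPresheaf _ _).preimageIso
    (NatIso.ofComponents (fun V => F.obj.mapIso (eqToIso (congrArg Opposite.op
      (show openImage IsOpenEmbedding.id V.unop = V.unop by
        ext w
        simp))))
      (fun {V V'} i => by
        refine (F.obj.map_comp _ _).symm.trans (Eq.trans ?_ (F.obj.map_comp _ _))
        congr 1)))
    (fun {F G} φ => by
      refine ObjectProperty.hom_ext _ (NatTrans.ext (funext fun V => ?_))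
      have := φ.hom.naturality (eqToHom (congrArg Opposite.op
        (show openImage IsOpenEmbedding.id V.unop = V.unop by
          ext w
          simp)))
      exact this.symm)

/-- Inverse image of sheaf complexes along the identity. -/
def complexPullId (E : SheafComplex R Y) : complexPull IsOpenEmbedding.id E ≅ E :=
  (NatIso.mapHomologicalComplex (sheafPullId (R := R) (Y := Y)) (ComplexShape.up ℤ)).app E ≪≫
    (Functor.mapHomologicalComplexIdIso _ _).app E

/-- The homology sheaves of the inverse image. -/
def homologyPullIso {f : Y → Z} (hf : IsOpenEmbedding f) (E : SheafComplex R Z) (i : ℤ) :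
    (complexPull hf E).homology i ≅ (sheafPull hf).obj (E.homology i) :=
  (E.sc i).mapHomologyIso (sheafPull hf)

end Derived

/-! ### Sections of sheaves of modules, handled by elements. -/

section Sections

variable {R : Type u} [CommRing R] {Y : Type u} [TopologicalSpace Y]

variable (R Y) in
/-- Presheaves of `R`-modules on `Y`. -/
abbrev ModPresheaf := TopCat.Presheaf (ModuleCat.{u} R) (TopCat.of Y)

variable (R Y) in
/-- Sheaves of `R`-modules on `Y`. -/
abbrev ModSheaf := TopCat.Sheaf (ModuleCat.{u} R) (TopCat.of Y)

/-- The module of sections of a presheaf over an open set. -/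
abbrev sec (P : ModPresheaf R Y) (V : Opens Y) : ModuleCat.{u} R := P.obj (.op V)

/-- Restriction of sections. -/
def res (P : ModPresheaf R Y) {V W : Opens Y} (h : V ≤ W) : sec P W →ₗ[R] sec P V :=
  (P.map (homOfLE h).op).hom

/-- The map on sections induced by a morphism of presheaves. -/
def secMap {P Q : ModPresheaf R Y} (f : P ⟶ Q) (V : Opens Y) : sec P V →ₗ[R] sec Q V :=
  (f.app (.op V)).hom

@[simp] lemma res_self (P : ModPresheaf R Y) {V : Opens Y} (h : V ≤ V) (x : sec P V) :
    res P h x = x :=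
  ConcreteCategory.congr_hom (P.map_id (.op V)) x

@[simp] lemma res_res (P : ModPresheaf R Y) {V W T : Opens Y} (h : V ≤ W) (h' : W ≤ T)
    (x : sec P T) : res P h (res P h' x) = res P (h.trans h') x :=
  (ConcreteCategory.congr_hom (P.map_comp (homOfLE h').op (homOfLE h).op) x).symm

lemma secMap_res {P Q : ModPresheaf R Y} (f : P ⟶ Q) {V W : Opens Y} (h : V ≤ W) (x : sec P W) :
    secMap f V (res P h x) = res Q h (secMap f W x) :=
  ConcreteCategory.congr_hom (f.naturality (homOfLE h).op) x

@[simp] lemma secMap_comp {P Q T : ModPresheaf R Y} (f : P ⟶ Q) (g : Q ⟶ T) (V : Opens Y)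
    (x : sec P V) : secMap (f ≫ g) V x = secMap g V (secMap f V x) := rfl

lemma sheaf_ext (F : ModSheaf R Y) {W : Opens Y} {x x' : sec F.obj W}
    (h : ∀ y ∈ W, ∃ (V : Opens Y) (hV : V ≤ W), y ∈ V ∧ res F.obj hV x = res F.obj hV x') :
    x = x' := by
  choose V hV hy hx using h
  refine F.eq_of_locally_eq' (fun y : W => V y.1 y.2) W (fun y => homOfLE (hV y.1 y.2)) ?_ x x'
    (fun y => hx y.1 y.2)
  intro y hyW
  exact Opens.mem_iSup.2 ⟨⟨y, hyW⟩, hy y hyW⟩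

lemma sheaf_glue (F : ModSheaf R Y) {V W : Opens Y} (x : sec F.obj V) (x' : sec F.obj W)
    (h : res F.obj (inf_le_left : V ⊓ W ≤ V) x = res F.obj (inf_le_right : V ⊓ W ≤ W) x') :
    ∃ t : sec F.obj (V ⊔ W), res F.obj le_sup_left t = x ∧ res F.obj le_sup_right t = x' := by
  have key := F.existsUnique_gluing' (fun b : Bool => bif b then V else W) (V ⊔ W)
    (fun b => homOfLE (by cases b; exacts [le_sup_right, le_sup_left]))
    (by
      refine sup_le ?_ ?_
      · exact le_iSup (fun b : Bool => bif b then V else W) true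
      · exact le_iSup (fun b : Bool => bif b then V else W) false)
    (fun b => match b with
      | true => x
      | false => x')
    (by
      rintro (_ | _) (_ | _)
      · rfl
      · have h' := congrArg (res F.obj (show W ⊓ V ≤ V ⊓ W from le_of_eq (inf_comm _ _))) h
        rw [res_res, res_res] at h'
        exact h'.symm
      · exact h
      · rfl)
  obtain ⟨t, ht, -⟩ := key
  exact ⟨t, ht true, ht false⟩

variable {F G : ModSheaf R Y}

lemma secMap_injective (f : F ⟶ G) [Mono f] (V : Opens Y) : Function.Injective (secMap f.hom V) := by
  have h1 : Mono ((TopCat.Sheaf.forget (ModuleCat.{u} R) (TopCat.of Y)).map f) :=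
    inferInstance
  have h2 : Mono (f.hom.app (.op V)) := (NatTrans.mono_iff_mono_app f.hom).1 h1 (.op V)
  exact (ModuleCat.mono_iff_injective _).1 h2

lemma exists_local_lift (f : F ⟶ G) [hf : Epi f] {V : Opens Y} (t : sec G.obj V) {y : Y}
    (hy : y ∈ V) : ∃ (V' : Opens Y) (h : V' ≤ V), y ∈ V' ∧
      ∃ s : sec F.obj V', secMap f.hom V' s = res G.obj h t := by
  obtain ⟨V', h, ⟨s, hs⟩, hy'⟩ := (TopCat.Presheaf.isLocallySurjective_iff f.hom).1
    ((TopCat.Sheaf.isLocallySurjective_iff_epi f).2 hf) V t y hy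
  exact ⟨V', h, hy', s, hs⟩

/-- Taking sections over a fixed open set is left exact: passing to presheaves is left exact and
evaluation is exact. -/
lemma exists_lift_of_exact {S : ShortComplex (ModSheaf R Y)} (hS : S.Exact) (hf : Mono S.f)
    {V : Opens Y} (s : sec S.X₂.obj V) (hs : secMap S.g.hom V s = 0) :
    ∃ t : sec S.X₁.obj V, secMap S.f.hom V t = s := by
  have hS' := (((Functor.preservesFiniteLimits_tfae (TopCat.Sheaf.forget (ModuleCat.{u} R)
    (TopCat.of Y))).out 1 3 rfl rfl).mpr inferInstance S ⟨hS, hf⟩).left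
  let Γ := (evaluation (Opens Y)ᵒᵖ (ModuleCat.{u} R)).obj (.op V)
  exact ((ShortComplex.moduleCat_exact_iff _).1 (((Functor.exact_tfae Γ).out 1 3 rfl rfl).mpr
    ⟨inferInstance, inferInstance⟩ _ hS')) s hs

lemma exists_local_lift_of_exact {S : ShortComplex (ModSheaf R Y)} (hS : S.Exact)
    {V : Opens Y} (s : sec S.X₂.obj V) (hs : secMap S.g.hom V s = 0) {y : Y} (hy : y ∈ V) :
    ∃ (V' : Opens Y) (h : V' ≤ V), y ∈ V' ∧
      ∃ t : sec S.X₁.obj V', secMap S.f.hom V' t = res S.X₂.obj h s := by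
  -- The section lifts to the kernel over all of `V`; only the lift along the epimorphism onto the
  -- kernel requires shrinking.
  obtain ⟨z, rfl⟩ := exists_lift_of_exact (S := ShortComplex.mk S.iCycles S.g S.iCycles_g)
    (ShortComplex.exact_of_f_is_kernel _ S.cyclesIsKernel) inferInstance s hs
  have := hS.epi_toCycles
  obtain ⟨V', h, hy', t, ht⟩ := exists_local_lift S.toCycles z hy
  refine ⟨V', h, hy', t, ?_⟩
  dsimp only
  rw [← secMap_res, ← ht, ← secMap_comp]
  exact congrArg (fun f => secMap (InducedCategory.Hom.hom f) V' t) S.toCycles_i.symm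

end Sections

/-! ### Cocycles that represent sections of the homology sheaves. -/

section Classes

variable {R : Type u} [CommRing R] {Y : Type u} [TopologicalSpace Y]

lemma secMap_hom_comp {F G H : ModSheaf R Y} {f : F ⟶ G} {g : G ⟶ H} {k : F ⟶ H} (h : f ≫ g = k)
    (V : Opens Y) (x : sec F.obj V) : secMap g.hom V (secMap f.hom V x) = secMap k.hom V x := by
  subst h
  rfl

/-- Sections of the `i`-th sheaf of a complex. -/
abbrev csec (I : SheafComplex R Y) (i : ℤ) (V : Opens Y) : ModuleCat.{u} R := sec (I.X i).obj V

/-- Restriction of sections of a sheaf complex. -/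
abbrev cres (I : SheafComplex R Y) (i : ℤ) {V W : Opens Y} (h : V ≤ W) :
    csec I i W →ₗ[R] csec I i V := res (I.X i).obj h

/-- The differential on sections of a sheaf complex. -/
abbrev cd (I : SheafComplex R Y) (i j : ℤ) (V : Opens Y) : csec I i V →ₗ[R] csec I j V :=
  secMap (I.d i j).hom V

lemma cd_cd (I : SheafComplex R Y) (i j k : ℤ) (V : Opens Y) (x : csec I i V) :
    cd I j k V (cd I i j V x) = 0 := by
  rw [cd, cd, secMap_hom_comp (I.d_comp_d i j k)]
  rfl

lemma cd_cres (I : SheafComplex R Y) (i j : ℤ) {V W : Opens Y} (h : V ≤ W) (x : csec I i W) :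
    cd I i j V (cres I i h x) = cres I j h (cd I i j W x) := secMap_res _ h x

variable (I : SheafComplex R Y) {i j k : ℤ}

/-- The section `s` of the homology sheaf is the class of the cocycle `a`. -/
def IsClass (i : ℤ) {V : Opens Y} (a : csec I i V) (s : sec (I.homology i).obj V) : Prop :=
  ∃ z : sec (I.cycles i).obj V, secMap (I.iCycles i).hom V z = a ∧
    secMap (I.homologyπ i).hom V z = s

variable {I}

lemma IsClass.res {V W : Opens Y} (h : V ≤ W) {a : csec I i W} {s : sec (I.homology i).obj W}
    (H : IsClass I i a s) : IsClass I i (cres I i h a) (IntrinsicStrat.res _ h s) := by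
  obtain ⟨z, rfl, rfl⟩ := H
  exact ⟨IntrinsicStrat.res _ h z, secMap_res _ h z, secMap_res _ h z⟩

lemma IsClass.sub {V : Opens Y} {a a' : csec I i V} {s s' : sec (I.homology i).obj V}
    (H : IsClass I i a s) (H' : IsClass I i a' s') : IsClass I i (a - a') (s - s') := by
  obtain ⟨z, rfl, rfl⟩ := H
  obtain ⟨z', rfl, rfl⟩ := H'
  exact ⟨z - z', map_sub _ _ _, map_sub _ _ _⟩

lemma IsClass.d_eq_zero {V : Opens Y} {a : csec I i V} {s : sec (I.homology i).obj V}
    (H : IsClass I i a s) : cd I i j V a = 0 := by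
  obtain ⟨z, rfl, rfl⟩ := H
  rw [cd, secMap_hom_comp (I.iCycles_d i j)]
  rfl

lemma IsClass.unique {V : Opens Y} {a : csec I i V} {s s' : sec (I.homology i).obj V}
    (H : IsClass I i a s) (H' : IsClass I i a s') : s = s' := by
  obtain ⟨z, hz, rfl⟩ := H
  obtain ⟨z', hz', rfl⟩ := H'
  rw [secMap_injective (I.iCycles i) V (hz.trans hz'.symm)]

lemma isClass_d {V : Opens Y} (b : csec I i V) : IsClass I j (cd I i j V b) 0 := by
  refine ⟨secMap (I.toCycles i j).hom V b, secMap_hom_comp (I.toCycles_i i j) V b, ?_⟩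
  rw [secMap_hom_comp (I.toCycles_comp_homologyπ i j)]
  rfl

lemma exists_isClass (hij : i + 1 = j) {V : Opens Y} {a : csec I i V} (ha : cd I i j V a = 0) :
    ∃ s, IsClass I i a s := by
  obtain ⟨z, hz⟩ := exists_lift_of_exact
    (S := ShortComplex.mk (I.iCycles i) (I.d i j) (I.iCycles_d i j))
    (ShortComplex.exact_of_f_is_kernel _ (I.cyclesIsKernel i j (by simp [← hij])))
    inferInstance a ha
  exact ⟨_, z, hz, rfl⟩

lemma exists_local_rep {V : Opens Y} (s : sec (I.homology i).obj V) {y : Y} (hy : y ∈ V) :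
    ∃ (V' : Opens Y) (h : V' ≤ V), y ∈ V' ∧ ∃ a, IsClass I i a (res _ h s) := by
  obtain ⟨V', h, hy', z, hz⟩ := exists_local_lift (I.homologyπ i) s hy
  exact ⟨V', h, hy', _, z, rfl, hz⟩

/-- The homology sheaf is the cokernel of `toCycles`, and exactness of sheaves gives preimages of
sections only locally. -/
lemma IsClass.locally_boundary (hij : i + 1 = j) {V : Opens Y} {a : csec I j V}
    (H : IsClass I j a 0) {y : Y} (hy : y ∈ V) :
    ∃ (V' : Opens Y) (h : V' ≤ V), y ∈ V' ∧ ∃ b : csec I i V', cd I i j V' b = cres I j h a := by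
  obtain ⟨z, rfl, hz⟩ := H
  obtain ⟨V', h, hy', b, hb⟩ := exists_local_lift_of_exact
    (S := ShortComplex.mk (I.toCycles i j) (I.homologyπ j) (I.toCycles_comp_homologyπ i j))
    (ShortComplex.exact_of_g_is_cokernel _ (I.homologyIsCokernel i j (by simp [← hij]))) z hz hy
  refine ⟨V', h, hy', b, ?_⟩
  dsimp only at hb
  rw [cd, ← secMap_hom_comp (I.toCycles_i i j), hb, secMap_res]

end Classes

/-! ### Injective sheaves are flasque. -/

section Flasque

variable {R : Type u} [CommRing R] {Y : Type u} [TopologicalSpace Y]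

/-- A section over `V` is a morphism to `F` from the sheafified free presheaf on `V`. This sheaf
embeds in the one for `W`, and injectivity of `F` extends the morphism. -/
lemma res_surjective_of_injective (F : ModSheaf R Y) [hF : Injective F] {V W : Opens Y}
    (h : V ≤ W) : Function.Surjective (res F.obj h) := by
  intro x
  let J := Opens.grothendieckTopology (TopCat.of Y)
  let i : V ⟶ W := homOfLE h
  let Fr (T : Opens Y) : (Opens (TopCat.of Y))ᵒᵖ ⥤ ModuleCat.{u} R :=
    yoneda.obj T ⋙ ModuleCat.free R
  let ι : Fr V ⟶ Fr W := Functor.whiskerRight (yoneda.map i) _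
  have hι : Mono ι := by
    rw [NatTrans.mono_iff_mono_app]
    intro T
    rw [ModuleCat.mono_iff_injective]
    exact Finsupp.mapDomain_injective fun a b _ =>
      Subsingleton.elim (α := (T.unop ⟶ V)) a b
  let L : ((Opens (TopCat.of Y))ᵒᵖ ⥤ ModuleCat.{u} R) ⥤ ModSheaf R Y := presheafToSheaf J _
  have hL : Limits.PreservesFiniteLimits L :=
    inferInstanceAs (Limits.PreservesFiniteLimits (presheafToSheaf J (ModuleCat.{u} R)))
  have hι' : Mono (L.map ι) := inferInstance
  let adj : L ⊣ sheafToPresheaf J (ModuleCat.{u} R) := sheafificationAdjunction J (ModuleCat.{u} R)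
  let adj' := ((ModuleCat.adj R).whiskerRight (Opens (TopCat.of Y))ᵒᵖ)
  let φ : L.obj (Fr V) ⟶ F := (adj.homEquiv _ _).symm ((adj'.homEquiv _ F.obj).symm
    (yonedaEquiv.symm x))
  let ψ : L.obj (Fr W) ⟶ F := Injective.factorThru φ (L.map ι)
  have hψ : L.map ι ≫ ψ = φ := Injective.comp_factorThru φ (L.map ι)
  let θ : yoneda.obj W ⟶ F.obj ⋙ forget _ := adj'.homEquiv _ F.obj (adj.homEquiv _ _ ψ)
  refine ⟨yonedaEquiv θ, ?_⟩
  -- The factorization `hψ`, read back through both adjunctions and the Yoneda lemma.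
  have h1 : yoneda.map i ≫ θ = yonedaEquiv.symm x := by
    have h2 := adj'.homEquiv_naturality_left (yoneda.map i) (adj.homEquiv (Fr W) F ψ)
    have h3 := adj.homEquiv_naturality_left ι ψ
    refine h2.symm.trans ?_
    refine (congrArg (adj'.homEquiv _ F.obj) h3.symm).trans ?_
    rw [hψ, Equiv.apply_symm_apply, Equiv.apply_symm_apply]
  have h4 := (yonedaEquiv_naturality θ i)
  refine h4.trans ?_
  rw [h1, Equiv.apply_symm_apply]

end Flasque

/-! ### Quasi-isomorphisms tested on stalks and on local sections. -/

section QuasiIso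

variable {R : Type u} [CommRing R]

lemma quasiIso_of_elements {K L : CochainComplex (ModuleCat.{u} R) ℤ} (f : K ⟶ L)
    (hsurj : ∀ (i j k : ℤ), i + 1 = j → j + 1 = k → ∀ b : L.X j, L.d j k b = 0 →
      ∃ a : K.X j, K.d j k a = 0 ∧ ∃ c : L.X i, b = f.f j a + L.d i j c)
    (hinj : ∀ (i j k : ℤ), i + 1 = j → j + 1 = k → ∀ a : K.X j, K.d j k a = 0 →
      (∃ c : L.X i, f.f j a = L.d i j c) → ∃ c : K.X i, a = K.d i j c) : QuasiIso f := by
  rw [quasiIso_iff]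
  intro j
  rw [quasiIsoAt_iff_isIso_homologyMap]
  obtain ⟨i, hij⟩ : ∃ i : ℤ, i + 1 = j := ⟨j - 1, by ring⟩
  have hc (M : CochainComplex (ModuleCat.{u} R) ℤ) (x : M.X j) (hx : M.d j (j + 1) x = 0) :
      ∃ z : M.cycles j, M.iCycles j z = x :=
    ((ShortComplex.moduleCat_exact_iff
      (ShortComplex.mk (M.iCycles j) (M.d j (j + 1)) (M.iCycles_d j (j + 1)))).1
      (ShortComplex.exact_of_f_is_kernel _ (M.cyclesIsKernel j (j + 1) (by simp)))) x hx
  have hb (M : CochainComplex (ModuleCat.{u} R) ℤ) (x : M.cycles j) (hx : M.homologyπ j x = 0) :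
      ∃ z : M.X i, M.toCycles i j z = x :=
    ((ShortComplex.moduleCat_exact_iff
      (ShortComplex.mk (M.toCycles i j) (M.homologyπ j) (M.toCycles_comp_homologyπ i j))).1
      (ShortComplex.exact_of_g_is_cokernel _ (M.homologyIsCokernel i j (by simp [← hij])))) x hx
  have hi (M : CochainComplex (ModuleCat.{u} R) ℤ) : Function.Injective (M.iCycles j) :=
    (ModuleCat.mono_iff_injective _).1 inferInstance
  have hπ (M : CochainComplex (ModuleCat.{u} R) ℤ) : Function.Surjective (M.homologyπ j) :=
    (ModuleCat.epi_iff_surjective _).1 inferInstance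
  have e1 (z : K.cycles j) : HomologicalComplex.homologyMap f j (K.homologyπ j z) =
      L.homologyπ j (HomologicalComplex.cyclesMap f j z) :=
    ConcreteCategory.congr_hom (HomologicalComplex.homologyπ_naturality f j) z
  have e2 (z : K.cycles j) : L.iCycles j (HomologicalComplex.cyclesMap f j z) =
      f.f j (K.iCycles j z) :=
    ConcreteCategory.congr_hom (HomologicalComplex.cyclesMap_i f j) z
  have e3 (M : CochainComplex (ModuleCat.{u} R) ℤ) (x : M.X i) :
      M.iCycles j (M.toCycles i j x) = M.d i j x :=
    ConcreteCategory.congr_hom (M.toCycles_i i j) x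
  have e4 (M : CochainComplex (ModuleCat.{u} R) ℤ) (x : M.X i) :
      M.homologyπ j (M.toCycles i j x) = 0 :=
    ConcreteCategory.congr_hom (M.toCycles_comp_homologyπ i j) x
  have e5 (M : CochainComplex (ModuleCat.{u} R) ℤ) (z : M.cycles j) :
      M.d j (j + 1) (M.iCycles j z) = 0 :=
    ConcreteCategory.congr_hom (M.iCycles_d j (j + 1)) z
  rw [ConcreteCategory.isIso_iff_bijective]
  constructor
  · rw [injective_iff_map_eq_zero]
    intro x hx
    obtain ⟨z, rfl⟩ := hπ K x
    rw [e1] at hx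
    obtain ⟨c, hc'⟩ := hb L _ hx
    obtain ⟨a, ha⟩ := hinj i j (j + 1) hij rfl (K.iCycles j z) (e5 K z)
      ⟨c, by rw [← e2, ← hc', e3]⟩
    rw [← e3] at ha
    rw [hi K ha, e4]
  · intro x
    obtain ⟨z, rfl⟩ := hπ L x
    obtain ⟨a, ha, c, hc'⟩ := hsurj i j (j + 1) hij rfl (L.iCycles j z) (e5 L z)
    obtain ⟨w, rfl⟩ := hc K a ha
    refine ⟨K.homologyπ j w, ?_⟩
    rw [e1]
    have : z = HomologicalComplex.cyclesMap f j w + L.toCycles i j c := by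
      apply hi L
      rw [hc', map_add, e2, e3]
    rw [this, map_add, e4, add_zero]

variable {Y : Type u} [TopologicalSpace Y]

/-- The stalk functor on presheaves of modules. -/
abbrev pstalk (y : Y) : ModPresheaf R Y ⥤ ModuleCat.{u} R :=
  TopCat.Presheaf.stalkFunctor (ModuleCat.{u} R) (X := TopCat.of Y) y

/-- The stalk functor on sheaves of modules. -/
abbrev sstalk (y : Y) : ModSheaf R Y ⥤ ModuleCat.{u} R :=
  TopCat.Sheaf.forget (ModuleCat.{u} R) (TopCat.of Y) ⋙ pstalk y

/-- Stalks commute with homology and jointly detect isomorphisms of sheaves. -/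
lemma quasiIso_of_stalk {A B : SheafComplex R Y} (g : A ⟶ B)
    (h : ∀ y : Y, QuasiIso (((sstalk (R := R) y).mapHomologicalComplex (ComplexShape.up ℤ)).map g)) :
    QuasiIso g := by
  rw [quasiIso_iff]
  intro i
  rw [quasiIsoAt_iff_isIso_homologyMap]
  have (y : TopCat.of Y) : IsIso ((TopCat.Presheaf.stalkFunctor (ModuleCat.{u} R) y).map
      (HomologicalComplex.homologyMap g i).1) := by
    have h1 := h y
    rw [quasiIso_iff] at h1
    have h2 := h1 i
    rw [quasiIsoAt_iff_isIso_homologyMap] at h2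
    have h3 := ShortComplex.mapHomologyIso_hom_naturality
      ((HomologicalComplex.shortComplexFunctor _ _ i).map g) (sstalk (R := R) y)
    have h4 : IsIso ((sstalk (R := R) y).map (HomologicalComplex.homologyMap g i)) := by
      change IsIso ((sstalk (R := R) y).map (ShortComplex.homologyMap _))
      have : IsIso (ShortComplex.homologyMap ((sstalk (R := R) y).mapShortComplex.map
        ((HomologicalComplex.shortComplexFunctor (ModSheaf R Y) (ComplexShape.up ℤ) i).map g))) := h2
      have h5 := IsIso.comp_isIso' this (ShortComplex.mapHomologyIso
        ((HomologicalComplex.shortComplexFunctor (ModSheaf R Y) (ComplexShape.up ℤ) i).obj B)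
          (sstalk (R := R) y)).isIso_hom
      have h6 := (congrArg (fun φ => IsIso φ) h3).mp h5
      exact @IsIso.of_isIso_comp_left _ _ _ _ _ _ _ (Iso.isIso_hom _) h6
    exact h4
  exact TopCat.Presheaf.isIso_of_stalkFunctor_map_iso _

/-- The germ of a section at a point. -/
def germAt (Q : ModPresheaf R Y) {V : Opens Y} {y : Y} (hy : y ∈ V) :
    sec Q V →ₗ[R] (pstalk y).obj Q := (Q.germ V y hy).hom

lemma exists_germAt {Q : ModPresheaf R Y} {y : Y} (x : (pstalk y).obj Q) :
    ∃ (V : Opens Y) (hy : y ∈ V) (s : sec Q V), germAt Q hy s = x :=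
  TopCat.Presheaf.exists_germ_eq Q x

lemma germAt_res {Q : ModPresheaf R Y} {y : Y} {V W : Opens Y} (h : V ≤ W) (hy : y ∈ V)
    (s : sec Q W) : germAt Q hy (res Q h s) = germAt Q (h hy) s :=
  TopCat.Presheaf.germ_res_apply Q (homOfLE h) y hy s

lemma map_germAt {Q Q' : ModPresheaf R Y} {y : Y} (φ : Q ⟶ Q') {V : Opens Y} (hy : y ∈ V)
    (s : sec Q V) : (pstalk y).map φ (germAt Q hy s) = germAt Q' hy (secMap φ V s) :=
  TopCat.Presheaf.stalkFunctor_map_germ_apply V y hy φ s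

lemma eq_of_germAt_eq {Q : ModPresheaf R Y} {y : Y} {V W : Opens Y} {hV : y ∈ V} {hW : y ∈ W}
    {s : sec Q V} {t : sec Q W} (h : germAt Q hV s = germAt Q hW t) :
    ∃ (T : Opens Y) (_ : y ∈ T) (h1 : T ≤ V) (h2 : T ≤ W), res Q h1 s = res Q h2 t := by
  obtain ⟨T, hT, i1, i2, h⟩ := TopCat.Presheaf.germ_eq Q y hV hW s t h
  exact ⟨T, hT, leOfHom i1, leOfHom i2, h⟩

/-- A morphism of presheaf complexes that is locally bijective on cohomology is a
quasi-isomorphism on stalks. -/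
lemma quasiIso_stalk_of_locally_bijective {P B : CochainComplex (ModPresheaf R Y) ℤ} (f : P ⟶ B)
    (hsurj : ∀ (i j k : ℤ), i + 1 = j → j + 1 = k → ∀ (V : Opens Y) (b : sec (B.X j) V),
      secMap (B.d j k) V b = 0 → ∀ y ∈ V, ∃ (V' : Opens Y) (h : V' ≤ V), y ∈ V' ∧
      ∃ a : sec (P.X j) V', secMap (P.d j k) V' a = 0 ∧ ∃ c : sec (B.X i) V',
        res (B.X j) h b = secMap (f.f j) V' a + secMap (B.d i j) V' c)
    (hinj : ∀ (i j k : ℤ), i + 1 = j → j + 1 = k → ∀ (V : Opens Y) (a : sec (P.X j) V),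
      secMap (P.d j k) V a = 0 → ∀ c : sec (B.X i) V,
      secMap (f.f j) V a = secMap (B.d i j) V c → ∀ y ∈ V,
      ∃ (V' : Opens Y) (h : V' ≤ V), y ∈ V' ∧ ∃ c : sec (P.X i) V',
        res (P.X j) h a = secMap (P.d i j) V' c) (y : Y) :
    QuasiIso (((pstalk (R := R) y).mapHomologicalComplex (ComplexShape.up ℤ)).map f) := by
  apply quasiIso_of_elements
  · intro i j k hij hjk b hb
    replace hb : (pstalk y).map (B.d j k) b = 0 := hb
    obtain ⟨V, hy, b, rfl⟩ := exists_germAt b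
    rw [map_germAt, ← map_zero (germAt (B.X k) hy)] at hb
    obtain ⟨T, hT, h1, h2, h⟩ := eq_of_germAt_eq hb
    rw [map_zero, ← secMap_res] at h
    obtain ⟨V', h', hy', a, ha, c, hc⟩ := hsurj i j k hij hjk T (res (B.X j) h1 b) h y hT
    have e1 : (pstalk y).map (P.d j k) (germAt (P.X j) hy' a) = 0 := by
      rw [map_germAt, ha, map_zero]
    have e2 : germAt (B.X j) hy b = (pstalk y).map (f.f j) (germAt (P.X j) hy' a) +
        (pstalk y).map (B.d i j) (germAt (B.X i) hy' c) := by
      rw [map_germAt, map_germAt, ← map_add, ← hc, res_res, germAt_res]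
    exact ⟨germAt (P.X j) hy' a, e1, germAt (B.X i) hy' c, e2⟩
  · intro i j k hij hjk a ha hac
    obtain ⟨c, hac⟩ := hac
    replace ha : (pstalk y).map (P.d j k) a = 0 := ha
    replace hac : (pstalk y).map (f.f j) a = (pstalk y).map (B.d i j) c := hac
    obtain ⟨V, hy, a, rfl⟩ := exists_germAt a
    obtain ⟨V1, hy1, c, rfl⟩ := exists_germAt c
    rw [map_germAt, ← map_zero (germAt (P.X k) hy)] at ha
    obtain ⟨T, hT, h1, h2, h⟩ := eq_of_germAt_eq ha
    rw [map_zero, ← secMap_res] at h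
    rw [map_germAt, map_germAt] at hac
    obtain ⟨T', hT', h1', h2', h'⟩ := eq_of_germAt_eq hac
    have hTT : y ∈ T ⊓ T' := ⟨hT, hT'⟩
    have e1 : secMap (P.d j k) (T ⊓ T') (res (P.X j) (inf_le_left.trans h1) a) = 0 := by
      have := congrArg (res (P.X k) (inf_le_left : T ⊓ T' ≤ T)) h
      rwa [map_zero, ← secMap_res, res_res] at this
    have e2 : secMap (f.f j) (T ⊓ T') (res (P.X j) (inf_le_left.trans h1) a) =
        secMap (B.d i j) (T ⊓ T') (res (B.X i) (inf_le_right.trans h2') c) := by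
      have := congrArg (res (B.X j) (inf_le_right : T ⊓ T' ≤ T')) h'
      rwa [res_res, res_res, ← secMap_res, ← secMap_res] at this
    obtain ⟨V', hV', hy', x, hx⟩ := hinj i j k hij hjk _ _ e1 _ e2 y hTT
    refine ⟨germAt (P.X i) hy' x, ?_⟩
    refine Eq.trans ?_ (map_germAt (P.d i j) hy' x).symm
    rw [← hx, res_res, germAt_res]

/-- The underlying presheaf complex of a sheaf complex. -/
abbrev forgetComplex : SheafComplex R Y ⥤ CochainComplex (ModPresheaf R Y) ℤ :=
  (TopCat.Sheaf.forget (ModuleCat.{u} R) (TopCat.of Y)).mapHomologicalComplex (ComplexShape.up ℤ)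

/-- A morphism of sheaf complexes is a quasi-isomorphism if it is locally bijective on the
cohomology of a presheaf complex that has the same stalks. -/
lemma quasiIso_of_presheaf {A B : SheafComplex R Y} (g : A ⟶ B)
    (P : CochainComplex (ModPresheaf R Y) ℤ) (v : P ⟶ forgetComplex.obj A)
    (hv : ∀ (i : ℤ) (y : Y), IsIso ((pstalk y).map (v.f i)))
    (hq : ∀ y : Y, QuasiIso (((pstalk (R := R) y).mapHomologicalComplex
      (ComplexShape.up ℤ)).map (v ≫ forgetComplex.map g))) : QuasiIso g := by
  apply quasiIso_of_stalk
  intro y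
  let Φ := (pstalk (R := R) y).mapHomologicalComplex (ComplexShape.up ℤ)
  -- On stalks `v` is an isomorphism, so it can be cancelled from the quasi-isomorphism `v ≫ g`.
  have hviso : IsIso (Φ.map v) := by
    have (i : ℤ) : IsIso ((Φ.map v).f i) := hv i y
    exact HomologicalComplex.Hom.isIso_of_components _
  have hf : QuasiIso (Φ.map v ≫ Φ.map (forgetComplex.map g)) := by
    rw [← Functor.map_comp]
    exact hq y
  exact quasiIso_of_comp_left (Φ.map v) (Φ.map (forgetComplex.map g))

end QuasiIso

/-! ### What is used of local constancy: frames of constant sections. -/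

section Frames

variable {R : Type u} [CommRing R] {Y : Type u} [TopologicalSpace Y]

/-- Near `y` the sheaf `F` has a family of sections that behave like the constant sections of a
constant sheaf. -/
def HasFrameAt (F : ModSheaf R Y) (y : Y) : Prop :=
  ∃ V : Opens Y, y ∈ V ∧ ∃ S : Set (sec F.obj V),
    (∀ (W : Opens Y) (hW : W ≤ V) (t : sec F.obj W), ∀ q ∈ W, ∃ s ∈ S, ∃ (T : Opens Y) (hT : T ≤ W),
      q ∈ T ∧ res F.obj (hT.trans hW) s = res F.obj hT t) ∧
    (∀ s ∈ S, ∀ (T : Opens Y) (hT : T ≤ V), (T : Set Y).Nonempty → res F.obj hT s = 0 → s = 0)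

lemma HasFrameAt.of_iso {F G : ModSheaf R Y} (e : F ≅ G) {y : Y} (h : HasFrameAt F y) :
    HasFrameAt G y := by
  obtain ⟨V, hy, S, h1, h2⟩ := h
  have hr (W : Opens Y) (x : sec F.obj W) : secMap e.inv.hom W (secMap e.hom.hom W x) = x := by
    rw [secMap_hom_comp e.hom_inv_id]
    rfl
  have hl (W : Opens Y) (x : sec G.obj W) : secMap e.hom.hom W (secMap e.inv.hom W x) = x := by
    rw [secMap_hom_comp e.inv_hom_id]
    rfl
  refine ⟨V, hy, secMap e.hom.hom V '' S, ?_, ?_⟩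
  · intro W hW t q hq
    obtain ⟨s, hs, T, hT, hqT, hst⟩ := h1 W hW (secMap e.inv.hom W t) q hq
    refine ⟨_, ⟨s, hs, rfl⟩, T, hT, hqT, ?_⟩
    rw [← secMap_res, hst, secMap_res, hl]
  · rintro _ ⟨s, hs, rfl⟩ T hT hT' h
    rw [← secMap_res] at h
    have h' := congrArg (secMap e.inv.hom T) h
    rw [hr, map_zero] at h'
    rw [h2 s hs T hT hT' h', map_zero]

lemma HasFrameAt.pull {Z : Type u} [TopologicalSpace Z] {f : Z → Y} (hf : IsOpenEmbedding f)
    {F : ModSheaf R Y} {z : Z} (h : HasFrameAt F (f z)) : HasFrameAt ((sheafPull hf).obj F) z := by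
  obtain ⟨V, hy, S, h1, h2⟩ := h
  let V' : Opens Z := ⟨f ⁻¹' V, V.2.preimage hf.continuous⟩
  have hV' : openImage hf V' ≤ V := by
    rintro _ ⟨z, hz, rfl⟩
    exact hz
  refine ⟨V', hy, (fun s => res F.obj hV' s) '' S, ?_, ?_⟩
  · intro W hW t q hq
    have hWV : openImage hf W ≤ openImage hf V' := Set.image_mono hW
    obtain ⟨s, hs, T, hT, hqT, hst⟩ := h1 (openImage hf W) (hWV.trans hV') t (f q) ⟨q, hq, rfl⟩
    let T' : Opens Z := ⟨f ⁻¹' T, T.2.preimage hf.continuous⟩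
    have hT' : T' ≤ W := by
      intro z hz
      obtain ⟨z', hz', h⟩ := hT hz
      exact hf.injective h ▸ hz'
    have hTT : openImage hf T' ≤ T := by
      rintro _ ⟨z, hz, rfl⟩
      exact hz
    refine ⟨_, ⟨s, hs, rfl⟩, T', hT', hqT, ?_⟩
    have := congrArg (res F.obj hTT) hst
    exact (res_res F.obj (show openImage hf T' ≤ openImage hf V' from
      Set.image_mono (hT'.trans hW)) hV' s).trans ((res_res F.obj hTT _ s).symm.trans
      (this.trans (res_res F.obj hTT hT t)))
  · rintro _ ⟨s, hs, rfl⟩ T hT ⟨z', hz'⟩ h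
    have hTT : openImage hf T ≤ openImage hf V' := Set.image_mono hT
    have h' : res F.obj (hTT.trans hV') s = 0 := (res_res F.obj hTT hV' s).symm.trans h
    have := h2 s hs (openImage hf T) _ ⟨f z', z', hz', rfl⟩ h'
    subst this
    exact map_zero (res F.obj hV')

lemma HasFrameAt.of_pull {Z : Type u} [TopologicalSpace Z] {f : Z → Y} (hf : IsOpenEmbedding f)
    {F : ModSheaf R Y} {z : Z} (h : HasFrameAt ((sheafPull hf).obj F) z) : HasFrameAt F (f z) := by
  obtain ⟨V, hy, S, h1, h2⟩ := h
  refine ⟨openImage hf V, ⟨z, hy, rfl⟩, S, ?_, ?_⟩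
  · rintro W hW t q hq
    obtain ⟨z', hz', rfl⟩ := hW hq
    let W' : Opens Z := ⟨f ⁻¹' W, W.2.preimage hf.continuous⟩
    have hW' : W' ≤ V := by
      intro z hz
      obtain ⟨z', hz', h⟩ := hW hz
      exact hf.injective h ▸ hz'
    have hWW : openImage hf W' ≤ W := by
      rintro _ ⟨z, hz, rfl⟩
      exact hz
    obtain ⟨s, hs, T, hT, hqT, hst⟩ := h1 W' hW' (res F.obj hWW t) z' hq
    have hTW : openImage hf T ≤ openImage hf W' := Set.image_mono hT
    exact ⟨s, hs, openImage hf T, hTW.trans hWW, ⟨z', hqT, rfl⟩,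
      hst.trans (res_res F.obj hTW hWW t)⟩
  · intro s hs T hT ⟨q, hq⟩ h
    let T' : Opens Z := ⟨f ⁻¹' T, T.2.preimage hf.continuous⟩
    have hT' : T' ≤ V := by
      intro z hz
      obtain ⟨z', hz', h⟩ := hT hz
      exact hf.injective h ▸ hz'
    have hTT : openImage hf T' ≤ T := by
      rintro _ ⟨z, hz, rfl⟩
      exact hz
    obtain ⟨z', hz', rfl⟩ := hT hq
    refine h2 s hs T' hT' ⟨z', hq⟩ ?_
    have := congrArg (res F.obj hTT) h
    rw [res_res, map_zero] at this
    exact this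

/-- The frame consists of the images of the elements of `M` only, so that no connectedness of open
sets is needed: every section is locally of this form, and such a section that vanishes somewhere is
zero. -/
lemma hasFrameAt_constantSheaf (M : ModuleCat.{u} R) (y : Y) :
    HasFrameAt ((constantSheaf (Opens.grothendieckTopology (TopCat.of Y)) (ModuleCat.{u} R)).obj M :
      ModSheaf R Y) y := by
  let J := Opens.grothendieckTopology (TopCat.of Y)
  let P : ModPresheaf R Y := (Functor.const _).obj M
  let η : P ⟶ ((constantSheaf J (ModuleCat.{u} R)).obj M : ModSheaf R Y).obj := toSheafify J P
  have hsurj : Presheaf.IsLocallySurjective J (toSheafify J P) := inferInstance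
  have hinj : Presheaf.IsLocallyInjective J (toSheafify J P) := inferInstance
  have hP {V W : Opens Y} (h : V ≤ W) (m : M) : res P h (m : sec P W) = (m : sec P V) := rfl
  refine ⟨⊤, trivial, Set.range fun m : M => secMap η ⊤ (m : sec P ⊤), ?_, ?_⟩
  · intro W hW t q hq
    obtain ⟨T, hT, ⟨m, hm⟩, hqT⟩ :=
      (TopCat.Presheaf.isLocallySurjective_iff η).1 hsurj W t q hq
    refine ⟨_, ⟨m, rfl⟩, T, hT, hqT, ?_⟩
    rw [← secMap_res]
    exact hm
  · rintro _ ⟨m, rfl⟩ T hT ⟨q, hq⟩ h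
    rw [← secMap_res] at h
    -- Local injectivity gives a neighborhood of `q` on which `m` is already zero in the constant
    -- presheaf, whose restriction maps are identities.
    have h' := Presheaf.equalizerSieve_mem J (toSheafify J P) (X := .op T) (m : sec P T) (0 : sec P T)
      (h.trans (map_zero _).symm)
    obtain ⟨T', i, hi, -⟩ := h' q hq
    have : m = 0 := hi
    rw [this]
    exact map_zero (secMap η ⊤)

lemma IsConstantNear.hasFrameAt {P : ModuleCat.{u} R → Prop} {F : ModSheaf R Y} {y : Y}
    (h : IsConstantNear P F y) : HasFrameAt F y := by
  obtain ⟨V, hy, M, -, ⟨e⟩⟩ := h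
  exact HasFrameAt.of_pull V.isOpenEmbedding' (z := ⟨y, hy⟩)
    ((hasFrameAt_constantSheaf M _).of_iso e.symm)

lemma hasFrameAt_of_isZero {F : ModSheaf R Y} (h : Limits.IsZero F) (y : Y) : HasFrameAt F y := by
  have h0 (V : Opens Y) (s : sec F.obj V) : s = 0 := by
    have := secMap_hom_comp (h.eq_of_src (𝟙 F ≫ 𝟙 F) (0 : F ⟶ F)) V s
    exact this
  exact ⟨⊤, trivial, {0}, fun W hW t q hq => ⟨0, rfl, W, le_rfl, hq, by rw [h0 W t]; simp⟩,
    fun s hs _ _ _ _ => hs⟩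

end Frames

/-- A flow on `Y` together with a coordinate that increases with unit speed; up to homeomorphism
this is a product decomposition `Y ≅ ℝ × Z`. -/
structure UnitFlow (Y : Type u) [TopologicalSpace Y] where
  /-- the flow -/
  T : ℝ → Y → Y
  continuous_T : Continuous fun p : ℝ × Y => T p.1 p.2
  zero : ∀ y, T 0 y = y
  add : ∀ s t y, T (s + t) y = T s (T t y)
  /-- the coordinate -/
  ξ : Y → ℝ
  continuous_ξ : Continuous ξ
  ξ_T : ∀ s y, ξ (T s y) = ξ y + s

/-- By compactness the interval subdivides into finitely many pieces, each inside one of the sets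
`O`; these are then concatenated. This drives all continuation arguments along flow lines. -/
lemma interval_induction (P : ℝ → ℝ → Prop) {a₀ b₀ : ℝ} (h₀ : a₀ ≤ b₀)
    (hloc : ∀ t ∈ Set.Icc a₀ b₀, ∃ O : Set ℝ, IsOpen O ∧ t ∈ O ∧ ∀ a b, a₀ ≤ a → a ≤ b → b ≤ b₀ →
      Set.Icc a b ⊆ O → P a b)
    (hcat : ∀ a b c, a₀ ≤ a → a ≤ b → b ≤ c → c ≤ b₀ → P a b → P b c → P a c) : P a₀ b₀ := by
  choose! O hO htO hP using hloc
  obtain ⟨t, ht0, htm, ⟨N, hN⟩, ht⟩ := exists_monotone_Icc_subset_open_cover_Icc h₀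
    (c := fun i : Set.Icc a₀ b₀ => {x : Set.Icc a₀ b₀ | (x : ℝ) ∈ O i})
    (fun i => (hO i i.2).preimage continuous_subtype_val)
    (fun x _ => Set.mem_iUnion.2 ⟨x, htO x x.2⟩)
  have key (n : ℕ) : P a₀ (t n) := by
    have hstep (n : ℕ) : P (t n) (t (n + 1)) := by
      obtain ⟨i, hi⟩ := ht n
      refine hP i i.2 _ _ (t n).2.1 (htm n.le_succ) (t (n + 1)).2.2 ?_
      intro x hx
      exact hi (a := ⟨x, (t n).2.1.trans hx.1, hx.2.trans (t (n + 1)).2.2⟩) ⟨hx.1, hx.2⟩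
    induction n with
    | zero =>
      rw [ht0]
      obtain ⟨i, hi⟩ := ht 0
      refine hP i i.2 _ _ le_rfl le_rfl h₀ ?_
      intro x hx
      have hx' : x = (t 0 : ℝ) := by rw [ht0]; exact le_antisymm hx.2 hx.1
      rw [hx']
      exact hi (a := t 0) ⟨le_rfl, htm (Nat.le_succ 0)⟩
    | succ n ih => exact hcat _ _ _ le_rfl (t n).2.1 (htm n.le_succ) (t (n + 1)).2.2 ih (hstep n)
  have := key N
  rwa [hN N le_rfl] at this

/-! ### Continuation of sections, cocycles and primitives along a flow line. -/

section Path

variable {R : Type u} [CommRing R] {Y : Type u} [TopologicalSpace Y]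

/-- The open set `V` contains the piece of the flow line of `w` over `[a, b]`. -/
def UnitFlow.Covers (φ : UnitFlow Y) (w : Y) (a b : ℝ) (V : Opens Y) : Prop :=
  ∀ s ∈ Set.Icc a b, φ.T s w ∈ V

variable {φ : UnitFlow Y} {w : Y} {a b c : ℝ}

lemma UnitFlow.Covers.inf {V W : Opens Y} (h : φ.Covers w a b V) (h' : φ.Covers w a b W) :
    φ.Covers w a b (V ⊓ W) := fun s hs => ⟨h s hs, h' s hs⟩

lemma UnitFlow.Covers.sup {V W : Opens Y} (h : φ.Covers w a b V) (h' : φ.Covers w b c W) :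
    φ.Covers w a c (V ⊔ W) := by
  intro s hs
  rcases le_total s b with h1 | h1
  · exact Or.inl (h s ⟨hs.1, h1⟩)
  · exact Or.inr (h' s ⟨h1, hs.2⟩)

variable (φ w) in
lemma UnitFlow.continuous_path : Continuous fun s => φ.T s w :=
  φ.continuous_T.comp (continuous_id.prodMk continuous_const)

/-- The coordinate `ξ` separates the two halves of the segment: cutting off just above and just
below the junction leaves an overlap that is thin in the flow direction, and it is made thin
transversally as well. -/
lemma UnitFlow.exists_shrink (V₁ V₂ V₃ : Opens Y) (h₁ : φ.Covers w a b V₁)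
    (h₂ : φ.Covers w b c V₂) (h₃ : φ.T b w ∈ V₃) : ∃ W₁ W₂ : Opens Y, W₁ ≤ V₁ ∧ W₂ ≤ V₂ ∧
      φ.Covers w a b W₁ ∧ φ.Covers w b c W₂ ∧ W₁ ⊓ W₂ ≤ V₃ := by
  obtain ⟨p, hpw⟩ : ∃ p, p = φ.T b w := ⟨_, rfl⟩
  have hp : φ.ξ p = φ.ξ w + b := by rw [hpw, φ.ξ_T]
  rw [← hpw] at h₃
  have hcont : ∀ᶠ q : ℝ × Y in 𝓝 (0, p), φ.T q.1 q.2 ∈ V₃ := by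
    apply φ.continuous_T.continuousAt
    change (V₃ : Set Y) ∈ 𝓝 (φ.T 0 p)
    rw [φ.zero]
    exact V₃.2.mem_nhds h₃
  rw [nhds_prod_eq, Filter.eventually_prod_iff] at hcont
  obtain ⟨P, hP, Q, hQ, hPQ⟩ := hcont
  obtain ⟨ε, hε, hP⟩ := Metric.eventually_nhds_iff.1 hP
  obtain ⟨N, hN, hNo, hpN⟩ := eventually_nhds_iff.1 hQ
  have hρ : Continuous fun y => φ.T (φ.ξ p - φ.ξ y) y :=
    φ.continuous_T.comp ((continuous_const.sub φ.continuous_ξ).prodMk continuous_id)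
  have hρw (s : ℝ) : φ.T (φ.ξ p - φ.ξ (φ.T s w)) (φ.T s w) = p := by
    rw [← φ.add, φ.ξ_T, hp, hpw]
    congr 1
    ring
  -- The points whose flow line crosses the height of `p` inside the small neighborhood `N` of `p`.
  let D : Opens Y := ⟨_, hNo.preimage hρ⟩
  let L : Opens Y := ⟨{y | φ.ξ y < φ.ξ p + ε}, isOpen_lt φ.continuous_ξ continuous_const⟩
  let U : Opens Y := ⟨{y | φ.ξ p - ε < φ.ξ y}, isOpen_lt continuous_const φ.continuous_ξ⟩
  refine ⟨V₁ ⊓ (L ⊓ D), V₂ ⊓ (U ⊓ D), inf_le_left, inf_le_left, ?_, ?_, ?_⟩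
  · intro s hs
    refine ⟨h₁ s hs, ?_, ?_⟩
    · change φ.ξ _ < _
      rw [φ.ξ_T, hp]
      linarith [hs.2]
    · change φ.T _ _ ∈ N
      rwa [hρw]
  · intro s hs
    refine ⟨h₂ s hs, ?_, ?_⟩
    · change _ < φ.ξ _
      rw [φ.ξ_T, hp]
      linarith [hs.1]
    · change φ.T _ _ ∈ N
      rwa [hρw]
  · rintro y ⟨⟨-, hL, hD⟩, ⟨-, hU, -⟩⟩
    have hL' : φ.ξ y < φ.ξ p + ε := hL
    have hU' : φ.ξ p - ε < φ.ξ y := hU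
    have := hPQ (x := φ.ξ y - φ.ξ p) (hP (by
      rw [Real.dist_eq, sub_zero, abs_lt]
      constructor <;> linarith)) (hN _ hD)
    dsimp only at this
    rw [← φ.add] at this
    have h0 : φ.ξ y - φ.ξ p + (φ.ξ p - φ.ξ y) = 0 := by ring
    rwa [h0, φ.zero] at this

lemma UnitFlow.exists_glue (F : ModSheaf R Y) {V₁ V₂ V₃ : Opens Y} (h₁ : φ.Covers w a b V₁)
    (h₂ : φ.Covers w b c V₂) (h₃ : φ.T b w ∈ V₃) (h13 : V₃ ≤ V₁) (h23 : V₃ ≤ V₂)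
    (s₁ : sec F.obj V₁) (s₂ : sec F.obj V₂) (hs : res F.obj h13 s₁ = res F.obj h23 s₂) :
    ∃ (W₁ W₂ : Opens Y) (hW₁ : W₁ ≤ V₁) (hW₂ : W₂ ≤ V₂) (s : sec F.obj (W₁ ⊔ W₂)),
      φ.Covers w a b W₁ ∧ φ.Covers w b c W₂ ∧
      res F.obj le_sup_left s = res F.obj hW₁ s₁ ∧ res F.obj le_sup_right s = res F.obj hW₂ s₂ := by
  obtain ⟨W₁, W₂, hW₁, hW₂, hc₁, hc₂, hW⟩ := UnitFlow.exists_shrink V₁ V₂ V₃ h₁ h₂ h₃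
  obtain ⟨s, e₁, e₂⟩ := sheaf_glue F (res F.obj hW₁ s₁) (res F.obj hW₂ s₂) (by
    have := congrArg (res F.obj hW) hs
    rw [res_res, res_res] at this ⊢
    exact this)
  exact ⟨W₁, W₂, hW₁, hW₂, s, hc₁, hc₂, e₁, e₂⟩

lemma sheaf_ext_sup (F : ModSheaf R Y) {V W : Opens Y} {s t : sec F.obj (V ⊔ W)}
    (h₁ : res F.obj (le_sup_left : V ≤ V ⊔ W) s = res F.obj le_sup_left t)
    (h₂ : res F.obj (le_sup_right : W ≤ V ⊔ W) s = res F.obj le_sup_right t) : s = t := by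
  refine sheaf_ext F fun y hy => ?_
  rcases hy with hy | hy
  · exact ⟨V, le_sup_left, hy, h₁⟩
  · exact ⟨W, le_sup_right, hy, h₂⟩

/-- The section `s` vanishes near `y`. -/
def VanishesAt (F : ModSheaf R Y) {V : Opens Y} (s : sec F.obj V) (y : Y) : Prop :=
  ∃ (T : Opens Y) (hT : T ≤ V), y ∈ T ∧ res F.obj hT s = 0

/-- Identity principle: near each point of the line the section agrees with a frame section, which
is zero as soon as it vanishes on a nonempty open set. -/
lemma UnitFlow.vanishesAt_of_vanishesAt {F : ModSheaf R Y} (hF : ∀ y, HasFrameAt F y)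
    (hab : a ≤ b) {V : Opens Y} (hV : φ.Covers w a b V) (s : sec F.obj V) :
    ∀ c ∈ Set.Icc a b, VanishesAt F s (φ.T c w) →
      ∀ d ∈ Set.Icc a b, VanishesAt F s (φ.T d w) := by
  refine interval_induction (fun a' b' => ∀ c ∈ Set.Icc a' b', VanishesAt F s (φ.T c w) →
      ∀ d ∈ Set.Icc a' b', VanishesAt F s (φ.T d w)) hab ?_ ?_
  · intro t ht
    obtain ⟨V₁, ht₁, S, h1, h2⟩ := hF (φ.T t w)
    obtain ⟨σ, hσ, T, hT, htT, hσs⟩ := h1 (V ⊓ V₁) inf_le_right (res F.obj inf_le_left s)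
      (φ.T t w) ⟨hV t ht, ht₁⟩
    rw [res_res] at hσs
    refine ⟨_, T.2.preimage (φ.continuous_path w), htT, ?_⟩
    rintro a' b' - - - hO c hc ⟨T', hT', hcT', h0⟩ d hd
    have hσ0 : σ = 0 := by
      refine h2 σ hσ (T ⊓ T') (inf_le_left.trans (hT.trans inf_le_right)) ⟨_, hO hc, hcT'⟩ ?_
      have e1 := congrArg (res F.obj (inf_le_left : T ⊓ T' ≤ T)) hσs
      have e2 := congrArg (res F.obj (inf_le_right : T ⊓ T' ≤ T')) h0
      rw [res_res, res_res] at e1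
      rw [res_res, map_zero] at e2
      rw [e1, e2]
    exact ⟨T, hT.trans inf_le_left, hO hd, by rw [← hσs, hσ0, map_zero]⟩
  · intro a' b' c' _ h1 h2 _ hab hbc c hc h0 d hd
    have hb : VanishesAt F s (φ.T b' w) := by
      rcases le_total c b' with h | h
      · exact hab c ⟨hc.1, h⟩ h0 b' ⟨h1, le_rfl⟩
      · exact hbc c ⟨h, hc.2⟩ h0 b' ⟨le_rfl, h2⟩
    rcases le_total d b' with h | h
    · exact hab b' ⟨h1, le_rfl⟩ hb d ⟨hd.1, h⟩
    · exact hbc b' ⟨le_rfl, h2⟩ hb d ⟨h, hd.2⟩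

/-- Near one time, a germ agrees with a frame section, which is defined on a whole neighborhood;
successive continuations are glued at the junctions. -/
lemma UnitFlow.exists_extension {F : ModSheaf R Y} (hF : ∀ y, HasFrameAt F y) (φ : UnitFlow Y)
    (w : Y) (hab : a ≤ b) : ∀ c ∈ Set.Icc a b, ∀ (V₀ : Opens Y) (_ : φ.T c w ∈ V₀)
      (s₀ : sec F.obj V₀), ∃ (V : Opens Y) (s : sec F.obj V) (T : Opens Y) (hT : T ≤ V)
      (hT₀ : T ≤ V₀), φ.Covers w a b V ∧ φ.T c w ∈ T ∧ res F.obj hT s = res F.obj hT₀ s₀ := by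
  refine interval_induction (fun a b => ∀ c ∈ Set.Icc a b, ∀ (V₀ : Opens Y) (_ : φ.T c w ∈ V₀)
      (s₀ : sec F.obj V₀), ∃ (V : Opens Y) (s : sec F.obj V) (T : Opens Y) (hT : T ≤ V)
      (hT₀ : T ≤ V₀), φ.Covers w a b V ∧ φ.T c w ∈ T ∧ res F.obj hT s = res F.obj hT₀ s₀) hab ?_ ?_
  · intro t _
    obtain ⟨V, htV, S, h1, -⟩ := hF (φ.T t w)
    refine ⟨_, V.2.preimage (φ.continuous_path w), htV, ?_⟩
    intro a b _ _ _ hO c hc V₀ hc₀ s₀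
    obtain ⟨s, -, T, hT, hcT, h⟩ := h1 (V ⊓ V₀) inf_le_left (res F.obj inf_le_right s₀) (φ.T c w)
      ⟨hO hc, hc₀⟩
    rw [res_res] at h
    exact ⟨V, s, T, _, _, fun x hx => hO hx, hcT, h⟩
  · intro a b c _ hab hbc _ h1 h2 d hd V₀ hd₀ s₀
    rcases le_total d b with hdb | hdb
    · obtain ⟨V, s, T, hT, hT₀, hV, hdT, e⟩ := h1 d ⟨hd.1, hdb⟩ V₀ hd₀ s₀
      obtain ⟨V', s', T', hT', hT₀', hV', hdT', e'⟩ := h2 b ⟨le_rfl, hbc⟩ V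
        (hV b ⟨hab, le_rfl⟩) s
      obtain ⟨W₁, W₂, hW₁, hW₂, t, hc₁, hc₂, e₁, e₂⟩ :=
        UnitFlow.exists_glue F hV hV' hdT' hT₀' hT' s s' e'.symm
      refine ⟨_, t, W₁ ⊓ T, inf_le_left.trans le_sup_left, inf_le_right.trans hT₀, hc₁.sup hc₂,
        ⟨hc₁ d ⟨hd.1, hdb⟩, hdT⟩, ?_⟩
      have := congrArg (res F.obj (inf_le_left : W₁ ⊓ T ≤ W₁)) e₁
      have e' := congrArg (res F.obj (inf_le_right : W₁ ⊓ T ≤ T)) e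
      rw [res_res, res_res] at this e'
      rw [this, e']
    · obtain ⟨V', s', T', hT', hT₀', hV', hdT', e'⟩ := h2 d ⟨hdb, hd.2⟩ V₀ hd₀ s₀
      obtain ⟨V, s, T, hT, hT₀, hV, hdT, e⟩ := h1 b ⟨hab, le_rfl⟩ V' (hV' b ⟨le_rfl, hbc⟩) s'
      obtain ⟨W₁, W₂, hW₁, hW₂, t, hc₁, hc₂, e₁, e₂⟩ :=
        UnitFlow.exists_glue F hV hV' hdT hT hT₀ s s' e
      refine ⟨_, t, W₂ ⊓ T', inf_le_left.trans le_sup_right, inf_le_right.trans hT₀', hc₁.sup hc₂,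
        ⟨hc₂ d ⟨hdb, hd.2⟩, hdT'⟩, ?_⟩
      have := congrArg (res F.obj (inf_le_left : W₂ ⊓ T' ≤ W₂)) e₂
      have e := congrArg (res F.obj (inf_le_right : W₂ ⊓ T' ≤ T')) e'
      rw [res_res, res_res] at this e
      rw [this, e]

variable {I : SheafComplex R Y}

/-- Local representatives exist. At a junction two of them differ by a boundary `dv`; since the
sheaves are flasque, `v` extends, and adding `dv` to the second representative makes them match. -/
lemma UnitFlow.exists_cocycle
    (hI : ∀ (i : ℤ) (V W : Opens Y) (h : V ≤ W), Function.Surjective (cres I i h))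
    {i j : ℤ} (hij : i + 1 = j) (hab : a ≤ b) {V : Opens Y} (hV : φ.Covers w a b V)
    (s : sec (I.homology j).obj V) : ∃ (W : Opens Y) (hW : W ≤ V) (x : csec I j W),
      φ.Covers w a b W ∧ IsClass I j x (res _ hW s) := by
  refine interval_induction (fun a b => ∃ (W : Opens Y) (hW : W ≤ V) (x : csec I j W),
      φ.Covers w a b W ∧ IsClass I j x (res _ hW s)) hab ?_ ?_
  · intro t ht
    obtain ⟨W, hW, htW, x, hx⟩ := exists_local_rep s (hV t ht)
    exact ⟨_, W.2.preimage (φ.continuous_path w), htW,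
      fun a b _ _ _ hO => ⟨W, hW, x, fun y hy => hO hy, hx⟩⟩
  · rintro a b c - hab hbc - ⟨V₁, hV₁, x₁, hc₁, hx₁⟩ ⟨V₂, hV₂, x₂, hc₂, hx₂⟩
    have hd := (hx₁.res inf_le_left).sub (hx₂.res (inf_le_right : V₁ ⊓ V₂ ≤ V₂))
    rw [res_res, res_res, sub_self] at hd
    obtain ⟨V₃, hV₃, hbV₃, v, hv⟩ := hd.locally_boundary hij (y := φ.T b w)
      ⟨hc₁ b ⟨hab, le_rfl⟩, hc₂ b ⟨le_rfl, hbc⟩⟩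
    obtain ⟨v, rfl⟩ := hI i V₃ ⊤ le_top v
    have hx₂' : IsClass I j (x₂ + cd I i j V₂ (cres I i le_top v)) (res _ hV₂ s) := by
      have := hx₂.sub (isClass_d (j := j) (-(cres I i (le_top : V₂ ≤ ⊤) v)))
      rwa [map_neg, sub_neg_eq_add, sub_zero] at this
    obtain ⟨W₁, W₂, hW₁, hW₂, x, hc₁', hc₂', e₁, e₂⟩ := UnitFlow.exists_glue (I.X j) hc₁ hc₂ hbV₃
      (hV₃.trans inf_le_left) (hV₃.trans inf_le_right) x₁ (x₂ + cd I i j V₂ (cres I i le_top v)) (by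
        rw [map_add, ← cd_cres, res_res, hv, map_sub, res_res, res_res]
        abel)
    refine ⟨W₁ ⊔ W₂, sup_le (hW₁.trans hV₁) (hW₂.trans hV₂), x, hc₁'.sup hc₂', ?_⟩
    have hx : cd I j (j + 1) _ x = 0 := by
      refine sheaf_ext_sup _ ?_ ?_
      · rw [← cd_cres, e₁, (hx₁.res hW₁).d_eq_zero, map_zero]
      · rw [← cd_cres, e₂, (hx₂'.res hW₂).d_eq_zero, map_zero]
    obtain ⟨s', hs'⟩ := exists_isClass rfl hx
    -- The glued cocycle has some class; on each of the two pieces it is the prescribed one.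
    have : s' = res _ (sup_le (hW₁.trans hV₁) (hW₂.trans hV₂)) s := by
      refine sheaf_ext_sup _ ?_ ?_
      · have h1 := hs'.res le_sup_left
        rw [cres, e₁] at h1
        rw [h1.unique (hx₁.res hW₁), res_res, res_res]
      · have h1 := hs'.res le_sup_right
        rw [cres, e₂] at h1
        rw [h1.unique (hx₂'.res hW₂), res_res, res_res]
    rwa [this] at hs'

/-- The class of `x` vanishes at time `c`, hence along the whole segment, so primitives exist
locally. Two of them differ at a junction by a cocycle one degree lower, whose class is continued
along the second piece and represented there; this corrects the second primitive up to a boundary.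
-/
lemma UnitFlow.exists_primitive
    (hI : ∀ (i : ℤ) (V W : Opens Y) (h : V ≤ W), Function.Surjective (cres I i h))
    (hF : ∀ i y, HasFrameAt (I.homology i) y)
    {i j : ℤ} (hij : i + 1 = j) (hab : a ≤ b) {V : Opens Y} (hV : φ.Covers w a b V)
    (x : csec I j V) (hx : cd I j (j + 1) V x = 0) (hc : c ∈ Set.Icc a b)
    {T : Opens Y} (hT : T ≤ V) (hcT : φ.T c w ∈ T) (v : csec I i T)
    (hv : cd I i j T v = cres I j hT x) :
    ∃ (W : Opens Y) (hW : W ≤ V) (u : csec I i W), φ.Covers w a b W ∧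
      cd I i j W u = cres I j hW x := by
  obtain ⟨s, hs⟩ := exists_isClass rfl hx
  have hs0 : ∀ d ∈ Set.Icc a b, VanishesAt _ s (φ.T d w) := by
    refine UnitFlow.vanishesAt_of_vanishesAt (hF j) hab hV s c hc ⟨T, hT, hcT, ?_⟩
    have := hs.res hT
    rw [← hv] at this
    exact this.unique (isClass_d v)
  refine interval_induction (fun a b => ∃ (W : Opens Y) (hW : W ≤ V) (u : csec I i W),
    φ.Covers w a b W ∧ cd I i j W u = cres I j hW x) hab ?_ ?_
  · intro t ht
    obtain ⟨T, hT, htT, h⟩ := hs0 t ht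
    have h' := hs.res hT
    rw [h] at h'
    obtain ⟨W, hW, htW, u, hu⟩ := h'.locally_boundary hij htT
    rw [res_res] at hu
    exact ⟨_, W.2.preimage (φ.continuous_path w), htW,
      fun a b _ _ _ hO => ⟨W, _, u, fun y hy => hO hy, hu⟩⟩
  · rintro a b c - hab hbc - ⟨V₁, hV₁, u₁, hc₁, hu₁⟩ ⟨V₂, hV₂, u₂, hc₂, hu₂⟩
    obtain ⟨h, hhi⟩ : ∃ h : ℤ, h + 1 = i := ⟨i - 1, by ring⟩
    have hbV : φ.T b w ∈ V₁ ⊓ V₂ := ⟨hc₁ b ⟨hab, le_rfl⟩, hc₂ b ⟨le_rfl, hbc⟩⟩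
    have hd : cd I i j (V₁ ⊓ V₂) (cres I i inf_le_left u₁ - cres I i inf_le_right u₂) = 0 := by
      rw [map_sub, cd_cres, cd_cres, hu₁, hu₂, res_res, res_res, sub_self]
    obtain ⟨σ, hσ⟩ := exists_isClass hij hd
    obtain ⟨V₄, s₄, T₄, hT₄, hT₄', hV₄, hbT₄, e₄⟩ := UnitFlow.exists_extension (hF i) φ w hbc b
      ⟨le_rfl, hbc⟩ (V₁ ⊓ V₂) hbV σ
    obtain ⟨V₅, hV₅, z, hc₅, hz⟩ := UnitFlow.exists_cocycle hI hhi hbc hV₄ s₄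
    have hd' := (hσ.res (inf_le_left.trans hT₄' : T₄ ⊓ V₅ ≤ _)).sub
      (hz.res (inf_le_right : T₄ ⊓ V₅ ≤ V₅))
    have e₅ := congrArg (res (I.homology i).obj (inf_le_left : T₄ ⊓ V₅ ≤ T₄)) e₄
    rw [res_res, res_res] at e₅
    rw [res_res, e₅, sub_self] at hd'
    obtain ⟨V₃, hV₃, hbV₃, v, hv⟩ := hd'.locally_boundary hhi (y := φ.T b w)
      ⟨hbT₄, hc₅ b ⟨le_rfl, hbc⟩⟩
    obtain ⟨v, rfl⟩ := hI h V₃ ⊤ le_top v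
    -- Near the junction `u₁ - u₂ = z + dv`. Both added terms are closed, so `u₂'` is still a
    -- primitive of `x`, and it agrees there with `u₁`.
    let u₂' : csec I i (V₂ ⊓ V₅) := cres I i inf_le_left u₂ + cres I i inf_le_right z +
      cd I h i _ (cres I h le_top v)
    have hu₂' : cd I i j _ u₂' = cres I j (inf_le_left.trans hV₂) x := by
      rw [map_add, map_add, cd_cd, cd_cres, cd_cres, hz.d_eq_zero, hu₂, res_res, map_zero,
        add_zero, add_zero]
    have hV₃₁ : V₃ ≤ V₁ := hV₃.trans (inf_le_left.trans (hT₄'.trans inf_le_left))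
    have hV₃₂ : V₃ ≤ V₂ := hV₃.trans (inf_le_left.trans (hT₄'.trans inf_le_right))
    obtain ⟨W₁, W₂, hW₁, hW₂, u, hc₁', hc₂', e₁, e₂⟩ := UnitFlow.exists_glue (I.X i) hc₁
      (hc₂.inf hc₅) hbV₃ hV₃₁ (le_inf hV₃₂ (hV₃.trans inf_le_right)) u₁ u₂' (by
        simp only [u₂', map_add, ← cd_cres, res_res]
        rw [hv]
        simp only [map_sub, res_res]
        abel)
    refine ⟨W₁ ⊔ W₂, sup_le (hW₁.trans hV₁) (hW₂.trans (inf_le_left.trans hV₂)), u,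
      hc₁'.sup hc₂', ?_⟩
    refine sheaf_ext_sup _ ?_ ?_
    · rw [← cd_cres, e₁, cd_cres, hu₁, res_res, res_res]
    · rw [← cd_cres, e₂, cd_cres, hu₂', res_res, res_res]

lemma UnitFlow.exists_tube {V : Opens Y} (hV : φ.Covers w a b V) :
    ∃ W : Opens Y, w ∈ W ∧ ∀ w' ∈ W, φ.Covers w' a b V := by
  obtain ⟨u, v, -, hv, hu, hwv, h⟩ := generalized_tube_lemma (s := Set.Icc a b) isCompact_Icc
    (t := {w}) isCompact_singleton (n := (fun p : ℝ × Y => φ.T p.1 p.2) ⁻¹' V)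
    (V.2.preimage φ.continuous_T) (by
      rintro ⟨s, y⟩ ⟨hs, rfl⟩
      exact hV s hs)
  exact ⟨⟨v, hv⟩, hwv rfl, fun w' hw' s hs => h (show (s, w') ∈ u ×ˢ v from ⟨hu hs, hw'⟩)⟩

end Path

/-! ### Germs of global sections along closed-up neighborhoods. -/

section Germs

variable {R : Type u} [CommRing R] {Y : Type u} [TopologicalSpace Y]

lemma VanishesAt.add {F : ModSheaf R Y} {V : Opens Y} {s t : sec F.obj V} {y : Y}
    (hs : VanishesAt F s y) (ht : VanishesAt F t y) : VanishesAt F (s + t) y := by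
  obtain ⟨T, hT, hy, h⟩ := hs
  obtain ⟨T', hT', hy', h'⟩ := ht
  refine ⟨T ⊓ T', inf_le_left.trans hT, ⟨hy, hy'⟩, ?_⟩
  rw [map_add, ← res_res _ inf_le_left hT, h, ← res_res _ inf_le_right hT' t, h', map_zero,
    map_zero, add_zero]

lemma VanishesAt.smul {F : ModSheaf R Y} {V : Opens Y} {s : sec F.obj V} {y : Y} (r : R)
    (hs : VanishesAt F s y) : VanishesAt F (r • s) y := by
  obtain ⟨T, hT, hy, h⟩ := hs
  exact ⟨T, hT, hy, by rw [map_smul, h, smul_zero]⟩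

lemma VanishesAt.secMap {F G : ModSheaf R Y} (f : F ⟶ G) {V : Opens Y} {s : sec F.obj V} {y : Y}
    (hs : VanishesAt F s y) : VanishesAt G (IntrinsicStrat.secMap f.hom V s) y := by
  obtain ⟨T, hT, hy, h⟩ := hs
  exact ⟨T, hT, hy, by rw [← secMap_res, h, map_zero]⟩

/-- The global sections that vanish near all points of `K`. -/
def vanishing (F : ModSheaf R Y) (K : Set Y) : Submodule R (sec F.obj ⊤) where
  carrier := {s | ∀ y ∈ K, VanishesAt F s y}
  zero_mem' := fun _ _ => ⟨⊤, le_rfl, trivial, map_zero _⟩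
  add_mem' := fun hs ht y hy => (hs y hy).add (ht y hy)
  smul_mem' := fun r _ hs y hy => (hs y hy).smul r

lemma vanishing_mono (F : ModSheaf R Y) {K K' : Set Y} (h : K' ⊆ K) :
    vanishing F K ≤ vanishing F K' := fun _ hs y hy => hs y (h hy)

lemma exists_open_of_vanishing {F : ModSheaf R Y} {K : Set Y} {s : sec F.obj ⊤}
    (hs : s ∈ vanishing F K) : ∃ V : Opens Y, K ⊆ V ∧ res F.obj (le_top : V ≤ ⊤) s = 0 := by
  choose! T hT hy h using hs
  refine ⟨⨆ y : K, T y, fun y hyK => Opens.mem_iSup.2 ⟨⟨y, hyK⟩, hy y hyK⟩, ?_⟩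
  refine sheaf_ext F fun y hyV => ?_
  obtain ⟨z, hz⟩ := Opens.mem_iSup.1 hyV
  refine ⟨T z, le_iSup (fun y : K => T y) z, hz, ?_⟩
  rw [res_res, map_zero]
  exact h z z.2

lemma res_eq_zero_of_vanishing {F : ModSheaf R Y} {V : Opens Y} {s : sec F.obj ⊤}
    (hs : s ∈ vanishing F V) : res F.obj (le_top : V ≤ ⊤) s = 0 := by
  obtain ⟨W, hVW, h⟩ := exists_open_of_vanishing hs
  rw [← res_res _ hVW le_top, h, map_zero]

/-- The presheaf of germs of global sections along the sets `κ W`. -/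
def germPresheafObj (κ : Opens Y → Set Y) (hκ : Monotone κ) (F : ModSheaf R Y) :
    ModPresheaf R Y where
  obj W := ModuleCat.of R (sec F.obj ⊤ ⧸ vanishing F (κ W.unop))
  map i := ModuleCat.ofHom (Submodule.factor (vanishing_mono F (hκ (leOfHom i.unop))))
  map_id _ := ModuleCat.hom_ext (Submodule.linearMap_qext _ (LinearMap.ext fun _ => rfl))
  map_comp _ _ := ModuleCat.hom_ext (Submodule.linearMap_qext _ (LinearMap.ext fun _ => rfl))

/-- The functor of germs of global sections along the sets `κ W`. -/
def germPresheaf (κ : Opens Y → Set Y) (hκ : Monotone κ) : ModSheaf R Y ⥤ ModPresheaf R Y where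
  obj F := germPresheafObj κ hκ F
  map {F G} f :=
    { app := fun W => ModuleCat.ofHom (Submodule.mapQ _ _ (secMap f.hom ⊤)
        (fun _ hs y hy => (hs y hy).secMap f))
      naturality := fun _ _ _ =>
        ModuleCat.hom_ext (Submodule.linearMap_qext _ (LinearMap.ext fun _ => rfl)) }
  map_id F := by
    exact NatTrans.ext (funext fun _ =>
      ModuleCat.hom_ext (Submodule.linearMap_qext _ (LinearMap.ext fun _ => rfl)))
  map_comp f g := by
    exact NatTrans.ext (funext fun _ =>
      ModuleCat.hom_ext (Submodule.linearMap_qext _ (LinearMap.ext fun _ => rfl)))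

instance (κ : Opens Y → Set Y) (hκ : Monotone κ) : (germPresheaf (R := R) κ hκ).Additive where
  map_add := NatTrans.ext (funext fun _ =>
    ModuleCat.hom_ext (Submodule.linearMap_qext _ (LinearMap.ext fun _ => rfl)))

/-- Sheafification of presheaves of modules. -/
abbrev shfy : ModPresheaf R Y ⥤ ModSheaf R Y :=
  presheafToSheaf (Opens.grothendieckTopology (TopCat.of Y)) (ModuleCat.{u} R)

/-- The sheafification adjunction. -/
abbrev shfyAdj : shfy (R := R) (Y := Y) ⊣ TopCat.Sheaf.forget (ModuleCat.{u} R) (TopCat.of Y) :=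
  sheafificationAdjunction (Opens.grothendieckTopology (TopCat.of Y)) (ModuleCat.{u} R)

instance : (shfy (R := R) (Y := Y)).Additive :=
  (shfyAdj (R := R) (Y := Y)).left_adjoint_additive

variable {κ : Opens Y → Set Y} (hκ : Monotone κ) {f : Y → Y} (hf : IsOpenEmbedding f)
  (hfκ : ∀ W : Opens Y, f '' W ⊆ κ W)

/-- Restriction of germs along `κ W` to `f W`. -/
def germToPull : germPresheaf (R := R) κ hκ ⟶
    sheafPull hf ⋙ TopCat.Sheaf.forget (ModuleCat.{u} R) (TopCat.of Y) where
  app F :=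
    { app := fun W => ModuleCat.ofHom (Submodule.liftQ _
        (res F.obj (le_top : openImage hf W.unop ≤ ⊤)) (by
          intro s hs
          exact res_eq_zero_of_vanishing (fun y hy => hs y (hfκ W.unop hy))))
      naturality := fun W W' i => by
        exact ModuleCat.hom_ext (Submodule.linearMap_qext _ (LinearMap.ext fun x =>
          (res_res F.obj (show openImage hf W'.unop ≤ openImage hf W.unop from
            Set.image_mono (leOfHom i.unop)) le_top x).symm)) }
  naturality F G g := by
    refine NatTrans.ext (funext fun W => ?_)
    exact ModuleCat.hom_ext (Submodule.linearMap_qext _ (LinearMap.ext fun x =>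
      (secMap_res g.hom le_top x).symm))

/-- The morphism from the sheaf of germs along `κ W` to the inverse image. -/
def germSheafToPull : germPresheaf (R := R) κ hκ ⋙ shfy ⟶ sheafPull hf where
  app F := (shfyAdj.homEquiv _ _).symm ((germToPull hκ hf hfκ).app F)
  naturality F G g := by
    refine ((shfyAdj.homEquiv_naturality_left_symm _ _).symm.trans ?_).trans
      (shfyAdj.homEquiv_naturality_right_symm _ _)
    exact congrArg _ ((germToPull hκ hf hfκ).naturality g)

/-- Sheafification does not change stalks, so the criterion can be tested on the presheaf of germs.
-/
lemma quasiIso_germSheafToPull (I : SheafComplex R Y)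
    (h : ∀ y : Y, QuasiIso (((pstalk (R := R) y).mapHomologicalComplex (ComplexShape.up ℤ)).map
      ((NatTrans.mapHomologicalComplex (germToPull (R := R) hκ hf hfκ)
        (ComplexShape.up ℤ)).app I))) :
    QuasiIso ((NatTrans.mapHomologicalComplex (germSheafToPull (R := R) hκ hf hfκ)
      (ComplexShape.up ℤ)).app I) := by
  let η : germPresheaf (R := R) κ hκ ⟶ (germPresheaf (R := R) κ hκ ⋙ shfy) ⋙
      TopCat.Sheaf.forget (ModuleCat.{u} R) (TopCat.of Y) :=
    Functor.whiskerLeft (germPresheaf (R := R) κ hκ) shfyAdj.unit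
  refine quasiIso_of_presheaf _ (((germPresheaf κ hκ).mapHomologicalComplex _).obj I)
    ((NatTrans.mapHomologicalComplex η (ComplexShape.up ℤ)).app I) ?_ ?_
  · intro i y
    exact TopCat.Presheaf.stalkFunctor_map_unit_toSheafify_isIso _ _ _
  · intro y
    have e : (NatTrans.mapHomologicalComplex η (ComplexShape.up ℤ)).app I ≫ forgetComplex.map
        ((NatTrans.mapHomologicalComplex (germSheafToPull (R := R) hκ hf hfκ)
          (ComplexShape.up ℤ)).app I) = (NatTrans.mapHomologicalComplex
            (germToPull (R := R) hκ hf hfκ) (ComplexShape.up ℤ)).app I :=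
      HomologicalComplex.hom_ext _ _ fun i =>
        (shfyAdj.homEquiv _ _).apply_symm_apply ((germToPull hκ hf hfκ).app (I.X i))
    exact (congrArg (fun φ => QuasiIso (((pstalk (R := R) y).mapHomologicalComplex
      (ComplexShape.up ℤ)).map φ)) e).mpr (h y)

end Germs

/-! ### Invariance of a complex with locally constant cohomology under a flow. -/

section Flow

variable {R : Type u} [CommRing R] {Y : Type u} [TopologicalSpace Y]

/-- The germ along `κ W` of a global section. -/
def germMk (κ : Opens Y → Set Y) (hκ : Monotone κ) (F : ModSheaf R Y) (W : Opens Y) :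
    sec F.obj ⊤ →ₗ[R] sec ((germPresheaf κ hκ).obj F) W :=
  Submodule.mkQ (vanishing F (κ W))

section

variable {κ : Opens Y → Set Y} {hκ : Monotone κ} {F G : ModSheaf R Y} {W : Opens Y}

lemma germMk_surjective : Function.Surjective (germMk κ hκ F W) := Submodule.mkQ_surjective _

lemma germMk_eq_zero {x : sec F.obj ⊤} : germMk κ hκ F W x = 0 ↔ x ∈ vanishing F (κ W) :=
  Submodule.Quotient.mk_eq_zero _

lemma map_germMk (f : F ⟶ G) (x : sec F.obj ⊤) :
    secMap ((germPresheaf κ hκ).map f) W (germMk κ hκ F W x) =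
      germMk κ hκ G W (secMap f.hom ⊤ x) := rfl

end

namespace UnitFlow

variable (φ : UnitFlow Y)

/-- The flow as a family of homeomorphisms. -/
def homeo (r : ℝ) : Y ≃ₜ Y where
  toFun := φ.T r
  invFun := φ.T (-r)
  left_inv y := by rw [← φ.add, neg_add_cancel, φ.zero]
  right_inv y := by rw [← φ.add, add_neg_cancel, φ.zero]
  continuous_toFun := φ.continuous_T.comp (continuous_const.prodMk continuous_id)
  continuous_invFun := φ.continuous_T.comp (continuous_const.prodMk continuous_id)

lemma isOpenEmbedding (r : ℝ) : IsOpenEmbedding (φ.T r) := (φ.homeo r).isOpenEmbedding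

/-- The points reached from `W` in time between `0` and `1`. -/
def sweep (W : Opens Y) : Set Y := {z | ∃ w ∈ W, ∃ s ∈ Set.Icc (0 : ℝ) 1, φ.T s w = z}

lemma sweep_mono : Monotone φ.sweep := by
  rintro W W' h _ ⟨w, hw, s, hs, rfl⟩
  exact ⟨w, h hw, s, hs, rfl⟩

lemma image_subset_sweep {r : ℝ} (hr : r ∈ Set.Icc (0 : ℝ) 1) (W : Opens Y) :
    φ.T r '' W ⊆ φ.sweep W := by
  rintro _ ⟨w, hw, rfl⟩
  exact ⟨w, hw, r, hr, rfl⟩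

variable {φ}

/-- Surjectivity on cohomology of restriction from germs along a segment to germs at time `r`. The
class is continued along the segment and represented by a cocycle near it; flasqueness makes the
cochain global, and the tube lemma gives closedness along all nearby segments. -/
lemma exists_global_rep {I : SheafComplex R Y}
    (hI : ∀ (i : ℤ) (V W : Opens Y) (h : V ≤ W), Function.Surjective (cres I i h))
    (hF : ∀ i y, HasFrameAt (I.homology i) y) {r : ℝ} (hr : r ∈ Set.Icc (0 : ℝ) 1)
    {i j : ℤ} (hij : i + 1 = j) {V : Opens Y} (b : csec I j (openImage (φ.isOpenEmbedding r) V))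
    (hb : cd I j (j + 1) _ b = 0) {y : Y} (hy : y ∈ V) :
    ∃ (V' : Opens Y) (h : openImage (φ.isOpenEmbedding r) V' ≤ openImage (φ.isOpenEmbedding r) V),
      V' ≤ V ∧ y ∈ V' ∧ ∃ x : csec I j ⊤, cd I j (j + 1) ⊤ x ∈ vanishing (I.X (j + 1)) (φ.sweep V') ∧
      ∃ c : csec I i (openImage (φ.isOpenEmbedding r) V'),
        cres I j h b = cres I j le_top x + cd I i j _ c := by
  have hf := φ.isOpenEmbedding r
  have hyV : φ.T r y ∈ openImage hf V := ⟨y, hy, rfl⟩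
  obtain ⟨σ, hσ⟩ := exists_isClass rfl hb
  obtain ⟨V₄, s, T, hT, hT', hV₄, hyT, e⟩ := exists_extension (hF j) φ y zero_le_one r hr _ hyV σ
  obtain ⟨V₅, hV₅, x, hc, hx⟩ := exists_cocycle hI hij zero_le_one hV₄ s
  have hd := (hσ.res (inf_le_left.trans hT' : T ⊓ V₅ ≤ _)).sub
    (hx.res (inf_le_right : T ⊓ V₅ ≤ V₅))
  have e' := congrArg (res (I.homology j).obj (inf_le_left : T ⊓ V₅ ≤ T)) e
  rw [res_res, res_res] at e'
  rw [res_res, e', sub_self] at hd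
  obtain ⟨V₃, hV₃, hyV₃, c, hc'⟩ := hd.locally_boundary hij ⟨hyT, hc r hr⟩
  obtain ⟨x, rfl⟩ := hI j V₅ ⊤ le_top x
  obtain ⟨W, hyW, hW⟩ := UnitFlow.exists_tube hc
  obtain ⟨D, hD⟩ : ∃ D : Opens Y, ∀ z, z ∈ D ↔ φ.T r z ∈ V₃ :=
    ⟨⟨φ.T r ⁻¹' V₃, V₃.2.preimage hf.continuous⟩, fun _ => Iff.rfl⟩
  -- `W` keeps the segments inside `V₅`, where `x` is closed; `D` keeps the time `r` points inside
  -- `V₃`, where the primitive `c` is defined.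
  have hV'₃ : openImage hf (W ⊓ D) ≤ V₃ := by
    rintro _ ⟨z, hz, rfl⟩
    exact (hD z).1 hz.2
  have hV'V : W ⊓ D ≤ V := by
    intro z hz
    obtain ⟨z', hz', h⟩ := hT' (hV₃ ((hD z).1 hz.2)).1
    rwa [← hf.injective h]
  have hle : openImage hf (W ⊓ D) ≤ openImage hf V := Set.image_mono hV'V
  refine ⟨W ⊓ D, hle, hV'V, ⟨hyW, (hD y).2 hyV₃⟩, x, ?_, cres I i hV'₃ c, ?_⟩
  · rintro _ ⟨w, hw, s, hs, rfl⟩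
    refine ⟨V₅, le_top, hW w hw.1 s hs, ?_⟩
    exact (cd_cres I j (j + 1) le_top x).symm.trans hx.d_eq_zero
  · rw [cd_cres, hc', res_res, map_sub, res_res, res_res]
    refine (add_sub_cancel (cres I j le_top x) (cres I j hle b)).symm.trans ?_
    congr 2
    exact (res_res _ _ _ _).symm

/-- The matching injectivity: a cocycle germ along the segment that bounds near the point at time
`r` bounds along the segment, by `exists_primitive`. -/
lemma exists_global_primitive {I : SheafComplex R Y}
    (hI : ∀ (i : ℤ) (V W : Opens Y) (h : V ≤ W), Function.Surjective (cres I i h))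
    (hF : ∀ i y, HasFrameAt (I.homology i) y) {r : ℝ} (hr : r ∈ Set.Icc (0 : ℝ) 1)
    {i j : ℤ} (hij : i + 1 = j) {V : Opens Y} (x : csec I j ⊤)
    (hx : cd I j (j + 1) ⊤ x ∈ vanishing (I.X (j + 1)) (φ.sweep V))
    (c : csec I i (openImage (φ.isOpenEmbedding r) V)) (hc : cres I j le_top x = cd I i j _ c)
    {y : Y} (hy : y ∈ V) :
    ∃ V' : Opens Y, V' ≤ V ∧ y ∈ V' ∧ ∃ u : csec I i ⊤,
      x - cd I i j ⊤ u ∈ vanishing (I.X j) (φ.sweep V') := by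
  obtain ⟨V₁, hV₁, h⟩ := exists_open_of_vanishing hx
  have hcov : φ.Covers y 0 1 V₁ := fun s hs => hV₁ ⟨y, hy, s, hs, rfl⟩
  obtain ⟨W, hW, u, hcu, hu⟩ := exists_primitive hI hF hij zero_le_one hcov (cres I j le_top x)
    ((cd_cres I j (j + 1) le_top x).trans h) hr
    (T := openImage (φ.isOpenEmbedding r) V ⊓ V₁) inf_le_right
    ⟨⟨y, hy, rfl⟩, hcov r hr⟩ (cres I i inf_le_left c) (by
      rw [cd_cres, ← hc, res_res, res_res])
  obtain ⟨u, rfl⟩ := hI i W ⊤ le_top u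
  obtain ⟨W', hyW', hW'⟩ := UnitFlow.exists_tube hcu
  refine ⟨W' ⊓ V, inf_le_right, ⟨hyW', hy⟩, u, ?_⟩
  rintro _ ⟨w, hw, s, hs, rfl⟩
  refine ⟨W, le_top, hW' w hw.1 s hs, ?_⟩
  rw [map_sub, ← cd_cres, hu, res_res, sub_self]

lemma quasiIso_germSheaf {I : SheafComplex R Y}
    (hI : ∀ (i : ℤ) (V W : Opens Y) (h : V ≤ W), Function.Surjective (cres I i h))
    (hF : ∀ i y, HasFrameAt (I.homology i) y) {r : ℝ} (hr : r ∈ Set.Icc (0 : ℝ) 1) :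
    QuasiIso ((NatTrans.mapHomologicalComplex (germSheafToPull (R := R) φ.sweep_mono
      (φ.isOpenEmbedding r) (φ.image_subset_sweep hr)) (ComplexShape.up ℤ)).app I) := by
  apply quasiIso_germSheafToPull
  intro y
  refine quasiIso_stalk_of_locally_bijective
    ((NatTrans.mapHomologicalComplex (germToPull (R := R) φ.sweep_mono
      (φ.isOpenEmbedding r) (φ.image_subset_sweep hr)) (ComplexShape.up ℤ)).app I) ?_ ?_ y
  · intro i j k hij hjk V b hb y hy
    subst hjk
    obtain ⟨V', h, hV', hyV', x, hx, c, hc⟩ := exists_global_rep hI hF hr hij b hb hy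
    have e1 : secMap ((germPresheaf φ.sweep φ.sweep_mono).map (I.d j (j + 1))) V'
        (germMk φ.sweep φ.sweep_mono (I.X j) V' x) = 0 := by
      rw [map_germMk, germMk_eq_zero]
      exact hx
    exact ⟨V', hV', hyV', germMk φ.sweep φ.sweep_mono (I.X j) V' x, e1, c, hc⟩
  · intro i j k hij hjk V a ha c hac y hy
    subst hjk
    obtain ⟨x, rfl⟩ := germMk_surjective (κ := φ.sweep) (hκ := φ.sweep_mono) (F := I.X j) a
    replace ha : germMk φ.sweep φ.sweep_mono (I.X (j + 1)) V (cd I j (j + 1) ⊤ x) = 0 := ha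
    obtain ⟨V', hV', hyV', u, hu⟩ := exists_global_primitive hI hF hr hij x
      (germMk_eq_zero.1 ha) c hac hy
    have e1 : germMk φ.sweep φ.sweep_mono (I.X j) V' x =
        secMap ((germPresheaf φ.sweep φ.sweep_mono).map (I.d i j)) V'
          (germMk φ.sweep φ.sweep_mono (I.X i) V' u) := by
      rw [map_germMk, ← sub_eq_zero, ← map_sub, germMk_eq_zero]
      exact hu
    exact ⟨V', hV', hyV', germMk φ.sweep φ.sweep_mono (I.X i) V' u, e1⟩

/-- A complex whose homology sheaves are locally constant is isomorphic in the derived category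
to its translate by a flow. -/
theorem derivedIso_pull {E : SheafComplex R Y} {a : ℤ} (ha : ∀ i < a, Limits.IsZero (E.homology i))
    (hF : ∀ i y, HasFrameAt (E.homology i) y) :
    DerivedIso (complexPull (φ.isOpenEmbedding 1) E) E := by
  have h0 : E.IsGE a := by
    rw [CochainComplex.isGE_iff]
    intro i hi
    exact (HomologicalComplex.exactAt_iff_isZero_homology _ _).2 (ha i hi)
  -- The truncation is quasi-isomorphic to `E` because the homology vanishes below `a`; it is
  -- strictly bounded below and so has an injective resolution.
  obtain ⟨I, ι, hι, hinj, -⟩ := CochainComplex.Plus.modelCategoryQuillen.exists_quasiIso_injective (E.truncGE a) a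
  have hEI : DerivedIso E I :=
    (DerivedIso.of_quasiIso (E.πTruncGE a)).trans (DerivedIso.of_quasiIso ι)
  have hI (i : ℤ) (V W : Opens Y) (h : V ≤ W) : Function.Surjective (cres I i h) := by
    have := hinj i
    exact res_surjective_of_injective _ h
  have hFI (i : ℤ) (y : Y) : HasFrameAt (I.homology i) y :=
    (hF i y).of_iso (asIso (HomologicalComplex.homologyMap (E.πTruncGE a ≫ ι) i))
  -- The complex of germs does not depend on `r`; comparing `r = 0` with `r = 1` gives the result.
  have key (r : ℝ) (hr : r ∈ Set.Icc (0 : ℝ) 1) :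
      DerivedIso (((germPresheaf (R := R) φ.sweep φ.sweep_mono ⋙ shfy).mapHomologicalComplex _).obj I)
        (complexPull (φ.isOpenEmbedding r) I) := by
    exact @DerivedIso.of_quasiIso _ _ _ _ _ _ _ (quasiIso_germSheaf (φ := φ) hI hFI hr)
  have e0 : complexPull (φ.isOpenEmbedding 0) I ≅ I := by
    have h : φ.T 0 = id := funext φ.zero
    have (g : Y → Y) (hg : IsOpenEmbedding g) (hgid : g = id) : Nonempty (complexPull hg I ≅ I) := by
      subst hgid
      exact ⟨complexPullId I⟩
    exact (this _ _ h).some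
  have h1 := key 1 ⟨zero_le_one, le_rfl⟩
  have h2 := (key 0 ⟨le_rfl, zero_le_one⟩).trans (.of_iso e0)
  exact (hEI.pull _).trans (h1.symm.trans (h2.trans hEI.symm))

end UnitFlow

end Flow

/-! ### The local equivalence relation, written with pairs of open embeddings. -/

section LocEquiv

variable {R : Type u} [CommRing R]
variable {X Y Z : Type u} [TopologicalSpace X] [TopologicalSpace Y] [TopologicalSpace Z]

/-- The restriction of a map to open sets of its source and target. -/
def resMap (f : Y → X) (V : Opens Y) (U : Opens X) (h : ∀ z ∈ V, f z ∈ U) : V → U :=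
  fun z => ⟨f z, h z z.2⟩

lemma isOpenEmbedding_resMap {f : Y → X} (hf : IsOpenEmbedding f) {V : Opens Y} {U : Opens X}
    (h : ∀ z ∈ V, f z ∈ U) : IsOpenEmbedding (resMap f V U h) :=
  .of_comp _ U.isOpenEmbedding' (hf.comp V.isOpenEmbedding')

variable {U : Opens X} {E : SheafComplex R U} {C : Set X}

/-- A symmetric form of the relation: a common source with two open embeddings. The homeomorphism is
`g ∘ f⁻¹`, and the equivalence then holds at every point of the source, not only at a base point. -/
lemma LocEquiv.intro {f g : Y → X} (hf : IsOpenEmbedding f) (hg : IsOpenEmbedding g)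
    (hC : ∀ z, f z ∈ C ↔ g z ∈ C) {V : Opens Y} (hfV : ∀ z, z ∈ V ↔ f z ∈ U)
    (hgV : ∀ z, z ∈ V ↔ g z ∈ U)
    (h : DerivedIso (complexPull (isOpenEmbedding_resMap hf fun z => (hfV z).1) E)
      (complexPull (isOpenEmbedding_resMap hg fun z => (hgV z).1) E)) (z : Y) :
    LocEquiv U E C (f z) (g z) := by
  let A : Opens X := ⟨Set.range f, hf.isOpen_range⟩
  let B : Opens X := ⟨Set.range g, hg.isOpen_range⟩
  let φ : Y ≃ₜ A := hf.isEmbedding.toHomeomorph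
  let ψ : Y ≃ₜ B := hg.isEmbedding.toHomeomorph
  have hφ (a : A) : f (φ.symm a) = a := congrArg Subtype.val (φ.apply_symm_apply a)
  have hψ (y : Y) : (ψ y : X) = g y := rfl
  have hU (a : A) : (a : X) ∈ U ↔ ((φ.symm.trans ψ) a : X) ∈ U := by
    rw [Homeomorph.trans_apply, hψ, ← hgV, hfV, hφ]
  have hk (a : (A ⊓ U : Opens X)) : φ.symm ⟨a, a.2.1⟩ ∈ V := by
    rw [hfV, hφ]
    exact a.2.2
  let k (a : (A ⊓ U : Opens X)) : V := ⟨φ.symm ⟨a, a.2.1⟩, hk a⟩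
  have ho : IsOpenEmbedding k := .of_comp _ V.isOpenEmbedding'
    (φ.symm.isOpenEmbedding.comp (Opens.isOpenEmbedding_of_le (inf_le_left : A ⊓ U ≤ A)))
  refine ⟨A, B, ⟨z, rfl⟩, ⟨z, rfl⟩, φ.symm.trans ψ, ?_, fun a => ?_, hU, ?_⟩
  · apply Subtype.ext
    rw [Homeomorph.trans_apply, hψ]
    exact congrArg g (φ.symm_apply_apply z)
  · rw [Homeomorph.trans_apply, hψ, ← hC, hφ]
  · have h1 := complexPullComp ho (isOpenEmbedding_resMap hf fun z => (hfV z).1)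
      (Opens.isOpenEmbedding_of_le (inf_le_right : A ⊓ U ≤ U))
      (fun a => Subtype.ext (hφ ⟨a, a.2.1⟩)) E
    have h2 := complexPullComp ho (isOpenEmbedding_resMap hg fun z => (hgV z).1)
      ((Opens.isOpenEmbedding_of_le (inf_le_right : B ⊓ U ≤ U)).comp
        (restrictHomeo (φ.symm.trans ψ) hU).isOpenEmbedding) (fun a => rfl) E
    have h3 := complexPullComp (restrictHomeo (φ.symm.trans ψ) hU).isOpenEmbedding
      (Opens.isOpenEmbedding_of_le (inf_le_right : B ⊓ U ≤ U))
      ((Opens.isOpenEmbedding_of_le (inf_le_right : B ⊓ U ≤ U)).comp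
        (restrictHomeo (φ.symm.trans ψ) hU).isOpenEmbedding) (fun a => rfl) E
    exact (DerivedIso.of_iso (h3 ≪≫ h2.symm)).trans ((h.symm.pull ho).trans (.of_iso h1))

/-- A homeomorphism realizing a local equivalence, as a pair of open embeddings. -/
structure LocEquivData (U : Opens X) (E : SheafComplex R U) (C : Set X) (x y : X) where
  /-- the common source -/
  Y : Type u
  [top : TopologicalSpace Y]
  /-- the first open embedding -/
  f : Y → X
  /-- the second open embedding -/
  g : Y → X
  /-- the base point -/
  y₀ : Y
  hf : IsOpenEmbedding f
  hg : IsOpenEmbedding g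
  f_y₀ : f y₀ = x
  g_y₀ : g y₀ = y
  hC : ∀ z, f z ∈ C ↔ g z ∈ C
  /-- the inverse image of `U` -/
  V : Opens Y
  hfV : ∀ z, z ∈ V ↔ f z ∈ U
  hgV : ∀ z, z ∈ V ↔ g z ∈ U
  iso : DerivedIso (complexPull (isOpenEmbedding_resMap hf fun z => (hfV z).1) E)
      (complexPull (isOpenEmbedding_resMap hg fun z => (hgV z).1) E)

attribute [instance] LocEquivData.top

lemma LocEquivData.locEquiv {x y : X} (d : LocEquivData U E C x y) (z : d.Y) :
    LocEquiv U E C (d.f z) (d.g z) :=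
  LocEquiv.intro d.hf d.hg d.hC d.hfV d.hgV d.iso z

lemma LocEquiv.exists_data {x y : X} (h : LocEquiv U E C x y) :
    Nonempty (LocEquivData U E C x y) := by
  obtain ⟨A, B, hx, hy, h, hxy, hC, hU, ⟨e⟩⟩ := h
  let V : Opens A := ⟨{z | (z : X) ∈ U}, U.2.preimage continuous_subtype_val⟩
  let k (z : V) : (A ⊓ U : Opens X) := ⟨z, z.1.2, z.2⟩
  have ho : IsOpenEmbedding k := .of_comp _ (A ⊓ U).isOpenEmbedding'
    (A.isOpenEmbedding'.comp V.isOpenEmbedding')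
  have hg : IsOpenEmbedding fun z => (h z : X) := B.isOpenEmbedding'.comp h.isOpenEmbedding
  refine ⟨⟨A, Subtype.val, fun z => h z, ⟨x, hx⟩, A.isOpenEmbedding', hg, rfl, by rw [hxy], hC, V,
    fun _ => Iff.rfl, hU, ?_⟩⟩
  have h1 := complexPullComp ho (Opens.isOpenEmbedding_of_le (inf_le_right : A ⊓ U ≤ U))
    (isOpenEmbedding_resMap (V := V) A.isOpenEmbedding' fun z hz => hz) (fun a => rfl) E
  have h3 := complexPullComp (restrictHomeo h hU).isOpenEmbedding
      (Opens.isOpenEmbedding_of_le (inf_le_right : B ⊓ U ≤ U))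
      ((Opens.isOpenEmbedding_of_le (inf_le_right : B ⊓ U ≤ U)).comp
        (restrictHomeo h hU).isOpenEmbedding) (fun a => rfl) E
  have h2 := complexPullComp ho ((Opens.isOpenEmbedding_of_le (inf_le_right : B ⊓ U ≤ U)).comp
    (restrictHomeo h hU).isOpenEmbedding)
    (isOpenEmbedding_resMap (V := V) hg fun z => (hU z).1) (fun a => rfl) E
  have h4 : DerivedIso _ _ := ⟨e⟩
  exact (DerivedIso.of_iso h1.symm).trans ((h4.symm.pull ho).trans (((DerivedIso.of_iso h3).pull
    ho).trans (.of_iso h2)))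

lemma LocEquiv.refl (x : X) : LocEquiv U E C x x :=
  LocEquiv.intro (V := U) .id .id (fun _ => Iff.rfl) (fun _ => Iff.rfl) (fun _ => Iff.rfl)
    (.refl _) x

lemma LocEquiv.symm {x y : X} (h : LocEquiv U E C x y) : LocEquiv U E C y x := by
  obtain ⟨d⟩ := h.exists_data
  have := LocEquiv.intro d.hg d.hf (fun z => (d.hC z).symm) d.hgV d.hfV d.iso.symm d.y₀
  rwa [d.f_y₀, d.g_y₀] at this

/-- The common source is the fibre product of the two given sources over `X`, realized as the open
set `D` of the first. -/
lemma LocEquiv.trans {x y z : X} (h : LocEquiv U E C x y) (h' : LocEquiv U E C y z) :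
    LocEquiv U E C x z := by
  obtain ⟨d⟩ := h.exists_data
  obtain ⟨d'⟩ := h'.exists_data
  let D : Opens d.Y := ⟨{a | d.g a ∈ Set.range d'.f}, d'.hf.isOpen_range.preimage d.hg.continuous⟩
  let φ : d'.Y ≃ₜ Set.range d'.f := d'.hf.isEmbedding.toHomeomorph
  let k (a : D) : d'.Y := φ.symm ⟨d.g a, a.2⟩
  have hk (a : D) : d'.f (k a) = d.g a := congrArg Subtype.val (φ.apply_symm_apply ⟨d.g a, a.2⟩)
  have ho : IsOpenEmbedding k := .of_comp _ d'.hf <| by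
    convert d.hg.comp D.isOpenEmbedding' using 1
    exact funext hk
  let V : Opens D := ⟨{a | (a : d.Y) ∈ d.V}, d.V.2.preimage continuous_subtype_val⟩
  have hV (a : D) : k a ∈ d'.V ↔ (a : d.Y) ∈ d.V := by
    rw [d'.hfV, hk, d.hgV]
  have o1 : IsOpenEmbedding (resMap (Subtype.val : D → d.Y) V d.V fun z hz => hz) :=
    isOpenEmbedding_resMap D.isOpenEmbedding' _
  have o2 : IsOpenEmbedding (resMap k V d'.V fun z hz => (hV z).2 hz) :=
    isOpenEmbedding_resMap ho _
  have hf := d.hf.comp D.isOpenEmbedding'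
  have hg := d'.hg.comp ho
  have hfV (a : D) : a ∈ V ↔ d.f a ∈ U := d.hfV a
  have hgV (a : D) : a ∈ V ↔ d'.g (k a) ∈ U := (hV a).symm.trans (d'.hgV _)
  have hm := d.hg.comp D.isOpenEmbedding'
  have hmV (a : D) : a ∈ V ↔ d.g a ∈ U := d.hgV a
  have i1 := complexPullComp o1 (isOpenEmbedding_resMap d.hf fun z => (d.hfV z).1)
    (isOpenEmbedding_resMap hf fun z => (hfV z).1) (fun a => rfl) E
  have i2 := complexPullComp o1 (isOpenEmbedding_resMap d.hg fun z => (d.hgV z).1)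
    (isOpenEmbedding_resMap hm fun z => (hmV z).1) (fun a => rfl) E
  have i3 := complexPullComp o2 (isOpenEmbedding_resMap d'.hf fun z => (d'.hfV z).1)
    (isOpenEmbedding_resMap hm fun z => (hmV z).1) (fun a => Subtype.ext (hk a)) E
  have i4 := complexPullComp o2 (isOpenEmbedding_resMap d'.hg fun z => (d'.hgV z).1)
    (isOpenEmbedding_resMap hg fun z => (hgV z).1) (fun a => rfl) E
  have hD : d.y₀ ∈ D := ⟨d'.y₀, by rw [d'.f_y₀, d.g_y₀]⟩
  have := LocEquiv.intro (C := C) hf hg (fun a => (d.hC a).trans (by rw [← hk, d'.hC]; rfl)) hfV hgV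
    ((DerivedIso.of_iso i1.symm).trans ((d.iso.pull o1).trans ((DerivedIso.of_iso
      (i2 ≪≫ i3.symm)).trans ((d'.iso.pull o2).trans (.of_iso i4))))) ⟨d.y₀, hD⟩
  have e : k ⟨d.y₀, hD⟩ = d'.y₀ := by
    apply d'.hf.injective
    rw [hk, d'.f_y₀, d.g_y₀]
  simp only [Function.comp_apply, e, d.f_y₀, d'.g_y₀] at this
  exact this

lemma LocEquiv.mem_iff {x y : X} (h : LocEquiv U E C x y) : x ∈ C ↔ y ∈ C := by
  obtain ⟨d⟩ := h.exists_data
  have := d.hC d.y₀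
  rwa [d.f_y₀, d.g_y₀] at this

lemma LocEquiv.mem_open_iff {x y : X} (h : LocEquiv U E C x y) : x ∈ U ↔ y ∈ U := by
  obtain ⟨d⟩ := h.exists_data
  have := (d.hfV d.y₀).symm.trans (d.hgV d.y₀)
  rwa [d.f_y₀, d.g_y₀] at this

end LocEquiv

/-! ### Translations of a Euclidean factor are local equivalences. -/

section Translation

variable {R : Type u} [CommRing R] {X : Type u} [TopologicalSpace X]

/-- The translations in a nonzero direction of a Euclidean factor. -/
def translationFlow {k : ℕ} {Q : Type u} [TopologicalSpace Q]
    (V : Opens (EuclideanSpace ℝ (Fin k) × Q)) {Z : Set Q} (hV : ∀ p, p ∈ V ↔ p.2 ∈ Z)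
    (w : EuclideanSpace ℝ (Fin k)) (hw : w ≠ 0) : UnitFlow V where
  T s p := ⟨(p.1.1 + s • w, p.1.2), (hV _).2 ((hV p.1).1 p.2)⟩
  continuous_T := by fun_prop
  zero p := by simp
  add s t p := by simp [add_smul, add_assoc, add_comm (s • w)]
  ξ p := inner ℝ p.1.1 w / ‖w‖ ^ 2
  continuous_ξ := by fun_prop
  ξ_T s p := by
    have : ‖w‖ ≠ 0 := norm_ne_zero_iff.2 hw
    simp only [inner_add_left, inner_smul_left, real_inner_self_eq_norm_sq, RCLike.conj_to_real]
    field_simp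

variable {U : Opens X} {E : SheafComplex R U} {C : Set X}

/-- The preimage of `U` has the form `ℝ^k × ZU`, so translation is a unit-speed flow on it and
`derivedIso_pull` compares `E` with its translate. Only membership in `U` and `C` has to be
independent of the Euclidean coordinate. -/
theorem LocEquiv.translate (hF : ∀ i y, HasFrameAt (E.homology i) y) {a : ℤ}
    (ha : ∀ i < a, Limits.IsZero (E.homology i)) {k : ℕ} {Q : Type u} [TopologicalSpace Q]
    {g : EuclideanSpace ℝ (Fin k) × Q → X} (hg : IsOpenEmbedding g) {ZU ZC : Set Q}
    (hU : ∀ p, g p ∈ U ↔ p.2 ∈ ZU) (hC : ∀ p, g p ∈ C ↔ p.2 ∈ ZC)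
    (v v' : EuclideanSpace ℝ (Fin k)) (q : Q) : LocEquiv U E C (g (v, q)) (g (v', q)) := by
  -- A zero direction has no unit-speed coordinate and is treated apart.
  by_cases hvv : v' - v = 0
  · rw [sub_eq_zero.1 hvv]
    exact .refl _
  let V : Opens (EuclideanSpace ℝ (Fin k) × Q) := ⟨{p | g p ∈ U}, U.2.preimage hg.continuous⟩
  have hV (p) : p ∈ V ↔ g p ∈ U := Iff.rfl
  let φ := translationFlow V (fun p => (hV p).trans (hU p)) _ hvv
  let τ : EuclideanSpace ℝ (Fin k) × Q ≃ₜ EuclideanSpace ℝ (Fin k) × Q :=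
    (Homeomorph.addRight (v' - v)).prodCongr (Homeomorph.refl Q)
  have hτ (p) : (τ p).2 = p.2 := rfl
  have hgτ : IsOpenEmbedding fun p => g (τ p) := hg.comp τ.isOpenEmbedding
  have hVτ (p) : p ∈ V ↔ g (τ p) ∈ U := by
    rw [hV, hU, hU, hτ]
  have og := isOpenEmbedding_resMap hg fun p => (hV p).1
  have h := φ.derivedIso_pull (E := complexPull og E) (a := a) (fun i hi => by
      exact ((sheafPull og).map_isZero (ha i hi)).of_iso (homologyPullIso og E i))
    (fun i y => ((hF i _).pull og).of_iso (homologyPullIso og E i).symm)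
  have h1 := complexPullComp (φ.isOpenEmbedding 1) og
    (isOpenEmbedding_resMap hgτ fun p => (hVτ p).1) (fun p => by
      apply Subtype.ext
      change g (p.1.1 + (1 : ℝ) • (v' - v), p.1.2) = g (p.1.1 + (v' - v), p.1.2)
      rw [one_smul]) E
  have := LocEquiv.intro (C := C) hg hgτ (fun p => by rw [hC, hC, hτ]) hV hVτ
    (h.symm.trans (.of_iso h1)) (v, q)
  have e : τ (v, q) = (v', q) := Prod.ext (add_sub_cancel v v') rfl
  rwa [e] at this

lemma IsTSCoefficientSystem.hasFrameAt (hE : IsTSCoefficientSystem E) (i : ℤ) (y : U) :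
    HasFrameAt (E.homology i) y := by
  obtain ⟨⟨p, h⟩, h'⟩ := hE
  by_cases h0 : i = 0
  · subst h0
    exact (h y).2.hasFrameAt
  by_cases h1 : i = 1
  · subst h1
    exact (h y).1.hasFrameAt
  exact hasFrameAt_of_isZero (h' i h0 h1) y

lemma IsTSCoefficientSystem.isZero (hE : IsTSCoefficientSystem E) (i : ℤ) (hi : i < 0) :
    Limits.IsZero (E.homology i) :=
  hE.2 i (by omega) (by omega)

end Translation

/-! ### Topology of open cones and their radial contractions. -/

section Cone

variable {L : Type u}

lemma OpenCone.point_zero (l : L) {t : Set.Ico (0 : ℝ) 1} (ht : (t : ℝ) = 0) :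
    OpenCone.point l t = OpenCone.vertex L :=
  Quotient.sound (Or.inr ⟨ht, trivial⟩)

lemma OpenCone.point_eq_vertex {l : L} {t : Set.Ico (0 : ℝ) 1} :
    OpenCone.point l t = OpenCone.vertex L ↔ (t : ℝ) = 0 := by
  refine ⟨fun h => ?_, point_zero l⟩
  rcases Quotient.exact h with h | h
  · cases h
  · exact h.1

lemma OpenCone.point_inj {l l' : L} {t t' : Set.Ico (0 : ℝ) 1} (ht : (t : ℝ) ≠ 0) :
    OpenCone.point l t = OpenCone.point l' t' ↔ l = l' ∧ t = t' := by
  refine ⟨fun h => ?_, by rintro ⟨rfl, rfl⟩; rfl⟩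
  rcases Quotient.exact h with h | h
  · simpa using h
  · exact absurd h.1 ht

lemma OpenCone.cases (c : OpenCone L) : c = OpenCone.vertex L ∨
    ∃ l, ∃ t : Set.Ico (0 : ℝ) 1, 0 < (t : ℝ) ∧ c = OpenCone.point l t := by
  obtain ⟨(_ | ⟨l, t⟩), rfl⟩ := Quotient.exists_rep c
  · exact Or.inl rfl
  · rcases t.2.1.eq_or_lt with h | h
    · exact Or.inl (point_zero l h.symm)
    · exact Or.inr ⟨l, t, h, rfl⟩

/-- The points over the bounded height `ε`. -/
def OpenCone.scale (ε : Set.Ioc (0 : ℝ) 1) : OpenCone L → OpenCone L :=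
  Quotient.map (Sum.map id fun p => (p.1, ⟨ε * p.2, mul_nonneg ε.2.1.le p.2.2.1,
    (mul_le_of_le_one_left p.2.2.1 ε.2.2).trans_lt p.2.2.2⟩)) (by
      rintro a b (rfl | ⟨ha, hb⟩)
      · exact Or.inl rfl
      · refine Or.inr ⟨?_, ?_⟩
        · rcases a with _ | a
          · trivial
          · exact mul_eq_zero_of_right _ ha
        · rcases b with _ | b
          · trivial
          · exact mul_eq_zero_of_right _ hb)

lemma OpenCone.scale_vertex (ε : Set.Ioc (0 : ℝ) 1) : scale ε (vertex L) = vertex L := rfl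

lemma OpenCone.scale_point (ε : Set.Ioc (0 : ℝ) 1) (l : L) (t : Set.Ico (0 : ℝ) 1) :
    ∃ t' : Set.Ico (0 : ℝ) 1, (t' : ℝ) = ε * t ∧ scale ε (point l t) = point l t' :=
  ⟨_, rfl, rfl⟩

lemma OpenCone.scale_injective (ε : Set.Ioc (0 : ℝ) 1) : Function.Injective (scale (L := L) ε) := by
  intro c d h
  rcases c.cases with rfl | ⟨l, t, ht, rfl⟩ <;> rcases d.cases with rfl | ⟨l', t', ht', rfl⟩
  · rfl
  · obtain ⟨s, hs, e⟩ := scale_point ε l' t'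
    rw [e, scale_vertex, eq_comm, point_eq_vertex] at h
    have := mul_pos ε.2.1 ht'
    linarith
  · obtain ⟨s, hs, e⟩ := scale_point ε l t
    rw [e, scale_vertex, point_eq_vertex] at h
    have := mul_pos ε.2.1 ht
    linarith
  · obtain ⟨s, hs, e⟩ := scale_point ε l t
    obtain ⟨s', hs', e'⟩ := scale_point ε l' t'
    have := mul_pos ε.2.1 ht
    rw [e, e', point_inj (by rw [hs]; exact this.ne')] at h
    obtain ⟨rfl, rfl⟩ := h
    congr 1
    exact Subtype.ext (mul_left_cancel₀ ε.2.1.ne' (hs.symm.trans hs'))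

lemma coneSkel_vertex {G : ℤ → Set L} {j : ℤ} : OpenCone.vertex L ∈ coneSkel G j ↔ -1 ≤ j :=
  ⟨fun h => h.1, fun h => ⟨h, Or.inl rfl⟩⟩

lemma coneSkel_point {G : ℤ → Set L} {j : ℤ} {l : L} {t : Set.Ico (0 : ℝ) 1} (ht : 0 < (t : ℝ)) :
    OpenCone.point l t ∈ coneSkel G j ↔ -1 ≤ j ∧ l ∈ G j := by
  refine and_congr_right fun _ => ⟨?_, fun h => Or.inr ⟨l, h, t, rfl⟩⟩
  rintro (h | ⟨l', hl, t', h⟩)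
  · rw [OpenCone.point_eq_vertex] at h
    exact absurd h ht.ne'
  · rw [OpenCone.point_inj ht.ne'] at h
    exact h.1 ▸ hl

lemma coneSkel_scale {G : ℤ → Set L} {j : ℤ} (ε : Set.Ioc (0 : ℝ) 1) (c : OpenCone L) :
    OpenCone.scale ε c ∈ coneSkel G j ↔ c ∈ coneSkel G j := by
  rcases c.cases with rfl | ⟨l, t, ht, rfl⟩
  · rfl
  · obtain ⟨s, hs, e⟩ := OpenCone.scale_point ε l t
    rw [e, coneSkel_point ht, coneSkel_point (by rw [hs]; exact mul_pos ε.2.1 ht)]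

variable [TopologicalSpace L]

lemma OpenCone.isOpen_iff {W : Set (OpenCone L)} : IsOpen W ↔
    IsOpen {p : L × Set.Ico (0 : ℝ) 1 | OpenCone.point p.1 p.2 ∈ W} := by
  refine (isOpen_coinduced (f := Quotient.mk (coneSetoid L)) (s := W)).trans ?_
  rw [isOpen_sum_iff]
  exact and_iff_right (isOpen_discrete _)

lemma OpenCone.continuous_point :
    Continuous fun p : L × Set.Ico (0 : ℝ) 1 => OpenCone.point p.1 p.2 :=
  continuous_def.2 fun _ hW => isOpen_iff.1 hW

lemma isOpenEmbedding_mul (ε : Set.Ioc (0 : ℝ) 1) : IsOpenEmbedding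
    fun t : Set.Ico (0 : ℝ) 1 => (⟨ε * t, mul_nonneg ε.2.1.le t.2.1,
      (mul_le_of_le_one_left t.2.1 ε.2.2).trans_lt t.2.2⟩ : Set.Ico (0 : ℝ) 1) := by
  constructor
  · have h := (Homeomorph.mulLeft₀ (ε : ℝ) ε.2.1.ne').isEmbedding.comp
      (IsEmbedding.subtypeVal (p := (· ∈ Set.Ico (0 : ℝ) 1)))
    exact .of_comp (by fun_prop) continuous_subtype_val h
  · have : Set.range (fun t : Set.Ico (0 : ℝ) 1 => (⟨ε * t, mul_nonneg ε.2.1.le t.2.1,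
      (mul_le_of_le_one_left t.2.1 ε.2.2).trans_lt t.2.2⟩ : Set.Ico (0 : ℝ) 1)) =
        {t : Set.Ico (0 : ℝ) 1 | (t : ℝ) < ε} := by
      ext t
      constructor
      · rintro ⟨s, rfl⟩
        exact mul_lt_of_lt_one_right ε.2.1 s.2.2
      · intro ht
        exact ⟨⟨t / ε, div_nonneg t.2.1 ε.2.1.le, (div_lt_one ε.2.1).2 ht⟩,
          Subtype.ext (mul_div_cancel₀ _ ε.2.1.ne')⟩
    rw [this]
    exact isOpen_lt continuous_subtype_val continuous_const

lemma OpenCone.isOpenEmbedding_scale (ε : Set.Ioc (0 : ℝ) 1) :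
    IsOpenEmbedding (scale (L := L) ε) := by
  have hm := (IsOpenEmbedding.id (X := L)).prodMap (isOpenEmbedding_mul ε)
  refine .of_continuous_injective_isOpenMap ?_ (scale_injective ε) fun W hW => ?_
  · exact continuous_def.2 fun W hW => isOpen_iff.2 ((isOpen_iff.1 hW).preimage hm.continuous)
  · rw [isOpen_iff]
    convert hm.isOpenMap _ (isOpen_iff.1 hW)
    ext ⟨l, t⟩
    constructor
    · rintro ⟨c, hc, h⟩
      rcases c.cases with rfl | ⟨l', t', ht', rfl⟩
      · rw [scale_vertex, eq_comm, point_eq_vertex] at h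
        -- The vertex is `[l, 0]` for the given `l`, so it has a preimage in `L × [0,1)` over every
        -- such point.
        refine ⟨(l, ⟨0, le_rfl, one_pos⟩), ?_, ?_⟩
        · change point l _ ∈ W
          rwa [point_zero l rfl]
        · exact Prod.ext rfl (Subtype.ext ((mul_zero _).trans h.symm))
      · refine ⟨(l', t'), hc, ?_⟩
        obtain ⟨s, hs, e⟩ := scale_point ε l' t'
        rw [e, point_inj (by rw [hs]; exact (mul_pos ε.2.1 ht').ne')] at h
        exact Prod.ext h.1 (Subtype.ext (hs.symm.trans (congrArg Subtype.val h.2)))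
    · rintro ⟨⟨l', t'⟩, h, e⟩
      refine ⟨_, h, ?_⟩
      cases e
      rfl

/-- Since `L` is compact, a neighborhood of `L × {0}` contains some `L × [0, ε)`. This is where
compactness of links enters. -/
lemma OpenCone.exists_scale_mem [CompactSpace L] {W : Set (OpenCone L)} (hW : IsOpen W)
    (h : vertex L ∈ W) : ∃ ε : Set.Ioc (0 : ℝ) 1, ∀ δ : Set.Ioc (0 : ℝ) 1, (δ : ℝ) ≤ ε →
      ∀ c, scale δ c ∈ W := by
  obtain ⟨A, B, -, hB, hA', hB', hAB⟩ := generalized_tube_lemma (isCompact_univ (X := L))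
    (isCompact_singleton (x := (⟨0, le_rfl, one_pos⟩ : Set.Ico (0 : ℝ) 1))) (isOpen_iff.1 hW) (by
      rintro ⟨l, t⟩ ⟨-, rfl⟩
      change point l _ ∈ W
      rwa [point_zero l rfl])
  obtain ⟨ε, hε, hb⟩ := Metric.isOpen_iff.1 hB _ (hB' rfl)
  refine ⟨⟨min ε 1, lt_min hε one_pos, min_le_right _ _⟩, fun δ hδ c => ?_⟩
  rcases c.cases with rfl | ⟨l, t, ht, rfl⟩
  · exact h
  · obtain ⟨s, hs, e⟩ := scale_point δ l t
    rw [e]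
    refine hAB (Set.mk_mem_prod (hA' trivial) (hb ?_))
    rw [Metric.mem_ball, Subtype.dist_eq, Real.dist_eq, sub_zero, abs_of_nonneg s.2.1, hs]
    exact (mul_lt_of_lt_one_right δ.2.1 t.2.2).trans_le (hδ.trans (min_le_left _ _))

end Cone

/-! ### Centered charts defined on all of Euclidean space. -/

section Euclidean

variable {k : ℕ}

lemma exists_univ_chart (c : EuclideanSpace ℝ (Fin k)) {O : Set (EuclideanSpace ℝ (Fin k))}
    (hO : IsOpen O) (hc : c ∈ O) :
    ∃ β : OpenPartialHomeomorph (EuclideanSpace ℝ (Fin k)) (EuclideanSpace ℝ (Fin k)),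
      β.source = Set.univ ∧ β 0 = c ∧ ∀ v, β v ∈ O := by
  obtain ⟨ε, hε, hb⟩ := Metric.isOpen_iff.1 hO c hc
  refine ⟨.univBall c ε, OpenPartialHomeomorph.univBall_source c ε,
    OpenPartialHomeomorph.univBall_apply_zero c ε, fun v => hb ?_⟩
  rw [← OpenPartialHomeomorph.univBall_target c hε]
  exact OpenPartialHomeomorph.map_source _ (by simp)

lemma exists_isOpenEmbedding_of_chartedSpace {M : Type*} [TopologicalSpace M]
    [ChartedSpace (EuclideanSpace ℝ (Fin k)) M] (m : M) {O : Set M} (hO : IsOpen O) (hm : m ∈ O) :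
    ∃ e : EuclideanSpace ℝ (Fin k) → M, IsOpenEmbedding e ∧ e 0 = m ∧ ∀ v, e v ∈ O := by
  let φ := chartAt (EuclideanSpace ℝ (Fin k)) m
  have hφ : m ∈ φ.source := mem_chart_source _ m
  obtain ⟨β, hβ, h0, h⟩ := exists_univ_chart (φ m) (φ.symm.isOpen_inter_preimage hO)
    ⟨φ.map_source hφ, by rwa [Set.mem_preimage, φ.left_inv hφ]⟩
  refine ⟨β.trans φ.symm, OpenPartialHomeomorph.isOpenEmbedding _ ?_, ?_, fun v => (h v).2⟩
  · rw [OpenPartialHomeomorph.trans_source, hβ, Set.univ_inter, Set.eq_univ_iff_forall]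
    exact fun v => (h v).1
  · rw [OpenPartialHomeomorph.trans_apply, h0, φ.left_inv hφ]

lemma nonempty_chartedSpace {M : Type*} [TopologicalSpace M]
    (h : ∀ m : M, ∃ e : EuclideanSpace ℝ (Fin k) → M, IsOpenEmbedding e ∧ m ∈ Set.range e) :
    Nonempty (ChartedSpace (EuclideanSpace ℝ (Fin k)) M) := by
  choose e he hm using h
  exact ⟨{
    atlas := Set.range fun m => ((he m).toOpenPartialHomeomorph).symm
    chartAt := fun m => ((he m).toOpenPartialHomeomorph).symm
    mem_chart_source := fun m => by simpa using hm m
    chart_mem_atlas := fun m => ⟨m, rfl⟩ }⟩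

end Euclidean

/-! ### Distinguished neighborhoods as open embeddings of `ℝ^k × cL`, and unions of strata. -/

section Charts

variable {X : Type u} [TopologicalSpace X]

/-- A distinguished neighborhood of `x` in the form of an open embedding. -/
structure ConeChart (n : ℕ) (F : ℤ → Set X) (k : ℕ) (x : X) where
  /-- the link -/
  L : Type u
  [top : TopologicalSpace L]
  [compact : CompactSpace L]
  /-- the filtration of the link -/
  G : ℤ → Set L
  filtration : IsFiltration ((n : ℤ) - k - 1) G
  /-- the chart -/
  g : EuclideanSpace ℝ (Fin k) × OpenCone L → X
  isOpenEmbedding : IsOpenEmbedding g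
  base : g (0, OpenCone.vertex L) = x
  mem_iff : ∀ (j : ℤ) p, g p ∈ F (k + j + 1) ↔ p.2 ∈ coneSkel G j

attribute [instance] ConeChart.top ConeChart.compact

lemma coneSkel_eq_vertex {d : ℤ} {L : Type u} [TopologicalSpace L] {G : ℤ → Set L}
    (hG : IsFiltration d G) {c : OpenCone L} :
    c ∈ coneSkel G (-1) ↔ c = OpenCone.vertex L := by
  refine ⟨?_, ?_⟩
  · rintro ⟨-, h | ⟨l, hl, -⟩⟩
    · exact h
    · rw [hG.neg _ (by norm_num)] at hl
      exact hl.elim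
  · rintro rfl
    exact coneSkel_vertex.2 le_rfl

namespace ConeChart

variable {n : ℕ} {F : ℤ → Set X} {k : ℕ} {x : X}

lemma mem_iff' (c : ConeChart n F k x) (i : ℤ) (p) :
    c.g p ∈ F i ↔ p.2 ∈ coneSkel c.G (i - k - 1) := by
  rw [← c.mem_iff]
  congr! 2
  ring

lemma mem_layer_iff (c : ConeChart n F k x) (p) :
    c.g p ∈ layer F k ↔ p.2 = OpenCone.vertex c.L := by
  rw [layer, Set.mem_sdiff, c.mem_iff', c.mem_iff', show (k : ℤ) - k - 1 = -1 by ring,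
    coneSkel_eq_vertex c.filtration]
  refine and_iff_left_of_imp fun h h' => ?_
  have := h'.1
  omega

lemma mem_skel_iff (c : ConeChart n F k x) (p) :
    c.g p ∈ F k ↔ p.2 = OpenCone.vertex c.L := by
  rw [c.mem_iff', show (k : ℤ) - k - 1 = -1 by ring, coneSkel_eq_vertex c.filtration]

lemma exists_shrink (c : ConeChart n F k x) {O : Set X} (hO : IsOpen O) (hx : x ∈ O) :
    ∃ c' : ConeChart n F k x, ∀ p, c'.g p ∈ O := by
  obtain ⟨A, B, hA, hB, h0, hv, hAB⟩ := isOpen_prod_iff.1 (hO.preimage c.isOpenEmbedding.continuous)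
    0 (OpenCone.vertex c.L) (by rwa [Set.mem_preimage, c.base])
  obtain ⟨β, hβ, hβ0, hβA⟩ := exists_univ_chart 0 hA h0
  obtain ⟨ε, hε⟩ := OpenCone.exists_scale_mem hB hv
  refine ⟨{ L := c.L, G := c.G, filtration := c.filtration
            g := fun p => c.g (β p.1, OpenCone.scale ε p.2)
            isOpenEmbedding := c.isOpenEmbedding.comp
              ((β.isOpenEmbedding hβ).prodMap (OpenCone.isOpenEmbedding_scale ε))
            base := by rw [hβ0, OpenCone.scale_vertex, c.base]
            mem_iff := fun j p => by rw [c.mem_iff, coneSkel_scale] }, fun p => ?_⟩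
  exact hAB (Set.mk_mem_prod (hβA _) (hε ε le_rfl _))

/-- Change of the filtered space by a homeomorphism. -/
lemma transport (c : ConeChart n F k x) {Y : Type u} [TopologicalSpace Y] {f g : Y → X}
    (hf : IsOpenEmbedding f) (hg : IsOpenEmbedding g) {y : Y} (hy : f y = x)
    (h : ∀ i z, f z ∈ F i ↔ g z ∈ F i) : Nonempty (ConeChart n F k (g y)) := by
  obtain ⟨c, hc⟩ := c.exists_shrink hf.isOpen_range ⟨y, hy⟩
  let φ : Y ≃ₜ Set.range f := hf.isEmbedding.toHomeomorph
  have hφ (p) : f (φ.symm ⟨c.g p, hc p⟩) = c.g p :=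
    congrArg Subtype.val (φ.apply_symm_apply ⟨c.g p, hc p⟩)
  have ho : IsOpenEmbedding fun p => φ.symm ⟨c.g p, hc p⟩ := .of_comp _ hf <| by
    convert c.isOpenEmbedding using 1
    exact funext hφ
  refine ⟨{ L := c.L, G := c.G, filtration := c.filtration
            g := fun p => g (φ.symm ⟨c.g p, hc p⟩)
            isOpenEmbedding := hg.comp ho
            base := congrArg g (hf.injective ?_)
            mem_iff := fun j p => by rw [← h, hφ, c.mem_iff] }⟩
  rw [hφ, c.base, hy]

/-- The chart of the layer. -/
def layerMap (c : ConeChart n F k x) (v : EuclideanSpace ℝ (Fin k)) : layer F k :=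
  ⟨c.g (v, OpenCone.vertex c.L), (c.mem_layer_iff _).2 rfl⟩

lemma isOpenEmbedding_layerMap (c : ConeChart n F k x) : IsOpenEmbedding c.layerMap := by
  constructor
  · have h := c.isOpenEmbedding.isEmbedding.comp
      (isEmbedding_prodMkLeft (X := EuclideanSpace ℝ (Fin k)) (OpenCone.vertex c.L))
    exact .of_comp (h.continuous.subtype_mk _) continuous_subtype_val h
  · have : Set.range c.layerMap = Subtype.val ⁻¹' Set.range c.g := by
      ext ⟨y, hy⟩
      constructor
      · rintro ⟨v, hv⟩
        exact ⟨_, congrArg Subtype.val hv⟩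
      · rintro ⟨⟨v, d⟩, rfl⟩
        obtain rfl : d = _ := (c.mem_layer_iff _).1 hy
        exact ⟨v, rfl⟩
    rw [this]
    exact c.isOpenEmbedding.isOpen_range.preimage continuous_subtype_val

lemma layerMap_zero (c : ConeChart n F k x) : (c.layerMap 0 : X) = x := c.base

lemma hasDistinguishedNhd (c : ConeChart n F k x) : HasDistinguishedNhd n F k x := by
  let B : Set X := Set.range c.g ∩ layer F k
  have hB (v) : (c.layerMap v : X) ∈ B := ⟨⟨_, rfl⟩, (c.layerMap v).2⟩
  let b (v : EuclideanSpace ℝ (Fin k)) : B := ⟨c.layerMap v, hB v⟩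
  have hb : IsEmbedding b := .of_comp
    ((continuous_subtype_val.comp c.isOpenEmbedding_layerMap.continuous).subtype_mk _)
    continuous_subtype_val (show IsEmbedding fun v => (c.layerMap v : X) from
      IsEmbedding.subtypeVal.comp c.isOpenEmbedding_layerMap.isEmbedding)
  have hbs : Function.Surjective b := by
    rintro ⟨_, ⟨⟨v, d⟩, rfl⟩, hy⟩
    obtain rfl : d = _ := (c.mem_layer_iff _).1 hy
    exact ⟨v, rfl⟩
  let e : EuclideanSpace ℝ (Fin k) ≃ₜ B := hb.toHomeomorphOfSurjective hbs
  let N : Opens X := ⟨Set.range c.g, c.isOpenEmbedding.isOpen_range⟩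
  let ψ : EuclideanSpace ℝ (Fin k) × OpenCone c.L ≃ₜ N :=
    c.isOpenEmbedding.isEmbedding.toHomeomorph
  refine ⟨B, N, c.L, c.top, c.compact, c.G,
    (e.symm.prodCongr (Homeomorph.refl _)).trans ψ, ?_, ⟨_, N.2, rfl⟩, ⟨_, c.base⟩, c.filtration,
    fun j => ?_⟩
  · exact c.layerMap_zero ▸ hB 0
  · ext z
    constructor
    · rintro ⟨p, hp, rfl⟩
      exact ⟨(c.mem_iff j (e.symm p.1, p.2)).2 hp, ⟨_, rfl⟩⟩
    · rintro ⟨hz, ⟨p, rfl⟩⟩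
      refine ⟨(e p.1, p.2), (c.mem_iff j p).1 hz, ?_⟩
      change c.g (e.symm (e p.1), p.2) = c.g p
      rw [e.symm_apply_apply]

end ConeChart

/-- The base `B` is open in a `k`-manifold, so it may be replaced by a Euclidean chart centered at
the base coordinate of `x`. -/
lemma HasDistinguishedNhd.exists_coneChart {n : ℕ} {F : ℤ → Set X} {k : ℕ} {x : X}
    (h : HasDistinguishedNhd n F k x) (hM : IsManifoldSet k (layer F k)) (hx : x ∈ layer F k) :
    Nonempty (ConeChart n F k x) := by
  obtain ⟨B, N, L, _, _, G, h, hxB, ⟨O, hO, hBO⟩, hxN, hG, hh⟩ := h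
  obtain ⟨hM⟩ := hM
  have hskel (j : ℤ) (p) : (h p : X) ∈ F (k + j + 1) ↔ p.2 ∈ coneSkel G j := by
    constructor
    · intro hp
      obtain ⟨q, hq, e⟩ := (hh j).symm.subset ⟨hp, (h p).2⟩
      obtain rfl := h.injective (Subtype.ext e)
      exact hq
    · intro hp
      exact ((hh j).subset ⟨p, hp, rfl⟩).1
  obtain ⟨⟨b, d⟩, hbd⟩ := h.surjective ⟨x, hxN⟩
  -- The case `j = -1`: `x` lies in `F k`, which corresponds to the vertex of the cone.
  have hd : d = OpenCone.vertex L := by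
    rw [← coneSkel_eq_vertex hG]
    refine (hskel (-1) (b, d)).1 ?_
    rw [hbd]
    convert hx.1 using 2
    ring
  subst hd
  have hb : (b : X) ∈ layer F k := (hBO.subset b.2).2
  obtain ⟨e, he, he0, heO⟩ := exists_isOpenEmbedding_of_chartedSpace (k := k)
    (⟨b, hb⟩ : layer F k) (hO.preimage continuous_subtype_val) (hBO.subset b.2).1
  have heB (v) : (e v : X) ∈ B := hBO.symm.subset ⟨heO v, (e v).2⟩
  have hBl : B ⊆ layer F k := fun z hz => (hBO.subset hz).2
  have hi : IsOpenEmbedding (Set.inclusion hBl) := .inclusion hBl (by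
    convert hO.preimage (continuous_subtype_val (p := (· ∈ layer F k))) using 1
    ext z
    exact ⟨fun hz => (hBO.subset hz).1, fun hz => hBO.symm.subset ⟨hz, z.2⟩⟩)
  have heo : IsOpenEmbedding fun v => (⟨e v, heB v⟩ : B) := .of_comp _ hi he
  exact ⟨{
    L := L, G := G, filtration := hG
    g := fun p => h (⟨e p.1, heB p.1⟩, p.2)
    isOpenEmbedding := N.isOpenEmbedding'.comp
      (h.isOpenEmbedding.comp (heo.prodMap .id))
    base := by
      have he1 : (e 0 : X) = b := congrArg Subtype.val he0
      have : (⟨e 0, heB 0⟩ : B) = b := Subtype.ext he1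
      change (h (⟨e 0, heB 0⟩, OpenCone.vertex L) : X) = x
      rw [this, hbd]
    mem_iff := fun j p => hskel j _ }⟩

variable {n : ℕ} {F : ℤ → Set X}

lemma IsCSSet.exists_coneChart (hF : IsCSSet n F) {k : ℕ} {x : X} (hx : x ∈ layer F k) :
    Nonempty (ConeChart n F k x) :=
  (hF.local_cone k x hx).exists_coneChart (hF.manifold k) hx

lemma isManifoldSet_layer {k : ℕ} (h : ∀ x ∈ layer F k, Nonempty (ConeChart n F k x)) :
    IsManifoldSet k (layer F k) :=
  nonempty_chartedSpace fun m => by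
    obtain ⟨c⟩ := h m m.2
    exact ⟨c.layerMap, c.isOpenEmbedding_layerMap, 0, Subtype.ext c.layerMap_zero⟩

lemma IsFiltration.exists_mem_layer {d : ℤ} (hF : IsFiltration d F) (x : X) :
    ∃ k : ℕ, x ∈ layer F k := by
  classical
  have h : ∃ k : ℕ, x ∈ F k := by
    refine ⟨d.toNat, hF.mono (Int.self_le_toNat d) ?_⟩
    rw [hF.top]
    trivial
  refine ⟨Nat.find h, Nat.find_spec h, fun h' => ?_⟩
  rcases Nat.eq_zero_or_pos (Nat.find h) with h0 | h0
  · rw [h0, hF.neg _ (by simp)] at h'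
    exact h'
  · refine Nat.find_min h (Nat.sub_one_lt h0.ne') ?_
    convert h' using 2
    omega

lemma IsFiltration.layer_eq {d : ℤ} (hF : IsFiltration d F) {x : X} {k k' : ℤ}
    (h : x ∈ layer F k) (h' : x ∈ layer F k') : k = k' := by
  by_contra hne
  rcases lt_or_gt_of_ne hne with hlt | hlt
  · exact h'.2 (hF.mono (by omega) h.1)
  · exact h.2 (hF.mono (by omega) h'.1)

lemma IsFiltration.nonneg_of_mem_layer {d : ℤ} (hF : IsFiltration d F) {x : X} {k : ℤ}
    (h : x ∈ layer F k) : 0 ≤ k := by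
  by_contra hk
  have := h.1
  rw [hF.neg k (by omega)] at this
  exact this

lemma isUnionOfStrata_iff {d : ℤ} (hF : IsFiltration d F) {A : Set X} : IsUnionOfStrata F A ↔
    ∀ k, ∀ x ∈ layer F k, x ∈ A → connectedComponentIn (layer F k) x ⊆ A := by
  constructor
  · rintro ⟨𝒮, h𝒮, rfl⟩ k x hx ⟨S, hS, hxS⟩
    obtain ⟨k', y, hy, rfl⟩ := h𝒮 S hS
    obtain rfl := hF.layer_eq hx (connectedComponentIn_subset _ _ hxS)
    rw [← connectedComponentIn_eq hxS]
    exact Set.subset_sUnion_of_mem hS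
  · intro h
    refine ⟨{S | IsStratum F S ∧ S ⊆ A}, fun S hS => hS.1, Set.Subset.antisymm (fun x hx => ?_) ?_⟩
    · obtain ⟨k, hk⟩ := hF.exists_mem_layer x
      exact ⟨_, ⟨⟨k, x, hk, rfl⟩, h k x hk hx⟩, mem_connectedComponentIn hk⟩
    · exact Set.sUnion_subset fun S hS => hS.2

lemma IsUnionOfStrata.mem_iff {d : ℤ} (hF : IsFiltration d F) {A : Set X}
    (hA : IsUnionOfStrata F A) {k : ℤ} {T : Set X} (hT : IsPreconnected T) (hTk : T ⊆ layer F k)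
    {x y : X} (hx : x ∈ T) (hy : y ∈ T) : x ∈ A ↔ y ∈ A := by
  have h (x y : X) (hx : x ∈ T) (hy : y ∈ T) (hxA : x ∈ A) : y ∈ A :=
    (isUnionOfStrata_iff hF).1 hA k x (hTk hx) hxA (hT.subset_connectedComponentIn hx hTk hy)
  exact ⟨h x y hx hy, h y x hy hx⟩

lemma IsUnionOfStrata.of_preconnected {d : ℤ} (hF : IsFiltration d F) {A : Set X}
    (h : ∀ k T, IsPreconnected T → T ⊆ layer F k → ∀ x ∈ T, ∀ y ∈ T, x ∈ A → y ∈ A) :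
    IsUnionOfStrata F A :=
  (isUnionOfStrata_iff hF).2 fun k x hx hxA y hy =>
    h k _ isPreconnected_connectedComponentIn (connectedComponentIn_subset _ _) x
      (mem_connectedComponentIn hx) y hy hxA

namespace ConeChart

variable {k : ℕ} {x : X}

/-- The slice `ℝ^k × {q}` is connected, and its skeleton memberships depend only on `q`, so it stays
in one stratum. -/
lemma mem_union_iff_fst (c : ConeChart n F k x) {d : ℤ} (hF : IsFiltration d F) {A : Set X}
    (hA : IsUnionOfStrata F A) (v v' : EuclideanSpace ℝ (Fin k)) (q : OpenCone c.L) :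
    c.g (v, q) ∈ A ↔ c.g (v', q) ∈ A := by
  obtain ⟨m, hm⟩ := hF.exists_mem_layer (c.g (v, q))
  refine hA.mem_iff hF (T := Set.range fun w => c.g (w, q)) (k := m) ?_ ?_ ⟨v, rfl⟩ ⟨v', rfl⟩
  · exact isPreconnected_range (c.isOpenEmbedding.continuous.comp (by fun_prop))
  · rintro _ ⟨w, rfl⟩
    rw [layer, Set.mem_sdiff, c.mem_iff', c.mem_iff'] at hm ⊢
    exact hm

lemma mem_union_iff (c : ConeChart n F k x) {d : ℤ} (hF : IsFiltration d F) {A : Set X}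
    (hA : IsUnionOfStrata F A) (p) : c.g p ∈ A ↔ p.2 ∈ {q | c.g (0, q) ∈ A} :=
  c.mem_union_iff_fst hF hA p.1 0 p.2

/-- The open cone over a point of the link, minus the vertex, lies in one layer. -/
lemma exists_ray (c : ConeChart n F k x) {d : ℤ} (hF : IsFiltration d F) (l : c.L) :
    ∃ T : Set X, ∃ m : ℤ, IsPreconnected T ∧ T ⊆ layer F m ∧
      ∀ v, ∀ t : Set.Ico (0 : ℝ) 1, 0 < (t : ℝ) → c.g (v, OpenCone.point l t) ∈ T := by
  let f (p : EuclideanSpace ℝ (Fin k) × Set.Ioo (0 : ℝ) 1) : X :=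
    c.g (p.1, OpenCone.point l ⟨p.2, p.2.2.1.le, p.2.2.2⟩)
  have : PreconnectedSpace (Set.Ioo (0 : ℝ) 1) :=
    isPreconnected_iff_preconnectedSpace.1 isPreconnected_Ioo
  have hf : Continuous f := c.isOpenEmbedding.continuous.comp
    (continuous_fst.prodMk (OpenCone.continuous_point.comp (continuous_const.prodMk
      ((continuous_subtype_val.comp continuous_snd).subtype_mk _))))
  have key (p) (i : ℤ) : f p ∈ F i ↔ -1 ≤ i - k - 1 ∧ l ∈ c.G (i - k - 1) :=
    (c.mem_iff' i _).trans (coneSkel_point p.2.2.1)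
  obtain ⟨m, hm⟩ := hF.exists_mem_layer (f (0, ⟨1 / 2, by norm_num, by norm_num⟩))
  refine ⟨Set.range f, m, isPreconnected_range hf, ?_, fun v t ht => ⟨(v, ⟨t, ht, t.2.2⟩), rfl⟩⟩
  rintro _ ⟨p, rfl⟩
  rwa [layer, Set.mem_sdiff, key, key] at hm ⊢

end ConeChart

end Charts

/-! ### The determinant of `id + t L` as a polynomial in `t`. -/

section Dimension

open MeasureTheory Metric

variable {V : Type*} [NormedAddCommGroup V] [NormedSpace ℝ V] [FiniteDimensional ℝ V]

lemma exists_polynomial_det (L : V →ₗ[ℝ] V) : ∃ q : Polynomial ℝ,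
    q.natDegree ≤ Module.finrank ℝ V ∧ ∀ t, q.eval t = LinearMap.det (LinearMap.id + t • L) := by
  let b := Module.finBasis ℝ V
  let M := LinearMap.toMatrix b b L
  refine ⟨((Polynomial.X : Polynomial ℝ) • M.map Polynomial.C +
    (1 : Matrix _ _ ℝ).map Polynomial.C).det, ?_, fun t => ?_⟩
  · simpa using Polynomial.natDegree_det_X_add_C_le M 1
  · rw [← Polynomial.coe_evalRingHom, RingHom.map_det, ← LinearMap.det_toMatrix b]
    congr 1
    ext i j
    simp [M, add_comm, Matrix.one_apply, apply_ite, mul_comm t]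

/-- The polynomial has degree at most `dim V`, so it is recovered from more than `dim V` nodes by
coefficients independent of `L`. This lets the value at `t = 1` be integrated from values at small
`t`. -/
lemma det_eq_sum_lagrange (L : V →ₗ[ℝ] V) {s : Finset ℕ} {v : ℕ → ℝ} (hv : Set.InjOn v s)
    (hs : Module.finrank ℝ V < s.card) (t : ℝ) : LinearMap.det (LinearMap.id + t • L) =
      ∑ i ∈ s, (Lagrange.basis s v i).eval t * LinearMap.det (LinearMap.id + v i • L) := by
  obtain ⟨q, hq, h⟩ := exists_polynomial_det L
  have hd : q.degree < s.card := Polynomial.degree_le_natDegree.trans_lt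
    (Nat.cast_lt.2 (hq.trans_lt hs))
  rw [← h, Lagrange.eq_interpolate hv hd, Lagrange.interpolate_apply, Polynomial.eval_finsetSum]
  refine Finset.sum_congr rfl fun i _ => ?_
  rw [Polynomial.eval_mul, Polynomial.eval_C, h, mul_comm]

/-- The determinant is `1` at time zero, and a zero on `[0, t]` would give a nonzero `v = -s D v`,
which the norm bound excludes. -/
lemma det_id_add_smul_pos (D : V →L[ℝ] V) {t : ℝ} (ht : 0 ≤ t) (h : t * ‖D‖ < 1) :
    0 < LinearMap.det (LinearMap.id + t • (D : V →ₗ[ℝ] V)) := by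
  obtain ⟨q, -, hq⟩ := exists_polynomial_det (D : V →ₗ[ℝ] V)
  by_contra! hneg
  rw [← hq] at hneg
  have h0 : (0 : ℝ) ≤ q.eval 0 := by simp [hq]
  obtain ⟨s, hs, hs0⟩ := intermediate_value_Icc' ht q.continuous.continuousOn ⟨hneg, h0⟩
  replace hs0 := (hq s).symm.trans hs0
  obtain ⟨v, hv, hv0⟩ := Submodule.exists_mem_ne_zero_of_ne_bot
    (LinearMap.bot_lt_ker_of_det_eq_zero hs0).ne'
  have h1 : v = -(s • D v) := eq_neg_of_add_eq_zero_left hv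
  have h2 : ‖v‖ ≤ s * ‖D‖ * ‖v‖ := by
    conv_lhs => rw [h1, norm_neg, norm_smul, Real.norm_of_nonneg hs.1]
    rw [mul_assoc]
    exact mul_le_mul_of_nonneg_left (D.le_opNorm v) hs.1
  have h3 : s * ‖D‖ < 1 := (mul_le_mul_of_nonneg_right hs.2 (norm_nonneg D)).trans_lt h
  have h4 := norm_pos_iff.2 hv0
  nlinarith

end Dimension

/-! ### The no-retraction theorem by a volume argument. -/

section Retraction

open MeasureTheory Metric

variable {V : Type*} [NormedAddCommGroup V] [InnerProductSpace ℝ V] [FiniteDimensional ℝ V]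

/-- A map that is the identity on the unit sphere becomes Lipschitz if it is replaced by the
identity outside the ball. -/
lemma norm_sub_le_of_eq_zero_on_sphere {V : Type*} [NormedAddCommGroup V] [NormedSpace ℝ V]
    {k : V → V} {M : ℝ} (hM : 0 ≤ M)
    (hk : ∀ x ∈ closedBall (0 : V) 1, ∀ y ∈ closedBall (0 : V) 1, ‖k x - k y‖ ≤ M * ‖x - y‖)
    (h0 : ∀ x, ‖x‖ = 1 → k x = 0) (x y : V) :
    ‖(ball (0 : V) 1).indicator k x - (ball (0 : V) 1).indicator k y‖ ≤ M * ‖x - y‖ := by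
  have key (x y : V) (hx : x ∈ ball (0 : V) 1) (hy : y ∉ ball (0 : V) 1) : ‖k x‖ ≤ M * ‖x - y‖ := by
    rw [mem_ball_zero_iff] at hx hy
    have hy' : 1 ≤ ‖y‖ := not_lt.1 hy
    obtain ⟨z, hz, hxz⟩ : ∃ z : V, ‖z‖ = 1 ∧ ‖x - z‖ ≤ ‖y‖ - ‖x‖ := by
      by_cases hx0 : x = 0
      · have hu : ‖‖y‖⁻¹ • y‖ = 1 :=
          norm_smul_inv_norm (𝕜 := ℝ) (norm_pos_iff.1 (one_pos.trans_le hy'))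
        refine ⟨‖y‖⁻¹ • y, hu, ?_⟩
        rwa [hx0, zero_sub, norm_neg, norm_zero, sub_zero, hu]
      · refine ⟨‖x‖⁻¹ • x, norm_smul_inv_norm (𝕜 := ℝ) hx0, ?_⟩
        have hp := norm_pos_iff.2 hx0
        have h1 : x - ‖x‖⁻¹ • x = (1 - ‖x‖⁻¹) • x := by rw [sub_smul, one_smul]
        rw [h1, norm_smul, Real.norm_of_nonpos (by linarith [one_le_inv_iff₀.2 ⟨hp, hx.le⟩])]
        have : -(1 - ‖x‖⁻¹) * ‖x‖ = 1 - ‖x‖ := by field_simp; ring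
        linarith
    have h1 := hk x (mem_closedBall_zero_iff.2 hx.le) z (mem_closedBall_zero_iff.2 hz.le)
    rw [h0 z hz, sub_zero] at h1
    refine h1.trans (mul_le_mul_of_nonneg_left (hxz.trans ?_) hM)
    rw [norm_sub_rev]
    exact norm_sub_norm_le y x
  by_cases hx : x ∈ ball (0 : V) 1 <;> by_cases hy : y ∈ ball (0 : V) 1
  · rw [Set.indicator_of_mem hx, Set.indicator_of_mem hy]
    exact hk x (ball_subset_closedBall hx) y (ball_subset_closedBall hy)
  · rw [Set.indicator_of_mem hx, Set.indicator_of_notMem hy, sub_zero]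
    exact key x y hx hy
  · rw [Set.indicator_of_notMem hx, Set.indicator_of_mem hy, zero_sub, norm_neg, norm_sub_rev]
    exact key y x hy hx
  · rw [Set.indicator_of_notMem hx, Set.indicator_of_notMem hy, sub_zero, norm_zero]
    positivity

/-- A small perturbation of the identity inside the unit ball is a bijection of the ball. -/
lemma bijOn_ball_of_lipschitz {h : V → V} {c : NNReal} (hc : c < 1)
    (hh : ∀ x y, ‖h x - h y‖ ≤ c * ‖x - y‖) (h0 : ∀ x ∉ ball (0 : V) 1, h x = 0) :
    Set.BijOn (fun x => x + h x) (ball (0 : V) 1) (ball (0 : V) 1) := by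
  have ha : ApproximatesLinearOn (fun x => x + h x) (ContinuousLinearEquiv.refl ℝ V : V →L[ℝ] V)
      Set.univ c := by
    intro x _ y _
    convert hh x y using 2
    simp only [ContinuousLinearEquiv.coe_refl, ContinuousLinearMap.coe_id', id]
    abel
  have hN : Subsingleton V ∨ c < ‖((ContinuousLinearEquiv.refl ℝ V).symm : V →L[ℝ] V)‖₊⁻¹ := by
    rcases subsingleton_or_nontrivial V with hV | hV
    · exact Or.inl hV
    · right
      have : ‖((ContinuousLinearEquiv.refl ℝ V).symm : V →L[ℝ] V)‖₊ = 1 :=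
        NNReal.eq (ContinuousLinearMap.norm_id (𝕜 := ℝ) (E := V))
      rw [this, inv_one]
      exact hc
  let φ := ha.toHomeomorph _ hN
  have hφ (x) : φ x = x + h x := rfl
  -- A bijection of `V` that fixes every point outside the ball must preserve the ball.
  have hout (x) (hx : x ∉ ball (0 : V) 1) : φ x = x := by rw [hφ, h0 x hx, add_zero]
  refine ⟨fun x hx => ?_, φ.injective.injOn, fun y hy => ?_⟩
  · by_contra hx'
    have := φ.injective (hout _ hx')
    exact hx' (this.symm ▸ hx : φ x ∈ _)
  · obtain ⟨x, rfl⟩ := φ.surjective y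
    refine ⟨x, ?_, rfl⟩
    by_contra hx
    rw [hout x hx] at hy
    exact hx hy

/-- Differentiating `‖r‖² = 1` shows that the image of the derivative is orthogonal to `r x ≠ 0`, so
the derivative is not surjective. -/
lemma det_fderiv_eq_zero {r : V → V} (h1 : ∀ x, ‖r x‖ = 1) {x : V} (hr : DifferentiableAt ℝ r x) :
    LinearMap.det (fderiv ℝ r x : V →ₗ[ℝ] V) = 0 := by
  by_contra hdet
  have hu := (LinearMap.isUnit_iff_isUnit_det (fderiv ℝ r x : V →ₗ[ℝ] V)).2 (isUnit_iff_ne_zero.2 hdet)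
  obtain ⟨v, hv⟩ := ((Module.End.isUnit_iff _).1 hu).2 (r x)
  have hd := hr.hasFDerivAt.norm_sq
  have hc : (fun y => ‖r y‖ ^ 2) = fun _ => (1 : ℝ) := by
    funext y
    rw [h1, one_pow]
  rw [hc] at hd
  have := congrArg (fun l => l v) (hd.unique (hasFDerivAt_const _ _))
  have hv' : fderiv ℝ r x v = r x := hv
  simp [hv', h1] at this

/-- There is no continuously differentiable retraction of the ball to its boundary. -/
theorem not_exists_retraction {r : V → V} (hr : ContDiff ℝ 1 r) (h1 : ∀ x, ‖r x‖ = 1)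
    (h2 : ∀ x, ‖x‖ = 1 → r x = x) : False := by
  borelize V
  let k (x : V) : V := r x - x
  have hk : ContDiff ℝ 1 k := hr.sub contDiff_id
  let D (x : V) : V →L[ℝ] V := fderiv ℝ k x
  have hD (x) : HasFDerivAt k (D x) x := (hk.differentiable one_ne_zero x).hasFDerivAt
  obtain ⟨M, hM⟩ := (isCompact_closedBall (0 : V) 1).exists_bound_of_continuousOn
    (hk.continuous_fderiv one_ne_zero).continuousOn
  have hM0 : 0 ≤ M := (norm_nonneg _).trans (hM 0 (mem_closedBall_self zero_le_one))
  have hkL : ∀ x ∈ closedBall (0 : V) 1, ∀ y ∈ closedBall (0 : V) 1,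
      ‖k x - k y‖ ≤ M * ‖x - y‖ := fun x hx y hy =>
    (convex_closedBall (0 : V) 1).norm_image_sub_le_of_norm_fderiv_le
      (fun x _ => hk.differentiable one_ne_zero x) hM hy hx
  have hL := norm_sub_le_of_eq_zero_on_sphere hM0 hkL fun x hx => sub_eq_zero.2 (h2 x hx)
  let B := ball (0 : V) 1
  let μ : Measure V := .addHaar
  -- For small `t` the map `x + t (r x - x)` is a bijection of the ball with positive Jacobian, so
  -- the Jacobian integrates to the volume of the ball.
  have hsmall (t : ℝ) (ht : 0 ≤ t) (htM : t * M < 1) :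
      IntegrableOn (fun x => LinearMap.det (LinearMap.id + t • (D x : V →ₗ[ℝ] V))) B μ ∧
      ∫ x in B, LinearMap.det (LinearMap.id + t • (D x : V →ₗ[ℝ] V)) ∂μ = μ.real B := by
    have hbij : Set.BijOn (fun x => x + t • k x) B B := by
      refine (bijOn_ball_of_lipschitz (h := fun x => t • B.indicator k x)
        (c := ⟨t * M, mul_nonneg ht hM0⟩) htM (fun x y => ?_) fun x hx => ?_).congr fun x hx => ?_
      · rw [← smul_sub, norm_smul, Real.norm_of_nonneg ht]
        exact (mul_le_mul_of_nonneg_left (hL x y) ht).trans_eq (mul_assoc _ _ _).symm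
      · rw [Set.indicator_of_notMem hx, smul_zero]
      · have : B.indicator k x = k x := Set.indicator_of_mem hx k
        simp only [this]
    have hder (x) (_ : x ∈ B) : HasFDerivWithinAt (fun x => x + t • k x)
        (ContinuousLinearMap.id ℝ V + t • D x) B x :=
      ((hasFDerivAt_id x).add ((hD x).const_smul t)).hasFDerivWithinAt
    have hpos (x) (hx : x ∈ B) : |(ContinuousLinearMap.id ℝ V + t • D x).det| • (1 : ℝ) =
        LinearMap.det (LinearMap.id + t • (D x : V →ₗ[ℝ] V)) := by
      rw [smul_eq_mul, mul_one]
      refine abs_of_pos (det_id_add_smul_pos (D x) ht ?_)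
      exact (mul_le_mul_of_nonneg_left (hM x (ball_subset_closedBall hx)) ht).trans_lt htM
    constructor
    · have := (integrableOn_image_iff_integrableOn_abs_det_fderiv_smul μ measurableSet_ball hder
        hbij.injOn (fun _ => (1 : ℝ))).1 (by
          rw [hbij.image_eq]
          exact integrableOn_const measure_ball_lt_top.ne)
      exact this.congr_fun hpos measurableSet_ball
    · have := integral_image_eq_integral_abs_det_fderiv_smul μ measurableSet_ball hder
        hbij.injOn (fun _ => (1 : ℝ))
      rw [setIntegral_congr_fun measurableSet_ball hpos, hbij.image_eq] at this
      rw [← this]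
      simp
  let N := Module.finrank ℝ V + 1
  -- `dim V + 1` distinct nodes, all small enough for `hsmall`.
  let τ (i : ℕ) : ℝ := i * (N * (M + 1))⁻¹
  have hc : 0 < ((N : ℝ) * (M + 1))⁻¹ := by positivity
  have hτ0 (i : ℕ) : 0 ≤ τ i := by positivity
  have hτM (i) (hi : i ∈ Finset.range N) : τ i * M < 1 := by
    have hiN : (i : ℝ) ≤ N := Nat.cast_le.2 (Finset.mem_range.1 hi).le
    have hN : 0 < (N : ℝ) := by positivity
    have hMp : 0 < M + 1 := by positivity
    change i * (N * (M + 1))⁻¹ * M < 1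
    rw [mul_right_comm, ← div_eq_mul_inv, div_lt_one (by positivity)]
    nlinarith
  have hinj : Set.InjOn τ (Finset.range N) := fun i _ j _ hij =>
    Nat.cast_injective (mul_right_cancel₀ hc.ne' hij)
  have hzero (x) : LinearMap.det (LinearMap.id + (1 : ℝ) • (D x : V →ₗ[ℝ] V)) = 0 := by
    have hrx := hr.differentiable one_ne_zero x
    rw [← det_fderiv_eq_zero h1 hrx, one_smul]
    congr 1
    have : D x = fderiv ℝ r x - ContinuousLinearMap.id ℝ V :=
      (hrx.hasFDerivAt.sub (hasFDerivAt_id x)).fderiv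
    rw [this]
    ext v
    simp
  -- At `t = 1` the Jacobian is that of `r`, hence zero. The Lagrange basis polynomials sum to `1`,
  -- so the ball would have volume zero.
  have hint : ∑ i ∈ Finset.range N, (Lagrange.basis (Finset.range N) τ i).eval 1 * μ.real B = 0 := by
    have hsum := fun x => det_eq_sum_lagrange (D x : V →ₗ[ℝ] V) hinj
      (by rw [Finset.card_range]; exact Nat.lt_succ_self _) 1
    have hI := integral_finsetSum (μ := μ.restrict B) (Finset.range N)
      (f := fun i x => (Lagrange.basis (Finset.range N) τ i).eval 1 *
        LinearMap.det (LinearMap.id + τ i • (D x : V →ₗ[ℝ] V)))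
      fun i hi => (hsmall _ (hτ0 i) (hτM i hi)).1.const_mul _
    simp only [← hsum, hzero, integral_zero, integral_const_mul] at hI
    rw [hI]
    exact Finset.sum_congr rfl fun i hi => by rw [(hsmall _ (hτ0 i) (hτM i hi)).2]
  rw [← Finset.sum_mul, ← Polynomial.eval_finsetSum, Lagrange.sum_basis hinj ⟨0, by simp [N]⟩,
    Polynomial.eval_one, one_mul] at hint
  exact (ENNReal.toReal_pos (measure_ball_pos μ _ one_pos).ne' measure_ball_lt_top.ne).ne' hint

end Retraction

/-! ### Invariance of dimension. -/

section Injective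

open Metric

lemma exists_contDiff_dist_lt {V W : Type*} [NormedAddCommGroup V] [NormedSpace ℝ V]
    [FiniteDimensional ℝ V] [NormedAddCommGroup W] [NormedSpace ℝ W] [CompleteSpace W]
    {f : V → W} (hf : Continuous f) {K : Set V} (hK : IsCompact K) {ε : ℝ} (hε : 0 < ε) :
    ∃ g : V → W, ContDiff ℝ 1 g ∧ ∀ x ∈ K, dist (g x) (f x) < ε := by
  obtain ⟨g, hg, h⟩ := (mem_closure_iff_nhds_basis
    (nhds_basis_uniformity Metric.uniformity_basis_dist.compactConvergenceUniformity)).1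
    (ContinuousMap.dense_setOfPred_contDiff (⟨f, hf⟩ : C(V, W))) (K, ε) ⟨hK, hε⟩
  exact ⟨g, ContDiff.of_le (n := ((⊤ : ℕ∞) : WithTop ℕ∞)) hg (by exact_mod_cast le_top), fun x hx => h x hx⟩

variable {V : Type*} [NormedAddCommGroup V] [InnerProductSpace ℝ V] [FiniteDimensional ℝ V]

/-- A continuous map close to the identity of the unit ball has a zero. -/
theorem exists_zero_of_dist_le {ψ : V → V} (hψ : Continuous ψ)
    (h : ∀ x ∈ closedBall (0 : V) 1, dist (ψ x) x ≤ 1 / 2) : ∃ x ∈ closedBall (0 : V) 1, ψ x = 0 := by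
  by_contra! hne
  have hcpt := isCompact_closedBall (0 : V) 1
  obtain ⟨x₀, hx₀, hmin⟩ := hcpt.exists_isMinOn ⟨0, mem_closedBall_self zero_le_one⟩
    hψ.norm.continuousOn
  have hδ : 0 < ‖ψ x₀‖ := norm_pos_iff.2 (hne x₀ hx₀)
  obtain ⟨g, hg, hgψ⟩ := exists_contDiff_dist_lt hψ hcpt (ε := min ‖ψ x₀‖ (1 / 4))
    (lt_min hδ (by norm_num))
  -- Interpolates from `g` inside radius `4/5` to the identity on the sphere. In the collar `g`
  -- moves points by at most `1/2 + 1/4 = 3/4 < 4/5`, so the interpolation has no zero there either.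
  let χ : ContDiffBump (0 : V) := ⟨4 / 5, 1, by norm_num, by norm_num⟩
  let Ψ (x : V) : V := x + χ x • (g x - x)
  have hΨ : ContDiff ℝ 1 Ψ :=
    contDiff_id.add (χ.contDiff.smul (hg.sub contDiff_id))
  have hout (x : V) (hx : 1 ≤ ‖x‖) : Ψ x = x := by
    have : χ x = 0 := χ.zero_of_le_dist (by simpa using hx)
    simp [Ψ, this]
  have hΨ0 (x : V) : Ψ x ≠ 0 := by
    intro h0
    rcases le_or_gt 1 ‖x‖ with hx | hx
    · rw [hout x hx] at h0
      rw [h0, norm_zero] at hx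
      linarith
    have hxb : x ∈ closedBall (0 : V) 1 := mem_closedBall_zero_iff.2 hx.le
    rcases le_or_gt ‖x‖ (4 / 5) with hx' | hx'
    · have hχ : χ x = 1 := χ.one_of_mem_closedBall (mem_closedBall_zero_iff.2 hx')
      have hgx : g x = 0 := by simpa [Ψ, hχ] using h0
      have h1 := (hgψ x hxb).trans_le (min_le_left _ _)
      rw [hgx, dist_zero_left] at h1
      exact absurd (hmin hxb) (not_le.2 h1)
    · have h1 : ‖g x - x‖ ≤ 3 / 4 := by
        rw [← dist_eq_norm]
        have := (hgψ x hxb).trans_le (min_le_right _ _)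
        linarith [dist_triangle (g x) (ψ x) x, h x hxb]
      have h2 : ‖χ x • (g x - x)‖ ≤ 3 / 4 := by
        rw [norm_smul, Real.norm_of_nonneg χ.nonneg]
        exact (mul_le_of_le_one_left (norm_nonneg _) χ.le_one).trans h1
      rw [eq_neg_of_add_eq_zero_left h0, norm_neg] at hx'
      linarith
  refine not_exists_retraction (r := fun x => ‖Ψ x‖⁻¹ • Ψ x) ?_
    (fun x => norm_smul_inv_norm (𝕜 := ℝ) (hΨ0 x)) fun x hx => ?_
  · exact ((hΨ.norm ℝ hΨ0).inv fun x => norm_ne_zero_iff.2 (hΨ0 x)).smul hΨ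
  · simp only [hout x hx.ge, hx, inv_one, one_smul]

/-- If `n < m`, the inverse of `f` on the image of the ball extends continuously (Tietze) and is
approximated by a smooth `P : ℝ^n → ℝ^m`, whose range has dense complement. Subtracting a small
value `a` missed by `P` from `P ∘ f` gives a map near the identity without zeros. -/
theorem le_of_continuous_injective {m n : ℕ}
    {f : EuclideanSpace ℝ (Fin m) → EuclideanSpace ℝ (Fin n)} (hf : Continuous f)
    (hi : Function.Injective f) : m ≤ n := by
  by_contra! hnm
  let B := closedBall (0 : EuclideanSpace ℝ (Fin m)) 1
  have hB : IsCompact B := isCompact_closedBall _ _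
  have : CompactSpace B := isCompact_iff_compactSpace.1 hB
  have he : IsClosedEmbedding fun x : B => f x :=
    (hf.comp continuous_subtype_val).isClosedEmbedding (hi.comp Subtype.val_injective)
  obtain ⟨G, hG⟩ := ContinuousMap.exists_extension he
    (⟨Subtype.val, continuous_subtype_val⟩ : C(B, EuclideanSpace ℝ (Fin m)))
  obtain ⟨P, hP, hPG⟩ := exists_contDiff_dist_lt G.continuous (hB.image hf)
    (ε := 1 / 4) (by norm_num)
  obtain ⟨a, ha, ha'⟩ := (hP.dense_compl_range_of_finrank_lt_finrank (by simpa)).exists_dist_lt 0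
    (ε := 1 / 4) (by norm_num)
  obtain ⟨x, -, hx⟩ := exists_zero_of_dist_le (ψ := fun x => P (f x) - a)
    ((hP.continuous.comp hf).sub continuous_const) fun x hx => by
      have h1 := hPG (f x) ⟨x, hx, rfl⟩
      have h2 : G (f x) = x := congrArg (fun g : C(B, _) => g ⟨x, hx⟩) hG
      rw [h2] at h1
      rw [dist_eq_norm] at h1 ha' ⊢
      rw [zero_sub, norm_neg] at ha'
      have := norm_sub_le (P (f x) - x) a
      rw [sub_right_comm]
      linarith
  exact ha ⟨f x, sub_eq_zero.1 hx⟩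

end Injective

/-! ### The intrinsic stratification and its properties. -/

section Intrinsic

variable {R : Type u} [CommRing R] {X : Type u} [TopologicalSpace X] {n : ℕ} {F : ℤ → Set X}
variable {U : Opens X} {E : SheafComplex R U} {C : Set X}

lemma ConeChart.locEquiv {k : ℕ} {x : X} (c : ConeChart n F k x) {d : ℤ} (hF : IsFiltration d F)
    (hU : IsUnionOfStrata F (U : Set X)) (hC : IsUnionOfStrata F C)
    (hE : IsTSCoefficientSystem E) (v v' : EuclideanSpace ℝ (Fin k)) (q : OpenCone c.L) :
    LocEquiv U E C (c.g (v, q)) (c.g (v', q)) :=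
  LocEquiv.translate hE.hasFrameAt hE.isZero c.isOpenEmbedding (c.mem_union_iff hF hU)
    (c.mem_union_iff hF hC) v v' q

/-- Nearby points of the layer are the points over the vertex in a cone chart, and translations
relate them; connectedness of `T` does the rest. -/
lemma IsCSSet.locEquiv (hF : IsCSSet n F) (hU : IsUnionOfStrata F (U : Set X))
    (hC : IsUnionOfStrata F C) (hE : IsTSCoefficientSystem E) {k : ℤ} {T : Set X}
    (hT : IsPreconnected T) (hTk : T ⊆ layer F k) {x y : X} (hx : x ∈ T) (hy : y ∈ T) :
    LocEquiv U E C x y := by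
  lift k to ℕ using hF.filtration.nonneg_of_mem_layer (hTk hx)
  refine hT.induction₂ (LocEquiv U E C) (fun x hx => ?_) (fun _ _ _ _ _ _ => LocEquiv.trans)
    (fun _ _ _ _ => LocEquiv.symm) hx hy
  obtain ⟨c⟩ := hF.exists_coneChart (hTk hx)
  filter_upwards [inter_mem_nhdsWithin T (c.isOpenEmbedding.isOpen_range.mem_nhds ⟨_, c.base⟩)]
  rintro _ ⟨hy, ⟨v, q⟩, rfl⟩
  obtain rfl : q = _ := (c.mem_layer_iff _).1 (hTk hy)
  have := c.locEquiv hF.filtration hU hC hE 0 v (OpenCone.vertex c.L)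
  rwa [c.base] at this

lemma intrinsic_subset (i : ℤ) : intrinsic U E C F i ⊆ F i := fun x hx => hx (LocEquiv.refl x)

lemma LocEquiv.mem_intrinsic_iff {x y : X} (h : LocEquiv U E C x y) {i : ℤ} :
    x ∈ intrinsic U E C F i ↔ y ∈ intrinsic U E C F i :=
  ⟨fun hx _ hz => hx (h.trans hz), fun hy _ hz => hy (h.symm.trans hz)⟩

lemma LocEquiv.mem_layer_intrinsic_iff {x y : X} (h : LocEquiv U E C x y) {i : ℤ} :
    x ∈ layer (intrinsic U E C F) i ↔ y ∈ layer (intrinsic U E C F) i :=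
  and_congr h.mem_intrinsic_iff h.mem_intrinsic_iff.not

lemma IsFiltration.intrinsic {d : ℤ} (hF : IsFiltration d F) :
    IsFiltration d (intrinsic U E C F) where
  closed i := by
    rw [← isOpen_compl_iff, isOpen_iff_mem_nhds]
    intro x hx
    obtain ⟨y, hxy, hy⟩ := Set.not_subset.1 hx
    obtain ⟨D⟩ := LocEquiv.exists_data hxy
    -- If the class of `x` leaves `F i` at `y`, the equivalence carries points near `x` to points
    -- near `y`, which are also outside `F i`.
    refine Filter.mem_of_superset ((D.hf.isOpenMap _ ((hF.closed i).isOpen_compl.preimage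
      D.hg.continuous)).mem_nhds ⟨D.y₀, ?_, D.f_y₀⟩) ?_
    · rwa [Set.mem_preimage, D.g_y₀]
    · rintro _ ⟨z, hz, rfl⟩ h
      exact hz (h (D.locEquiv z))
  mono i j hij x hx := hx.trans (hF.mono hij)
  neg i hi := Set.subset_empty_iff.1 ((intrinsic_subset i).trans (hF.neg i hi).subset)
  top := Set.eq_univ_of_forall fun x y _ => by
    rw [hF.top]
    trivial

lemma mem_layer_intrinsic {x : X} {k : ℤ} :
    x ∈ layer (intrinsic U E C F) k ↔
      x ∈ intrinsic U E C F k ∧ ∃ y ∈ layer F k, LocEquiv U E C x y := by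
  refine and_congr_right fun hx => ?_
  constructor
  · intro h
    obtain ⟨y, hxy, hy⟩ := Set.not_subset.1 h
    exact ⟨y, ⟨hx hxy, hy⟩, hxy⟩
  · rintro ⟨y, hy, hxy⟩ h
    exact hy.2 (h hxy)

/-- Here `y` lies on a stratum of the largest dimension occurring in its class, so the chart for `F`
still has the right dimension. Intrinsic skeleta lie in those of `F` and are constant along `ℝ^k`
and along rays, so they are cones over subsets of the old link. -/
lemma IsCSSet.coneChart_intrinsic_of_mem (hF : IsCSSet n F) (hU : IsUnionOfStrata F (U : Set X))
    (hC : IsUnionOfStrata F C) (hE : IsTSCoefficientSystem E) {k : ℕ} {y : X}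
    (hy : y ∈ layer F k) (hyk : y ∈ intrinsic U E C F k) :
    Nonempty (ConeChart n (intrinsic U E C F) k y) := by
  obtain ⟨c⟩ := hF.exists_coneChart hy
  have hI : IsFiltration n (intrinsic U E C F) := hF.filtration.intrinsic
  have hv (v) : LocEquiv U E C y (c.g (v, OpenCone.vertex c.L)) := by
    have := c.locEquiv hF.filtration hU hC hE 0 v (OpenCone.vertex c.L)
    rwa [c.base] at this
  have hk (p) : c.g p ∈ intrinsic U E C F k → p.2 = OpenCone.vertex c.L := fun hp =>
    (c.mem_skel_iff p).1 (intrinsic_subset _ hp)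
  -- Such a point would lie over the vertex, hence be equivalent to `y`, which is not in `F (k -
  -- 1)`.
  have hneg (p) (i : ℤ) (hi : i < k) : c.g p ∉ intrinsic U E C F i := by
    intro hp
    obtain ⟨v, q⟩ := p
    obtain rfl : q = _ := hk _ (hI.mono hi.le hp)
    exact hy.2 (hF.filtration.mono (by omega) (hp (hv v).symm))
  have hray (l) (v v') (t t' : Set.Ico (0 : ℝ) 1) (ht : 0 < (t : ℝ)) (ht' : 0 < (t' : ℝ)) :
      LocEquiv U E C (c.g (v, OpenCone.point l t)) (c.g (v', OpenCone.point l t')) := by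
    obtain ⟨T, m, hT, hTm, h⟩ := c.exists_ray hF.filtration l
    exact hF.locEquiv hU hC hE hT hTm (h v t ht) (h v' t' ht')
  let r : Set.Ico (0 : ℝ) 1 := ⟨1 / 2, by norm_num, by norm_num⟩
  have hr : 0 < (r : ℝ) := one_half_pos
  -- The link is placed at height `1/2`; by `hray` any positive height gives the same filtration.
  let G (j : ℤ) : Set c.L := {l | c.g (0, OpenCone.point l r) ∈ intrinsic U E C F (k + j + 1)}
  refine ⟨{ L := c.L, G := G, g := c.g, isOpenEmbedding := c.isOpenEmbedding, base := c.base,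
            filtration := ⟨fun j => ?_, fun i j hij l hl => hI.mono (by omega) hl, fun j hj => ?_,
              Set.eq_univ_of_forall fun l => ?_⟩
            mem_iff := fun j p => ?_ }⟩
  · exact (hI.closed _).preimage (c.isOpenEmbedding.continuous.comp (continuous_const.prodMk
      (OpenCone.continuous_point.comp (continuous_id.prodMk continuous_const))))
  · refine Set.eq_empty_of_forall_notMem fun l hl => ?_
    have := hk _ (hI.mono (by omega) hl)
    exact hr.ne' (OpenCone.point_eq_vertex.1 this)
  · change c.g _ ∈ intrinsic U E C F _
    rw [show (k : ℤ) + (n - k - 1) + 1 = n by ring, hI.top]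
    trivial
  · obtain ⟨v, q⟩ := p
    rcases q.cases with rfl | ⟨l, t, ht, rfl⟩
    · rw [coneSkel_vertex]
      constructor
      · intro h
        by_contra hj
        exact hneg _ _ (by omega) h
      · intro hj
        exact hI.mono (by omega) ((hv v).mem_intrinsic_iff.1 hyk)
    · rw [coneSkel_point ht, (hray l v 0 t r ht hr).mem_intrinsic_iff]
      refine (and_iff_right_of_imp fun h => ?_).symm
      by_contra hj
      exact hneg _ _ (by omega) h

lemma IsCSSet.coneChart_intrinsic (hF : IsCSSet n F) (hU : IsUnionOfStrata F (U : Set X))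
    (hC : IsUnionOfStrata F C) (hE : IsTSCoefficientSystem E) {k : ℕ} {x : X}
    (hx : x ∈ layer (intrinsic U E C F) k) :
    Nonempty (ConeChart n (intrinsic U E C F) k x) := by
  obtain ⟨hxk, y, hy, hxy⟩ := mem_layer_intrinsic.1 hx
  obtain ⟨c⟩ := hF.coneChart_intrinsic_of_mem hU hC hE hy (hxy.mem_intrinsic_iff.1 hxk)
  obtain ⟨D⟩ := hxy.exists_data
  have := c.transport D.hg D.hf D.g_y₀ fun i z => (D.locEquiv z).mem_intrinsic_iff.symm
  rwa [D.f_y₀] at this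

/-- The equivalence classes are open in the layers of the intrinsic stratification. -/
lemma IsCSSet.eventually_locEquiv (hF : IsCSSet n F) (hU : IsUnionOfStrata F (U : Set X))
    (hC : IsUnionOfStrata F C) (hE : IsTSCoefficientSystem E) {k : ℤ} {x : X}
    (hx : x ∈ layer (intrinsic U E C F) k) :
    ∀ᶠ y in 𝓝[layer (intrinsic U E C F) k] x, LocEquiv U E C x y := by
  obtain ⟨hxk, y, hy, hxy⟩ := mem_layer_intrinsic.1 hx
  lift k to ℕ using hF.filtration.nonneg_of_mem_layer hy
  obtain ⟨c⟩ := hF.exists_coneChart hy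
  obtain ⟨D⟩ := hxy.exists_data
  have hN := (D.hf.isOpenMap _ (c.isOpenEmbedding.isOpen_range.preimage D.hg.continuous)).mem_nhds
    ⟨D.y₀, ⟨_, c.base.trans D.g_y₀.symm⟩, D.f_y₀⟩
  filter_upwards [inter_mem_nhdsWithin _ hN]
  rintro _ ⟨hz, z, ⟨⟨v, q⟩, hp⟩, rfl⟩
  -- The image near `y` lies in the intrinsic `k`-skeleton, hence in `F k`, hence over the vertex of
  -- the chart.
  have hz' := intrinsic_subset _ ((D.locEquiv z).mem_intrinsic_iff.1 hz.1)
  rw [← hp, c.mem_skel_iff] at hz'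
  change q = _ at hz'
  subst hz'
  have := c.locEquiv hF.filtration hU hC hE 0 v (OpenCone.vertex c.L)
  rw [c.base, hp] at this
  exact hxy.trans (this.trans (D.locEquiv z).symm)

lemma IsCSSet.locEquiv_intrinsic (hF : IsCSSet n F) (hU : IsUnionOfStrata F (U : Set X))
    (hC : IsUnionOfStrata F C) (hE : IsTSCoefficientSystem E) {k : ℤ} {T : Set X}
    (hT : IsPreconnected T) (hTk : T ⊆ layer (intrinsic U E C F) k) {x y : X} (hx : x ∈ T)
    (hy : y ∈ T) : LocEquiv U E C x y :=
  hT.induction₂ (LocEquiv U E C)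
    (fun _ hx => nhdsWithin_mono _ hTk (hF.eventually_locEquiv hU hC hE (hTk hx)))
    (fun _ _ _ _ _ _ => LocEquiv.trans) (fun _ _ _ _ => LocEquiv.symm) hx hy

lemma IsCSSet.intrinsic (hF : IsCSSet n F) (hU : IsUnionOfStrata F (U : Set X))
    (hC : IsUnionOfStrata F C) (hE : IsTSCoefficientSystem E) :
    IsCSSet n (intrinsic U E C F) where
  filtration := hF.filtration.intrinsic
  manifold _ := isManifoldSet_layer fun _ hx => hF.coneChart_intrinsic hU hC hE hx
  local_cone _ _ hx := (hF.coneChart_intrinsic hU hC hE hx).some.hasDistinguishedNhd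
  dense := hF.dense.mono (Set.compl_subset_compl.2 (intrinsic_subset _))

lemma IsCSSet.isUnionOfStrata_intrinsic (hF : IsCSSet n F) (hU : IsUnionOfStrata F (U : Set X))
    (hC : IsUnionOfStrata F C) (hE : IsTSCoefficientSystem E) {A : Set X}
    (hA : ∀ x y, LocEquiv U E C x y → x ∈ A → y ∈ A) :
    IsUnionOfStrata (IntrinsicStrat.intrinsic U E C F) A :=
  .of_preconnected (hF.filtration.intrinsic) fun _ _ hT hTk x hx y hy =>
    hA x y (hF.locEquiv_intrinsic hU hC hE hT hTk hx hy)

/-- A connected subset of a layer of `F'` lies in one class, so in one intrinsic layer and then in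
one component of it. -/
lemma refines_intrinsic (hE : IsTSCoefficientSystem E) {F' : ℤ → Set X}
    (hF' : IsCSSet n F') (hU' : IsUnionOfStrata F' (U : Set X)) (hC' : IsUnionOfStrata F' C) :
    Refines F' (intrinsic U E C F) := by
  rintro _ ⟨k, x, hx, rfl⟩
  refine .of_preconnected hF'.filtration fun m T hT hTm y hy z hz hyS => ?_
  have hTk : T ⊆ layer (IntrinsicStrat.intrinsic U E C F) k := fun w hw =>
    (hF'.locEquiv hU' hC' hE hT hTm hy hw).mem_layer_intrinsic_iff.1
      (connectedComponentIn_subset _ _ hyS)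
  rw [connectedComponentIn_eq hyS]
  exact hT.subset_connectedComponentIn hy hTk hz

/-- The points near `x` in its intrinsic layer for `F` are equivalent to `x`, and the relation does
not involve the stratification, so they lie in the intrinsic `k'`-layer for `F'`. A `k`-disc thus
injects into `ℝ^k'`. -/
lemma dim_le_of_mem_layer_intrinsic {F' : ℤ → Set X} (hF : IsCSSet n F)
    (hU : IsUnionOfStrata F (U : Set X)) (hC : IsUnionOfStrata F C) (hE : IsTSCoefficientSystem E)
    (hF' : IsCSSet n F') (hU' : IsUnionOfStrata F' (U : Set X)) (hC' : IsUnionOfStrata F' C)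
    {x : X} {k k' : ℕ} (hx : x ∈ layer (intrinsic U E C F) k)
    (hx' : x ∈ layer (intrinsic U E C F') k') : k ≤ k' := by
  obtain ⟨a⟩ := hF.coneChart_intrinsic hU hC hE hx
  obtain ⟨b⟩ := hF'.coneChart_intrinsic hU' hC' hE hx'
  have ha : Continuous fun v => (a.layerMap v : X) :=
    continuous_subtype_val.comp a.isOpenEmbedding_layerMap.continuous
  have h := hF.eventually_locEquiv hU hC hE hx
  obtain ⟨N, hN, hxN, hNx⟩ := mem_nhdsWithin.1 h
  obtain ⟨β, hβ, h0, hβN⟩ := exists_univ_chart 0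
    ((hN.preimage ha).inter (b.isOpenEmbedding.isOpen_range.preimage ha))
    ⟨by rwa [Set.mem_preimage, a.layerMap_zero], ⟨_, b.base.trans a.layerMap_zero.symm⟩⟩
  have hβ' (v) : (a.layerMap (β v) : X) ∈ layer (intrinsic U E C F') k' :=
    (LocEquiv.mem_layer_intrinsic_iff (hNx ⟨(hβN v).1, (a.layerMap (β v)).2⟩)).1 hx'
  have hb (v) : (⟨a.layerMap (β v), hβ' v⟩ : layer (intrinsic U E C F') k') ∈
      Set.range b.layerMap := by
    obtain ⟨⟨w, q⟩, hw⟩ := (hβN v).2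
    obtain rfl : q = _ := (b.mem_layer_iff _).1 (show b.g (w, q) ∈ _ from hw.symm ▸ hβ' v)
    exact ⟨w, Subtype.ext hw⟩
  let ψ := b.isOpenEmbedding_layerMap.isEmbedding.toHomeomorph
  have hβo := β.isOpenEmbedding hβ
  refine le_of_continuous_injective (f := fun v => ψ.symm ⟨_, hb v⟩)
    (ψ.symm.continuous.comp (((ha.comp hβo.continuous).subtype_mk _).subtype_mk _)) ?_
  intro v w hvw
  have := ψ.symm.injective hvw
  rw [Subtype.mk.injEq, Subtype.mk.injEq] at this
  exact hβo.injective (a.isOpenEmbedding_layerMap.injective (Subtype.ext this))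

lemma intrinsic_eq {F' : ℤ → Set X} (hF : IsCSSet n F)
    (hU : IsUnionOfStrata F (U : Set X)) (hC : IsUnionOfStrata F C) (hE : IsTSCoefficientSystem E)
    (hF' : IsCSSet n F') (hU' : IsUnionOfStrata F' (U : Set X)) (hC' : IsUnionOfStrata F' C) :
    intrinsic U E C F' = intrinsic U E C F := by
  have hI : IsFiltration n (intrinsic U E C F) := hF.filtration.intrinsic
  have hI' : IsFiltration n (intrinsic U E C F') := hF'.filtration.intrinsic
  have key {G : ℤ → Set X} (hG : IsFiltration n G) {x : X} {k : ℤ} (hx : x ∈ layer G k) (i : ℤ) :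
      x ∈ G i ↔ k ≤ i := by
    constructor
    · intro h
      by_contra hi
      exact hx.2 (hG.mono (by omega) h)
    · exact fun h => hG.mono h hx.1
  ext i x
  obtain ⟨k, hk⟩ := hI.exists_mem_layer x
  obtain ⟨k', hk'⟩ := hI'.exists_mem_layer x
  have h1 := dim_le_of_mem_layer_intrinsic hF hU hC hE hF' hU' hC' hk hk'
  have h2 := dim_le_of_mem_layer_intrinsic hF' hU' hC' hE hF hU hC hk' hk
  rw [key hI hk, key hI' hk', le_antisymm h1 h2]

/-- A point of `U \ C` has a Euclidean neighborhood inside `U \ C`. Translations make it equivalent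
to a point of the dense top stratum of `F`. Conversely, a class that meets this top stratum lies in
`U` and avoids `C`. -/
lemma compl_intrinsic (hF : IsCSSet n F) (hUF : FullyAdapted n F U)
    (hUn : IsManifoldSet n (U : Set X)) (hE : IsTSCoefficientSystem E) (hC : IsClosed C)
    (hCF : C ⊆ F ((n : ℤ) - 1)) :
    (intrinsic U E C F ((n : ℤ) - 1))ᶜ = (U : Set X) \ C := by
  ext x
  constructor
  · intro hx
    obtain ⟨y, hxy, hy⟩ := Set.not_subset.1 hx
    exact ⟨(LocEquiv.mem_open_iff hxy).2 (hUF.1 hy), fun h => hy (hCF ((LocEquiv.mem_iff hxy).1 h))⟩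
  · rintro ⟨hxU, hxC⟩ h
    obtain ⟨hUn⟩ := hUn
    obtain ⟨e, he, he0, heC⟩ := exists_isOpenEmbedding_of_chartedSpace (k := n)
      (⟨x, hxU⟩ : U) (hC.isOpen_compl.preimage continuous_subtype_val) hxC
    have he' : IsOpenEmbedding fun v => (e v : X) := U.isOpenEmbedding'.comp he
    have hg : IsOpenEmbedding fun p : EuclideanSpace ℝ (Fin n) × PUnit.{u + 1} => (e p.1 : X) :=
      he'.comp (Homeomorph.prodPUnit _).isOpenEmbedding
    obtain ⟨_, hy, v, rfl⟩ := hF.dense.exists_mem_open he'.isOpen_range ⟨_, 0, rfl⟩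
    have := LocEquiv.translate (C := C) hE.hasFrameAt hE.isZero hg (ZU := Set.univ) (ZC := ∅)
      (fun p => iff_of_true (e p.1).2 trivial) (fun p => iff_of_false (heC p.1) id) 0 v ⟨⟩
    simp only [he0] at this
    exact hy (h this)

lemma IsUnionOfSingularStrata.isUnionOfStrata (h : IsUnionOfSingularStrata n F C) :
    IsUnionOfStrata F C := by
  obtain ⟨𝒮, h𝒮, rfl⟩ := h
  exact ⟨𝒮, fun S hS => (h𝒮 S hS).imp fun _ h => h.2, rfl⟩

lemma IsUnionOfSingularStrata.subset {d : ℤ} (hF : IsFiltration d F)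
    (h : IsUnionOfSingularStrata n F C) : C ⊆ F ((n : ℤ) - 1) := by
  obtain ⟨𝒮, h𝒮, rfl⟩ := h
  refine Set.sUnion_subset fun S hS => ?_
  obtain ⟨k, hk, x, hx, rfl⟩ := h𝒮 S hS
  exact (connectedComponentIn_subset _ _).trans (Set.sdiff_subset.trans (hF.mono hk))

lemma IsUnionOfStrata.isUnionOfSingularStrata {d : ℤ} (hF : IsFiltration d F)
    (h : IsUnionOfStrata F C) (hC : C ⊆ F ((n : ℤ) - 1)) : IsUnionOfSingularStrata n F C := by
  obtain ⟨𝒮, h𝒮, rfl⟩ := h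
  refine ⟨𝒮, fun S hS => ?_, rfl⟩
  obtain ⟨k, x, hx, rfl⟩ := h𝒮 S hS
  refine ⟨k, ?_, x, hx, rfl⟩
  by_contra hk
  exact hx.2 (hF.mono (by omega) (hC ⟨_, hS, mem_connectedComponentIn hx⟩))

lemma closureCodim_eq (n : ℕ) (F : ℤ → Set X) (k : ℕ) :
    closureCodim n F k = closure (layer F ((n : ℤ) - k)) := by
  rw [closureCodim]
  congr 1
  ext x
  constructor
  · rintro ⟨_, ⟨y, hy, rfl⟩, hx⟩
    exact connectedComponentIn_subset _ _ hx
  · exact fun hx => ⟨_, ⟨x, hx, rfl⟩, mem_connectedComponentIn hx⟩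

/-- In a cone chart a layer is a product with `ℝ^k`, so its closure is one too, and membership is
constant over the vertex. -/
lemma IsCSSet.isUnionOfStrata_closure_layer (hF : IsCSSet n F) (m : ℤ) :
    IsUnionOfStrata F (closure (layer F m)) := by
  refine .of_preconnected hF.filtration fun k T hT hTk x hx y hy => Iff.mp ?_
  lift k to ℕ using hF.filtration.nonneg_of_mem_layer (hTk hx)
  refine hT.induction₂ (fun x y => x ∈ closure (layer F m) ↔ y ∈ closure (layer F m))
    (fun x hx => ?_) (fun _ _ _ _ _ _ => Iff.trans) (fun _ _ _ _ => Iff.symm) hx hy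
  obtain ⟨c⟩ := hF.exists_coneChart (hTk hx)
  filter_upwards [inter_mem_nhdsWithin T (c.isOpenEmbedding.isOpen_range.mem_nhds ⟨_, c.base⟩)]
  rintro _ ⟨hy, ⟨v, q⟩, rfl⟩
  obtain rfl : q = _ := (c.mem_layer_iff _).1 (hTk hy)
  have h1 : c.g ⁻¹' layer F m = Set.univ ×ˢ
      (coneSkel c.G (m - k - 1) \ coneSkel c.G (m - 1 - k - 1)) := by
    ext p
    rw [Set.mem_preimage, layer, Set.mem_sdiff, c.mem_iff', c.mem_iff', Set.mem_prod]
    exact (and_iff_right trivial).symm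
  have h2 (p) : c.g p ∈ closure (layer F m) ↔
      p.2 ∈ closure (coneSkel c.G (m - k - 1) \ coneSkel c.G (m - 1 - k - 1)) := by
    rw [← Set.mem_preimage, c.isOpenEmbedding.isOpenMap.preimage_closure_eq_closure_preimage
      c.isOpenEmbedding.continuous, h1, closure_prod_eq, closure_univ, Set.mem_prod]
    exact and_iff_right trivial
  have := (h2 (0, OpenCone.vertex c.L)).trans (h2 (v, OpenCone.vertex c.L)).symm
  rwa [c.base] at this

/-- The relation preserves the closed set, which lies in `F m`. So the class of a point of the old
layer stays in `F m`, and the point remains in the layer; conversely, a new layer point is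
equivalent to an old one and lies in the closed set. -/
lemma closure_layer_intrinsic {d : ℤ} (hF : IsFiltration d F) (m : ℤ) :
    closure (layer (intrinsic U E (closure (layer F m)) F) m) = closure (layer F m) := by
  refine Set.Subset.antisymm (closure_minimal (fun x hx => ?_) isClosed_closure)
    (closure_mono fun x hx => ?_)
  · obtain ⟨-, y, hy, hxy⟩ := mem_layer_intrinsic.1 hx
    exact hxy.mem_iff.2 (subset_closure hy)
  · refine mem_layer_intrinsic.2 ⟨fun y hy => ?_, x, hx, .refl x⟩
    exact closure_minimal Set.sdiff_subset (hF.closed m) (LocEquiv.mem_iff hy |>.1 (subset_closure hx))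

end Intrinsic

end IntrinsicStrat

end

open IntrinsicStrat in
theorem mainTheorem6 {R : Type u} [CommRing R] [IsDomain R] [IsPrincipalIdealRing R]
    {X : Type u} [TopologicalSpace X] [T2Space X] [ParacompactSpace X]
    (n : ℕ) (F : ℤ → Set X) (hF : IsCSSet n F)
    (U : TopologicalSpace.Opens X) (E : SheafComplex R U)
    (hE : IsMaximalTSCoefficientSystem n U E) (hFE : FullyAdapted n F U) :
    (∀ C : Set X, IsClosed C → IsUnionOfSingularStrata n F C →
      IsCSSet n (intrinsic U E C F) ∧
      (∀ S, IsStratum (intrinsic U E C F) S → ∀ x ∈ S, ∀ y ∈ S, LocEquiv U E C x y) ∧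
      IsUnionOfStrata (intrinsic U E C F) C ∧
      (intrinsic U E C F ((n : ℤ) - 1))ᶜ = (U : Set X) \ C ∧
      FullyAdapted n (intrinsic U E C F) U ∧
      (∀ F' : ℤ → Set X, IsCSSet n F' → FullyAdapted n F' U → IsUnionOfStrata F' C →
        intrinsic U E C F' = intrinsic U E C F ∧ Refines F' (intrinsic U E C F))) ∧
    (∀ k : ℕ, 1 ≤ k →
      IsUnionOfSingularStrata n F (closureCodim n F k) ∧
      closureCodim n (intrinsic U E (closureCodim n F k) F) k = closureCodim n F k) := by
  refine ⟨fun C hC hCF => ?_, fun k hk => ⟨?_, ?_⟩⟩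
  · have hC' := hCF.isUnionOfStrata
    have h4 := compl_intrinsic hF hFE hE.manifold hE.coeff hC (hCF.subset hF.filtration)
    refine ⟨hF.intrinsic hFE.2 hC' hE.coeff, ?_,
      hF.isUnionOfStrata_intrinsic hFE.2 hC' hE.coeff fun x y h => h.mem_iff.1, h4,
      ⟨h4.trans_subset Set.sdiff_subset,
        hF.isUnionOfStrata_intrinsic hFE.2 hC' hE.coeff fun x y h => h.mem_open_iff.1⟩,
      fun F' hF' hFE' hCF' => ⟨intrinsic_eq hF hFE.2 hC' hE.coeff hF' hFE'.2 hCF',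
        refines_intrinsic hE.coeff hF' hFE'.2 hCF'⟩⟩
    rintro _ ⟨k, x, hx, rfl⟩ y hy z hz
    exact hF.locEquiv_intrinsic hFE.2 hC' hE.coeff isPreconnected_connectedComponentIn
      (connectedComponentIn_subset _ _) hy hz
  · rw [closureCodim_eq]
    refine (hF.isUnionOfStrata_closure_layer _).isUnionOfSingularStrata hF.filtration ?_
    exact closure_minimal (Set.sdiff_subset.trans (hF.filtration.mono (by omega)))
      (hF.filtration.closed _)
  · rw [closureCodim_eq, closureCodim_eq]
    exact closure_layer_intrinsic hF.filtration _
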